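/- **Setting.** An oriented virtual link diagram $D$ is an immersion of one or several oriented circles in the oriented plane with transverse double points, each being a classical crossing or a virtual crossing; an oriented virtual link is an equivalence class of such diagrams under the generalized Reidemeister moves. The writhe $\omega(D)$ is the number of positive minus the number of negative classical crossings, and the Kauffman bracket $\langle D\rangle\in\mathbb Z[q,q^{-1}]$ of the underlying unoriented diagram is determined by $\langle D\rangle=q\langle D_0\rangle+q^{-1}\langle D_1\rangle$ at every classical crossing (where $D_0$ is the smoothing that joins the two regions swept by the over strand when it rotates counterclockwise, and $D_1$ the one that joins the two other regions), the value of $m\ge 1$ circles without classical crossings being $(-q^2-q^{-2})^{m-1}$. The Jones-Kauffman polynomial of a virtual link $L$ is $f_L(q)=(-q)^{-3\omega(D_0)}\langle D_0\rangle$ for any diagram $D_0$ of $L$. The shadow graph $G$ of $D$ is the 4-valent graph drawn in the plane whose vertices are the classical crossings of $D$, the virtual crossings being virtual double points. A checkerboard coloring of $G$ colors one side of each edge such that near each vertex the four regions are alternately colored and uncolored and such that the coloring goes straight through virtual double points; $D$ is checkerboard-colorable if such a coloring exists. Given a coloring, orient each edge so that its colored side is on its left; then incoming and outgoing edge ends alternate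 around each vertex. Give a vertex the sign $+$ if the regions swept by the over strand when it rotates counterclockwise are colored, and $-$ otherwise. Label the vertices $v_1,\dots,v_n$. Suppose first that $G$ is connected (as a graph, the strands at a virtual double point not being connected). Let $\gamma$ be an Euler circuit of the directed graph $G$ (up to the choice of the starting point). Two distinct vertices interlace in $\gamma$ if $\gamma$ visits them in alternating cyclic order. The vertex $v_i$ is live if all vertices interlacing with it have labels greater than $i$, and dead otherwise. Separating the two passages of $\gamma$ through $v_i$ joins two opposite regions at $v_i$; $v_i$ is internal if these are colored and external if they are not. The marker of $v_i$ is $A$ (sign $+$, internal), $a$ (sign $+$, external), $B$ (sign $-$, internal) or $b$ (sign $-$, external). The weight $\mu_i(\gamma)$ is given by \[ \begin{array}{c|cccc} & A & a & B & b\\ \hline \text{live} & -q^{-3} & -q^{3} & -q^{3} & -q^{-3}\\ \text{dead} & q & q^{-1} & q^{-1} & q\end{array} \] and $X_G(q)=\sum_\gamma\prod_{i=1}^n\mu_i(\gamma)$, the sum being over all Euler circuits of $G$ (so $X_G=1$ for a circle without vertices). If $G$ has connected components $G_1,\dots,G_m$, then $X_G(q)=\bigl(-(q^2+q^{-2})\bigr)^{m-1}\prod_{i=1}^m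 X_{G_i}(q)$. **Corollary 3.4.** Let $L$ be an oriented virtual link that has a checkerboard-colorable diagram, let $D$ be any such diagram of $L$, and let $G$ be the shadow graph of $D$ with the vertex signs given by any checkerboard coloring and with any labeling of its vertices. Then \[ f_L(q)=(-q)^{-3\omega(D)}\,X_G(q). \] -/

import Mathlib

open scoped LaurentPolynomial

noncomputable section

namespace VirtualKnot

/-! ### 4-valent virtual graphs -/

/-- A 4-valent virtual graph drawn in the oriented plane, recorded combinatorially.  The curves of
the drawing are cut into segments at the double points and at finitely many auxiliary bends
(points of valency two, so that every closed curve without double points carries a bend); `Half` is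
the set of ends of these segments.

* `seg h` is the other end of the segment of which `h` is an end;
* `opp h` is the end one reaches from `h` by going straight ahead through the double point or the
  bend at which `h` lies;
* `port x 0, port x 1, port x 2, port x 3` are the four ends at the double point `x`, listed in
  counterclockwise order;
* `actual x` tells whether `x` is an actual double point (a vertex) or a virtual one. -/
structure VirtualGraph where
  Half : Type
  Point : Type
  [fintypeHalf : Fintype Half]
  [fintypePoint : Fintype Point]
  [decEqHalf : DecidableEq Half]
  [decEqPoint : DecidableEq Point]
  seg : Half → Half
  opp : Half → Half
  port : Point → Fin 4 → Half
  actual : Point → Bool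
  seg_seg : ∀ h, seg (seg h) = h
  seg_ne : ∀ h, seg h ≠ h
  opp_opp : ∀ h, opp (opp h) = h
  opp_ne : ∀ h, opp h ≠ h
  port_injective : Function.Injective fun x : Point × Fin 4 => port x.1 x.2
  opp_port : ∀ x k, opp (port x k) = port x (k + 2)

attribute [instance] VirtualGraph.fintypeHalf VirtualGraph.fintypePoint
  VirtualGraph.decEqHalf VirtualGraph.decEqPoint

namespace VirtualGraph

variable (G : VirtualGraph)

/-- The vertices, i.e. the actual double points. -/
abbrev Vertex : Type := {x : G.Point // G.actual x = true}

/-- `k` follows `h` counterclockwise among the ends at the double point or bend of `h`. -/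
def RotStep (h k : G.Half) : Prop :=
  (∃ x i, h = G.port x i ∧ k = G.port x (i + 1)) ∨
    ((∀ x i, h ≠ G.port x i) ∧ k = G.opp h)

/-- The faces of the drawing of the graph, both kinds of double points being regarded as nodes:
the orbits of "walk along the segment, then rotate". -/
def Face : Type := Quot fun h k : G.Half => G.RotStep (G.seg h) k

/-- The connected components of the drawing as a subset of the surface, i.e. the curves crossing at
a double point of either kind belong to the same component. -/
def DrawingComponent : Type :=
  Quot fun h k : G.Half => k = G.seg h ∨ k = G.opp h ∨ ∃ x i j, h = G.port x i ∧ k = G.port x j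

/-- The drawing is planar: Euler's formula `nodes - segments + faces = 2 * components`.  Every bend
has two ends and every double point four, so `nodes - segments` is minus the number of double
points. -/
def Planar : Prop :=
  Nat.card G.Face = Nat.card G.Point + 2 * Nat.card G.DrawingComponent

/-- The connected components of the graph: the edges meeting at a vertex are connected, whereas the
two strands at a virtual double point just pass through each other. -/
def Component : Type :=
  Quot fun h k : G.Half =>
    k = G.seg h ∨ k = G.opp h ∨ ∃ (v : G.Vertex) (i j : Fin 4), h = G.port v i ∧ k = G.port v j

/-- The component of an end. -/
def comp (h : G.Half) : G.Component := Quot.mk _ h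

instance : Finite G.Component := inferInstanceAs (Finite (Quot _))

instance : Fintype G.Component := Fintype.ofFinite _

/-- A checkerboard coloring: on each edge, one side is colored.  `left h = true` means that the
colored side of the segment of `h` is on the left when one leaves the double point or bend of `h`
along this segment (otherwise it is on the right).

The region between the consecutive ends `port v k` and `port v (k + 1)` at a vertex is on the left
of the first and on the right of the second, so a coloring near a vertex is a checkerboard one iff
`left` alternates around the vertex (the colored side then switches along each strand through the
vertex).  The coloring goes straight through bends and virtual double points. -/
structure Coloring where
  left : G.Half → Bool
  left_seg : ∀ h, left (G.seg h) = !left h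
  left_vertex : ∀ (v : G.Vertex) (k : Fin 4), left (G.port v (k + 1)) = !left (G.port v k)
  left_through : ∀ h, (∀ (v : G.Vertex) (k : Fin 4), h ≠ G.port v k) → left (G.opp h) = !left h

variable {G}

/-! ### Euler circuits

A checkerboard coloring orients every edge so that the colored side is on its left (the
source-target structure).  A directed segment is identified with its initial end. -/

/-- The directed segments that lie in the component `K`. -/
abbrev Edge (c : G.Coloring) (K : G.Component) : Type :=
  {h : G.Half // c.left h = true ∧ G.comp h = K}

/-- A path arriving along the end `h` may leave along the end `k`: at a vertex every end is
admissible, at bends and virtual double points one has to go straight ahead. -/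
def CanFollow (G : VirtualGraph) (h k : G.Half) : Prop :=
  (∃ (v : G.Vertex) (i j : Fin 4), h = G.port v i ∧ k = G.port v j) ∨
    ((∀ (v : G.Vertex) (i : Fin 4), h ≠ G.port v i) ∧ k = G.opp h)

/-- An Euler circuit of the component `K`, as a cyclic sequence: `next e` is the directed segment
traversed after `e`, and all directed segments of `K` form a single cycle. -/
structure EulerCircuit (c : G.Coloring) (K : G.Component) where
  next : Equiv.Perm (Edge c K)
  follows : ∀ e, G.CanFollow (G.seg e.1) (next e).1
  single : ∀ e e', next.SameCycle e e'

theorem EulerCircuit.next_injective (c : G.Coloring) (K : G.Component) :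
    Function.Injective (EulerCircuit.next : EulerCircuit c K → _) := by
  rintro ⟨a, _, _⟩ ⟨b, _, _⟩ h
  cases h
  rfl

instance (c : G.Coloring) (K : G.Component) : Finite (EulerCircuit c K) :=
  Finite.of_injective _ (EulerCircuit.next_injective c K)

instance (c : G.Coloring) (K : G.Component) : Fintype (EulerCircuit c K) := Fintype.ofFinite _

/-- The initial point of the directed segment `e` is the vertex `v`. -/
def StartsAt {c : G.Coloring} {K : G.Component} (e : Edge c K) (v : G.Vertex) : Prop :=
  ∃ i : Fin 4, e.1 = G.port v i

/-- Two distinct vertices interlace in the circuit: it visits them in the order `u … v … u … v`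
within one period. -/
def EulerCircuit.Interlaced {c : G.Coloring} {K : G.Component} (γ : EulerCircuit c K)
    (u v : G.Vertex) : Prop :=
  u ≠ v ∧ ∃ (e : Edge c K) (i j k : ℕ), 0 < i ∧ i < j ∧ j < k ∧ k < Nat.card (Edge c K) ∧
    StartsAt e u ∧ StartsAt ((γ.next ^ i) e) v ∧ StartsAt ((γ.next ^ j) e) u ∧
    StartsAt ((γ.next ^ k) e) v

/-- The marker at `v` lies on the colored side.  The circuit arrives at `v` along an end `port v k`
having the colored side on its left.  If it leaves along `port v (k + 1)`, then the two merged
edges near `v` face each other across the (now connected) colored regions at `v`; if it leaves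
along `port v (k - 1)`, they do so across the uncolored regions. -/
def EulerCircuit.MarkerColored {c : G.Coloring} {K : G.Component} (γ : EulerCircuit c K)
    (v : G.Vertex) : Prop :=
  ∃ (e : Edge c K) (k : Fin 4), G.seg e.1 = G.port v k ∧ (γ.next e).1 = G.port v (k + 1)

/-- The vertex `v` is live: every vertex interlacing with `v` has a larger label. -/
def EulerCircuit.Live {c : G.Coloring} {K : G.Component} (γ : EulerCircuit c K) {n : ℕ}
    (label : G.Vertex ≃ Fin n) (v : G.Vertex) : Prop :=
  ∀ u, γ.Interlaced v u → label v < label u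

end VirtualGraph

/-- The labels of markers. -/
inductive Marker
  | A | a | B | b

/-- The activity letters; `Lbar` stands for the overlined letter `L`, and so on. -/
inductive Letter
  | L | D | l | d | Lbar | Dbar | lbar | dbar

/-- The label of a marker, in terms of the sign of the vertex (`true` for `+`) and of whether the
marker lies on the colored side. -/
def Marker.of (positive colored : Bool) : Marker :=
  match positive, colored with
  | true, true => A
  | true, false => a
  | false, true => B
  | false, false => b

/-- The activity letter of a vertex with a given marker which is live or dead. -/
def Letter.of (m : Marker) (live : Bool) : Letter :=
  match m, live with
  | .A, true => L
  | .B, true => Lbar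
  | .A, false => D
  | .B, false => Dbar
  | .a, true => l
  | .b, true => lbar
  | .a, false => d
  | .b, false => dbar

/-- The power `q ^ n` of the variable `q` of the ring of integral Laurent polynomials. -/
abbrev q (n : ℤ) : ℤ[T;T⁻¹] := LaurentPolynomial.T n

/-- The weight of an activity letter. -/
def Letter.weight : Letter → ℤ[T;T⁻¹]
  | .L => -q (-3)
  | .D => q 1
  | .l => -q 3
  | .d => q (-1)
  | .Lbar => -q 3
  | .Dbar => q (-1)
  | .lbar => -q (-3)
  | .dbar => q 1

namespace VirtualGraph

variable {G : VirtualGraph}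

open scoped Classical in
/-- The activity letter of the vertex `v` with respect to an Euler circuit. -/
def EulerCircuit.letter {c : G.Coloring} {K : G.Component} (γ : EulerCircuit c K)
    (sign : G.Vertex → Bool) {n : ℕ} (label : G.Vertex ≃ Fin n) (v : G.Vertex) : Letter :=
  Letter.of (Marker.of (sign v) (decide (γ.MarkerColored v))) (decide (γ.Live label v))

open scoped Classical in
/-- The weight of an Euler circuit of the component `K`: the product of the weights of the vertices
of `K`. -/
def EulerCircuit.weight {c : G.Coloring} {K : G.Component} (γ : EulerCircuit c K)
    (sign : G.Vertex → Bool) {n : ℕ} (label : G.Vertex ≃ Fin n) : ℤ[T;T⁻¹] :=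
  ∏ v : {v : G.Vertex // G.comp (G.port v 0) = K}, (γ.letter sign label v.1).weight

/-- The polynomial `X` of a connected component of a graph. -/
def componentX (c : G.Coloring) (sign : G.Vertex → Bool) {n : ℕ} (label : G.Vertex ≃ Fin n)
    (K : G.Component) : ℤ[T;T⁻¹] :=
  ∑ γ : EulerCircuit c K, γ.weight sign label

/-- The polynomial `X` of a checkerboard-colored vertex-signed graph with labeled vertices. -/
def X (c : G.Coloring) (sign : G.Vertex → Bool) {n : ℕ} (label : G.Vertex ≃ Fin n) :
    ℤ[T;T⁻¹] :=
  (-(q 2 + q (-2))) ^ (Nat.card G.Component - 1) * ∏ K : G.Component, componentX c sign label K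

end VirtualGraph

/-! ### Unoriented diagrams and the Kauffman bracket -/

/-- An unoriented virtual link diagram: a 4-valent virtual graph with over/under information at the
vertices, which become the classical crossings.  The over strand at `v` has the ends
`port v (overPort v)` and `port v (overPort v + 2)`. -/
structure UnorientedDiagram extends VirtualGraph where
  overPort : toVirtualGraph.Vertex → Fin 4

namespace UnorientedDiagram

variable (U : UnorientedDiagram)

/-- Consecutive ends on the curves obtained by smoothing every classical crossing `v` according to
the state `s`.  The regions swept by the over strand `port v o`, `port v (o + 2)` when it rotates
counterclockwise are those between `port v o` and `port v (o + 1)`, and between `port v (o + 2)`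
and `port v (o + 3)`.  If `s v = true` these two regions get joined (the smoothing with coefficient
`q`), otherwise the other two regions get joined (the smoothing with coefficient `q⁻¹`). -/
def StateRel (s : U.Vertex → Bool) (h k : U.Half) : Prop :=
  k = U.seg h ∨
  ((∀ (v : U.Vertex) (i : Fin 4), h ≠ U.port v i) ∧ k = U.opp h) ∨
  (∃ (v : U.Vertex) (i : Fin 4), (i = U.overPort v ∨ i = U.overPort v + 2) ∧
    ((s v = true ∧ h = U.port v (i + 1) ∧ k = U.port v (i + 2)) ∨
     (s v = false ∧ h = U.port v i ∧ k = U.port v (i + 1))))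

/-- The number of closed curves of a state. -/
def loops (s : U.Vertex → Bool) : ℕ := Nat.card (Quot (U.StateRel s))

/-- The Kauffman bracket, as the sum over all ways to resolve all classical crossings by the
relation `⟨L⟩ = q ⟨L₀⟩ + q⁻¹ ⟨L₁⟩`, the value of `m ≥ 1` circles being `(-q⁻² - q²) ^ (m - 1)`. -/
def bracket : ℤ[T;T⁻¹] :=
  ∑ s : U.Vertex → Bool,
    (∏ v, if s v = true then q 1 else q (-1)) * (-q (-2) - q 2) ^ (U.loops s - 1)

end UnorientedDiagram

/-! ### Oriented virtual link diagrams -/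

inductive CrossingKind
  | positive | negative | virtual
  deriving DecidableEq

/-- The kind of crossing with over- and under-strand exchanged. -/
def CrossingKind.switch : CrossingKind → CrossingKind
  | .positive => .negative
  | .negative => .positive
  | .virtual => .virtual

/-- Combinatorial data of an oriented virtual link diagram.

`P` is a finite set of marked points on the circles containing all preimages of the crossings, at
least one point being marked on each circle; marked points that are not preimages of crossings are
bends.  `next` is the cyclic order of the marked points on the oriented circles.  Turn a crossing
`x` so that both strands run upwards: `strand (x, false)` is the preimage of `x` on the strand
running from bottom left to top right, `strand (x, true)` the one on the strand running from bottom
right to top left.  The crossing is positive if the first of them is the over strand and negative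
if it is the second. -/
structure DiagramData where
  P : Type
  C : Type
  [fintypeP : Fintype P]
  [fintypeC : Fintype C]
  [decEqP : DecidableEq P]
  [decEqC : DecidableEq C]
  next : Equiv.Perm P
  strand : C × Bool ↪ P
  kind : C → CrossingKind

attribute [instance] DiagramData.fintypeP DiagramData.fintypeC
  DiagramData.decEqP DiagramData.decEqC

namespace DiagramData

variable (D : DiagramData)

/-- The shadow graph.  The ends are `(p, true)`, where the oriented strand leaves the marked point
`p`, and `(p, false)`, where it arrives at `p`; classical crossings become vertices and virtual
crossings become virtual double points.  The ends at a crossing are listed counterclockwise: top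
right, top left, bottom left, bottom right. -/
def shadow : VirtualGraph where
  Half := D.P × Bool
  Point := D.C
  seg h := if h.2 = true then (D.next h.1, false) else (D.next.symm h.1, true)
  opp h := (h.1, !h.2)
  port x := ![(D.strand (x, false), true), (D.strand (x, true), true),
    (D.strand (x, false), false), (D.strand (x, true), false)]
  actual x := decide (D.kind x ≠ .virtual)
  seg_seg := by rintro ⟨p, _ | _⟩ <;> simp
  seg_ne := by rintro ⟨p, _ | _⟩ <;> simp
  opp_opp := by simp
  opp_ne := by rintro ⟨p, _ | _⟩ <;> simp
  port_injective := by
    rintro ⟨x, i⟩ ⟨y, j⟩ h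
    fin_cases i <;> fin_cases j <;> simp_all
  opp_port := by
    intro x k
    fin_cases k <;> simp

/-- The unoriented diagram obtained by forgetting the orientation. -/
def unoriented : UnorientedDiagram where
  toVirtualGraph := D.shadow
  overPort v := if D.kind v.1 = .positive then 0 else 1

/-- The writhe: the number of positive crossings minus the number of negative crossings. -/
def writhe : ℤ :=
  (Nat.card {x : D.C // D.kind x = .positive} : ℤ) - Nat.card {x : D.C // D.kind x = .negative}

/-! #### Generalized Reidemeister moves -/

/-- Isomorphisms, i.e. orientation preserving homeomorphisms of the plane, combinatorially. -/
structure Iso (D D' : DiagramData) where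
  onP : D.P ≃ D'.P
  onC : D.C ≃ D'.C
  next : ∀ p, onP (D.next p) = D'.next (onP p)
  strand : ∀ x b, onP (D.strand (x, b)) = D'.strand (onC x, b)
  kind : ∀ x, D.kind x = D'.kind (onC x)

/-- Mark a new bend right after the marked point `p`. -/
def addBend (p : D.P) : DiagramData where
  P := Option D.P
  C := D.C
  next := (Equiv.swap (some p) none).trans (Equiv.optionCongr D.next)
  strand := D.strand.trans Function.Embedding.some
  kind := D.kind

/-- Remove the crossings of `S`: the strands involved are pulled apart, and the preimages of the
removed crossings become bends. -/
def remove (S : Finset D.C) : DiagramData where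
  P := D.P
  C := {x : D.C // x ∉ S}
  next := D.next
  strand := ⟨fun x => D.strand (x.1.1, x.2), by
    rintro ⟨⟨x, _⟩, b⟩ ⟨⟨y, _⟩, b'⟩ h
    simpa using h⟩
  kind x := D.kind x.1

/-- Rearrange the preimages of the crossings among the marked points. -/
def rearrange (τ : Equiv.Perm D.P) : DiagramData where
  P := D.P
  C := D.C
  next := D.next
  strand := D.strand.trans τ.toEmbedding
  kind := D.kind

/-- `p` and `p'` are consecutive, in the order `p`, `p'` if `o = true`, in the order `p'`, `p` if
`o = false`. -/
def Consecutive (o : Bool) (p p' : D.P) : Prop :=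
  if o = true then D.next p = p' else D.next p' = p

/-- A monogon: one of the strands at `x` is directly followed by the other. -/
def Monogon (x : D.C) : Prop := ∃ b, D.next (D.strand (x, b)) = D.strand (x, !b)

/-- A bigon with distinct corners `x` and `y`: a strand runs from `x` to `y` and changes from one
side of the other strand to the other one, which is either parallel or antiparallel. -/
def Bigon (x y : D.C) : Prop :=
  x ≠ y ∧ ∃ b o, D.next (D.strand (x, b)) = D.strand (y, !b) ∧
    D.Consecutive o (D.strand (x, !b)) (D.strand (y, b))

/-- A triangle formed by three strands `X`, `Y`, `Z`, where `X`, `Y` cross at `x`, further `X`, `Z`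
at `y`, and `Y`, `Z` at `z`.  At `x` the strand `X` is `(x, i)`, at `y` it is `(y, j)`, and at `z`
the strand `Y` is `(z, k)`.  The strand `X` meets `x` before `y` iff `oX`, `Y` meets `x` before `z`
iff `oY`, and `Z` meets `y` before `z` iff `oZ`. -/
structure Triangle (x y z : D.C) (i j k oX oY oZ : Bool) : Prop where
  ne_xy : x ≠ y
  ne_xz : x ≠ z
  ne_yz : y ≠ z
  consecX : D.Consecutive oX (D.strand (x, i)) (D.strand (y, j))
  consecY : D.Consecutive oY (D.strand (x, !i)) (D.strand (z, k))
  consecZ : D.Consecutive oZ (D.strand (y, !j)) (D.strand (z, !k))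
  /-- The third crossing is on the same side of `X` as seen from `x` and as seen from `y`. -/
  side : (i = oY ↔ j = oZ)
  /-- At the third crossing, `Y` and `Z` cross each other in the direction which the directions at
  `x` and `y` force. -/
  turn : (i = k ↔ oX = oZ)

/-- The kinds of the crossings of a triangle allow a third move: either the crossings are classical
with `X` above `Y` and `Z`, and `Y` above `Z`, or at least two of them are virtual. -/
def Slidable (x y z : D.C) (i j k : Bool) : Prop :=
  (D.kind x = (if i = true then .negative else .positive) ∧
    D.kind y = (if j = true then .negative else .positive) ∧
    D.kind z = (if k = true then .negative else .positive)) ∨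
  (D.kind x = .virtual ∧ D.kind y = .virtual) ∨
  (D.kind x = .virtual ∧ D.kind z = .virtual) ∨
  (D.kind y = .virtual ∧ D.kind z = .virtual)

/-- Elementary transformations of diagrams: isomorphisms, marking additional bends, and the
generalized Reidemeister moves, all possible orientations of strands being included. -/
inductive Step : DiagramData → DiagramData → Prop
  | iso {D D' : DiagramData} (e : Iso D D') : Step D D'
  | bend (D : DiagramData) (p : D.P) : Step D (D.addBend p)
  | /-- The first move, classical or virtual. -/
    first (D : DiagramData) (x : D.C) (h : D.Monogon x) : Step D (D.remove {x})
  | /-- The second move: either both crossings are virtual, or they are classical and the same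
    strand is the over strand at both of them, i.e. they have opposite signs. -/
    second (D : DiagramData) (x y : D.C) (h : D.Bigon x y)
      (hk : D.kind y = (D.kind x).switch) : Step D (D.remove {x, y})
  | /-- The third move, classical, virtual or mixed: on each of the three strands the two crossings
    are exchanged. -/
    third (D : DiagramData) (x y z : D.C) (i j k oX oY oZ : Bool)
      (h : D.Triangle x y z i j k oX oY oZ) (hk : D.Slidable x y z i j k) :
      Step D (D.rearrange
        (Equiv.swap (D.strand (x, i)) (D.strand (y, j)) *
          Equiv.swap (D.strand (x, !i)) (D.strand (z, k)) *
          Equiv.swap (D.strand (y, !j)) (D.strand (z, !k))))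

end DiagramData

/-- An oriented virtual link diagram: one or several circles in the plane. -/
structure Diagram extends DiagramData where
  nonempty : Nonempty P
  planar : toDiagramData.shadow.Planar

/-- Equivalence of virtual link diagrams. -/
def Diagram.setoid : Setoid Diagram :=
  Relation.EqvGen.setoid fun D D' => DiagramData.Step D.toDiagramData D'.toDiagramData

/-- Oriented virtual links. -/
def Link : Type 1 := Quotient Diagram.setoid

namespace Diagram

/-- `D` is a diagram of the virtual link `L`. -/
def IsDiagramOf (D : Diagram) (L : Link) : Prop := Quotient.mk Diagram.setoid D = L

/-- The unit `-q` of the ring of Laurent polynomials. -/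
def negQ : (ℤ[T;T⁻¹])ˣ where
  val := -q 1
  inv := -q (-1)
  val_inv := by rw [neg_mul_neg, ← LaurentPolynomial.T_add]; simp
  inv_val := by rw [neg_mul_neg, ← LaurentPolynomial.T_add]; simp

/-- The polynomial `(-q) ^ (-3 ω(D)) ⟨D⟩` of a diagram. -/
def jonesKauffman (D : Diagram) : ℤ[T;T⁻¹] :=
  ((negQ ^ (-3 * D.writhe) : (ℤ[T;T⁻¹])ˣ) : ℤ[T;T⁻¹]) * D.unoriented.bracket

/-- The signs of the vertices of the shadow graph with respect to a checkerboard coloring (`true`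
for `+`): a vertex is positive if the regions swept by the over strand when it rotates
counterclockwise are colored. -/
def shadowSign (D : Diagram) (c : D.shadow.Coloring) (v : D.shadow.Vertex) : Bool :=
  c.left (D.shadow.port v (D.unoriented.overPort v))

end Diagram

/-- `f` is the Jones-Kauffman polynomial of the virtual link `L`: the polynomial computed from
any diagram of `L`. -/
def Link.IsJonesKauffman (L : Link) (f : ℤ[T;T⁻¹]) : Prop :=
  ∀ D : Diagram, D.IsDiagramOf L → D.jonesKauffman = f

end VirtualKnot

end

/-!
Two facts carry the proof: `(-q)^(-3ω(D)) ⟨D⟩` is an invariant of the virtual link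
(`Diagram.jonesKauffman_eq`), and the bracket of a checkerboard-colored diagram is the polynomial of
its shadow graph (`UnorientedDiagram.bracket_eq_X`).

**Invariance.** Every crossing is resolved in one of three ways: `straight` (with nonzero
coefficient only for virtual crossings), `oriented` or `disoriented`, so that the bracket times the
value `δ` of a circle is a state sum in which crossings of all kinds are treated alike
(`stateSum_eq_bracket`), and removing a crossing just means letting the strands go straight there
(`stateSum_remove`).  For a Reidemeister move, the sum over the smoothings of the crossings involved
is taken inside the sum over all others.  What remains to be compared is the number of classes
obtained from one fixed relation, the diagram cut open at these crossings, by gluing its loose ends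
in different ways.  The sides of the monogon, bigon or triangle are segments whose two ends are
connected to nothing else, and gluing such a segment to another end lowers the number of classes by
one (`classes_glue_cons`).  This replaces each number by the number of classes for a gluing of the
outer ends only, and the moves reduce to polynomial identities with `δ = -q² - q⁻²`.

**Expansion over Euler circuits.** If the colored side of each edge is kept on the left, then both
smoothings of a vertex respect the directions of the edges.  A smoothing of all vertices therefore
is a permutation of the directed edges, its circles are the cycles, and changing the smoothing of
one vertex composes the permutation with the transposition of the two edges starting there.  This is
all that is needed (`SmoothingSystem`).  The vertices are resolved in the order of decreasing
labels, i.e. the induction adds the vertex `v` with the largest label to the set `A` of vertices not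
yet smoothed.  At least one of the two smoothings of `v` does not disconnect the component of `v`.
If neither does, then both contribute their coefficients.  If the smoothing with coefficient `w⁻¹`
does, then its value is `δ` times that of the other one, and both together have the coefficient
`w + w⁻¹ δ = -w⁻³`.  The second case occurs iff `v` is live (`live_iff_not_joined`): two vertices
interlace in an Euler circuit iff the two circuits which arise from it by changing the smoothing of
the first vertex both visit the second one (`IsGivenBy.interlaced_iff`).
-/

noncomputable section

namespace VirtualKnot

/-! ### Counting the classes of a relation -/

/-- The function `f` takes the same value on related elements. -/
def Respects {α γ : Type} (r : α → α → Prop) (f : α → γ) : Prop := ∀ x y, r x y → f x = f y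

/-- The number of classes of the equivalence relation generated by `r`. -/
def classes {α : Type} (r : α → α → Prop) : ℕ := Nat.card (Quot r)

theorem respects_mk {α : Type} (r : α → α → Prop) : Respects r (Quot.mk r) :=
  fun _ _ h => Quot.sound h

/-- The quotients of two relations are equinumerous as soon as there are maps between the underlying
types that are mutually inverse on the quotients. -/
theorem classes_eq_of_maps {α β : Type} {r : α → α → Prop} {r' : β → β → Prop}
    (f : α → β) (g : β → α) (hf : Respects r (Quot.mk r' ∘ f)) (hg : Respects r' (Quot.mk r ∘ g))
    (hgf : ∀ x, Quot.mk r (g (f x)) = Quot.mk r x)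
    (hfg : ∀ y, Quot.mk r' (f (g y)) = Quot.mk r' y) :
    classes r = classes r' :=
  Nat.card_congr
    { toFun := Quot.lift (Quot.mk r' ∘ f) hf
      invFun := Quot.lift (Quot.mk r ∘ g) hg
      left_inv := by rintro ⟨x⟩; exact hgf x
      right_inv := by rintro ⟨y⟩; exact hfg y }

/-- The number of classes only depends on the functions which respect the relation. -/
theorem classes_congr {α : Type} {r r' : α → α → Prop}
    (h : ∀ (γ : Type) (f : α → γ), Respects r f ↔ Respects r' f) : classes r = classes r' :=
  classes_eq_of_maps id id ((h _ _).2 (respects_mk r')) ((h _ _).1 (respects_mk r))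
    (fun _ => rfl) fun _ => rfl

theorem one_le_classes {α : Type} [Finite α] [Nonempty α] (r : α → α → Prop) : 1 ≤ classes r := by
  have : Nonempty (Quot r) := ⟨Quot.mk r (Classical.arbitrary α)⟩
  exact Nat.card_pos

/-- The relation `r` with the pairs of the list `l` added. -/
def glue {α : Type} (r : α → α → Prop) (l : List (α × α)) (x y : α) : Prop := r x y ∨ (x, y) ∈ l

theorem respects_glue {α γ : Type} {r : α → α → Prop} {l : List (α × α)} {f : α → γ} :
    Respects (glue r l) f ↔ Respects r f ∧ ∀ p ∈ l, f p.1 = f p.2 := by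
  constructor
  · exact fun h => ⟨fun x y hxy => h x y (.inl hxy), fun p hp => h p.1 p.2 (.inr hp)⟩
  · rintro ⟨h, h'⟩ x y (hxy | hxy)
    exacts [h x y hxy, h' _ hxy]

/-- Adding a pair of elements of different classes lowers the number of classes by one. -/
theorem classes_glue_of_ne {α : Type} [Finite α] {r : α → α → Prop} {a b : α}
    (h : Quot.mk r a ≠ Quot.mk r b) : classes (glue r [(a, b)]) + 1 = classes r := by
  classical
  have e : Quot (glue r [(a, b)]) ≃ {z : Quot r // z ≠ Quot.mk r b} :=
    { toFun := Quot.lift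
        (fun x => ⟨if Quot.mk r x = Quot.mk r b then Quot.mk r a else Quot.mk r x, by
          split_ifs with hx
          exacts [h, hx]⟩) (by
        intro x y hxy
        rcases hxy with hxy | hxy
        · simp only [Quot.sound hxy]
        · simp only [List.mem_singleton, Prod.mk.injEq] at hxy
          obtain ⟨rfl, rfl⟩ := hxy
          simp [h])
      invFun := fun z => Quot.lift (Quot.mk (glue r [(a, b)]))
        (fun x y hxy => Quot.sound (.inl hxy)) z.1
      left_inv := by
        rintro ⟨x⟩
        change Quot.lift (Quot.mk (glue r [(a, b)])) _
          (if Quot.mk r x = Quot.mk r b then Quot.mk r a else Quot.mk r x) = Quot.mk _ x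
        split_ifs with hx
        · have h1 : Quot.mk (glue r [(a, b)]) a = Quot.mk _ b :=
            Quot.sound (.inr (List.mem_singleton.2 rfl))
          have h2 := congrArg (Quot.lift (Quot.mk (glue r [(a, b)]))
            (fun x y hxy => Quot.sound (.inl hxy))) hx
          exact h1.trans h2.symm
        · rfl
      right_inv := by
        rintro ⟨⟨x⟩, hx⟩
        apply Subtype.ext
        exact if_neg hx }
  rw [classes, classes, Nat.card_congr e]
  have : Fintype (Quot r) := Fintype.ofFinite _
  have := Fintype.card_subtype_compl (fun z : Quot r => z = Quot.mk r b)
  rw [Fintype.card_subtype_eq] at this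
  rw [Nat.card_eq_fintype_card, Nat.card_eq_fintype_card, this]
  have : 0 < Fintype.card (Quot r) := Fintype.card_pos_iff.2 ⟨Quot.mk r a⟩
  omega

theorem classes_glue_of_eq {α : Type} {r : α → α → Prop} {a b : α}
    (h : Quot.mk r a = Quot.mk r b) : classes (glue r [(a, b)]) = classes r := by
  refine classes_congr fun γ f => ?_
  simp only [respects_glue, List.mem_singleton, forall_eq, and_iff_left_iff_imp]
  exact fun hf => congrArg (Quot.lift f hf) h

/-- Gluing an element of a union `I` of classes to an element outside `I` lowers the number of
classes by one, unless other pairs already connect `I` with its complement. -/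
theorem classes_glue_cons {α : Type} [Finite α] {r : α → α → Prop} {l : List (α × α)} (I : α → Prop)
    (hr : Respects r I) (hl : ∀ p ∈ l, I p.1 = I p.2) {u a : α} (hu : I u) (ha : ¬ I a) :
    classes (glue r ((u, a) :: l)) + 1 = classes (glue r l) := by
  have hI : Respects (glue r l) I := respects_glue.2 ⟨hr, hl⟩
  rw [← classes_glue_of_ne (r := glue r l) (a := u) (b := a)]
  · congr 1
    refine classes_congr fun γ f => ?_
    simp only [respects_glue, List.mem_cons, List.not_mem_nil, or_false, forall_eq,
      forall_eq_or_imp]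
    tauto
  · intro h
    have h' := congrArg (Quot.lift I hI) h
    change I u = I a at h'
    exact ha (h' ▸ hu)

/-! ### The Kauffman bracket as a sum over smoothings of all crossings -/

/-- The value `-q⁻² - q²` of a circle. -/
def circleValue : ℤ[T;T⁻¹] := -q (-2) - q 2

theorem q_mul_q (m n : ℤ) : q m * q n = q (m + n) := (LaurentPolynomial.T_add m n).symm

theorem q_zero : q 0 = 1 := LaurentPolynomial.T_zero

theorem circleValue_ne_zero : circleValue ≠ 0 := by
  intro h
  have := congrArg (LaurentPolynomial.eval₂ (RingHom.id ℤ) 1) h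
  simp [circleValue, q] at this

/-- The ways to replace a crossing of two oriented strands: the strands may go straight ahead (a
virtual crossing), or they may be reconnected with or without respecting their orientations. -/
inductive Smoothing
  | straight | oriented | disoriented
  deriving DecidableEq

instance : Fintype Smoothing :=
  ⟨{.straight, .oriented, .disoriented}, by rintro (_ | _ | _) <;> decide⟩

theorem Smoothing.sum_univ (F : Smoothing → ℤ[T;T⁻¹]) :
    ∑ a, F a = F .straight + F .oriented + F .disoriented := by
  rw [show (Finset.univ : Finset Smoothing) = {.straight, .oriented, .disoriented} from rfl]
  simp [add_assoc]

/-- The pairs of ends which get connected, the ends at a crossing being listed as in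
`DiagramData.shadow`. -/
def Smoothing.pairs {α : Type} (a : Smoothing) (p : Fin 4 → α) : List (α × α) :=
  match a with
  | straight => [(p 0, p 2), (p 1, p 3)]
  | oriented => [(p 1, p 2), (p 3, p 0)]
  | disoriented => [(p 0, p 1), (p 2, p 3)]

/-- The coefficient of a smoothing in the expansion of the bracket at a crossing. -/
def CrossingKind.coeff : CrossingKind → Smoothing → ℤ[T;T⁻¹]
  | .virtual, .straight => 1
  | .positive, .oriented => q 1
  | .positive, .disoriented => q (-1)
  | .negative, .oriented => q (-1)
  | .negative, .disoriented => q 1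
  | _, _ => 0

namespace DiagramData

variable (D : DiagramData)

/-- The four ends at a crossing. -/
def ends (x : D.C) : Fin 4 → D.P × Bool :=
  ![(D.strand (x, false), true), (D.strand (x, true), true),
    (D.strand (x, false), false), (D.strand (x, true), false)]

/-- Consecutive ends on the curves obtained by smoothing the crossings outside `S` according to `t`,
the strands being cut open at the crossings in `S`. -/
def joins (S : Finset D.C) (t : D.C → Smoothing) (h k : D.P × Bool) : Prop :=
  (h.2 = true ∧ k = (D.next h.1, false)) ∨
    ((∀ x b, h.1 ≠ D.strand (x, b)) ∧ k = (h.1, !h.2)) ∨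
    ∃ x ∉ S, (h, k) ∈ (t x).pairs (D.ends x)

/-- The smoothings with all crossings in `S` going straight. -/
def straightOn (S : Finset D.C) : Finset (D.C → Smoothing) :=
  Finset.univ.filter fun t => ∀ x ∈ S, t x = .straight

/-- The product of the coefficients of the crossings outside `S`. -/
def coeffOff (S : Finset D.C) (t : D.C → Smoothing) : ℤ[T;T⁻¹] := ∏ x ∈ Sᶜ, (D.kind x).coeff (t x)

/-- The Kauffman bracket normalized to have the value `1` on the empty diagram, as a sum over the
smoothings of all crossings. -/
def stateSum : ℤ[T;T⁻¹] :=
  ∑ t ∈ D.straightOn ∅, D.coeffOff ∅ t * circleValue ^ classes (D.joins ∅ t)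

variable {D}

theorem respects_joins {S : Finset D.C} {t : D.C → Smoothing} {γ : Type} {f : D.P × Bool → γ} :
    Respects (D.joins S t) f ↔
      (∀ p, f (p, true) = f (D.next p, false)) ∧
      (∀ p, (∀ x b, p ≠ D.strand (x, b)) → f (p, true) = f (p, false)) ∧
      ∀ x ∉ S, ∀ e ∈ (t x).pairs (D.ends x), f e.1 = f e.2 := by
  constructor
  · intro h
    exact ⟨fun p => h _ _ (.inl ⟨rfl, rfl⟩),
      fun p hp => h (p, true) (p, false) (.inr (.inl ⟨hp, rfl⟩)),
      fun x hx e he => h _ _ (.inr (.inr ⟨x, hx, he⟩))⟩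
  · rintro ⟨h1, h2, h3⟩ ⟨p, b⟩ k (⟨hb, rfl⟩ | ⟨hp, rfl⟩ | ⟨x, hx, he⟩)
    · obtain rfl : b = true := hb
      exact h1 p
    · cases b
      exacts [(h2 p hp).symm, h2 p hp]
    · exact h3 x hx _ he

/-- Splitting off the links at one crossing. -/
theorem respects_joins_update {S : Finset D.C} {x : D.C} (hx : x ∉ S) {t : D.C → Smoothing}
    {a : Smoothing} {γ : Type} {f : D.P × Bool → γ} :
    Respects (D.joins S (Function.update t x a)) f ↔
      Respects (D.joins (insert x S) t) f ∧ ∀ e ∈ a.pairs (D.ends x), f e.1 = f e.2 := by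
  rw [respects_joins, respects_joins]
  constructor
  · rintro ⟨h1, h2, h3⟩
    refine ⟨⟨h1, h2, fun y hy => ?_⟩, by simpa using h3 x hx⟩
    rw [Finset.mem_insert, not_or] at hy
    simpa [Function.update_of_ne hy.1] using h3 y hy.2
  · rintro ⟨⟨h1, h2, h3⟩, h4⟩
    refine ⟨h1, h2, fun y hy => ?_⟩
    by_cases hyx : y = x
    · subst hyx
      simpa using h4
    · simpa [Function.update_of_ne hyx] using h3 y (by simp [hyx, hy])

/-- The conditions imposed by a smoothing, in terms of either of the two strands. -/
theorem pairs_ends {x : D.C} (i β : Bool) {γ : Type} {f : D.P × Bool → γ} (a : Smoothing) :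
    (∀ e ∈ a.pairs (D.ends x), f e.1 = f e.2) ↔
      match a with
      | .straight => f (D.strand (x, i), β) = f (D.strand (x, i), !β) ∧
          f (D.strand (x, !i), β) = f (D.strand (x, !i), !β)
      | .oriented => f (D.strand (x, i), β) = f (D.strand (x, !i), !β) ∧
          f (D.strand (x, i), !β) = f (D.strand (x, !i), β)
      | .disoriented => f (D.strand (x, i), β) = f (D.strand (x, !i), β) ∧
          f (D.strand (x, i), !β) = f (D.strand (x, !i), !β) := by
  cases a <;> cases i <;> cases β <;> simp [Smoothing.pairs, ends] <;> grind

/-- Expanding a state sum at one crossing. -/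
theorem sum_straightOn {S : Finset D.C} {x : D.C} (hx : x ∉ S)
    (F : (D.C → Smoothing) → ℤ[T;T⁻¹]) :
    ∑ t ∈ D.straightOn S, D.coeffOff S t * F t =
      ∑ t ∈ D.straightOn (insert x S), D.coeffOff (insert x S) t *
        ∑ a, (D.kind x).coeff a * F (Function.update t x a) := by
  have hc : ∀ t a, D.coeffOff S (Function.update t x a) =
      D.coeffOff (insert x S) t * (D.kind x).coeff a := by
    intro t a
    have hS : Sᶜ = insert x (insert x S)ᶜ := by
      ext y
      by_cases hy : y = x <;> simp [hy, hx]
    rw [coeffOff, hS, Finset.prod_insert (by simp), Function.update_self, mul_comm, coeffOff]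
    congr 1
    refine Finset.prod_congr rfl fun y hy => ?_
    rw [Function.update_of_ne (by rintro rfl; simp at hy)]
  simp_rw [Finset.mul_sum]
  rw [← Finset.sum_product']
  refine Finset.sum_nbij' (fun t => (Function.update t x .straight, t x))
    (fun p => Function.update p.1 x p.2) ?_ ?_ ?_ ?_ ?_
  · intro t ht
    simp only [straightOn, Finset.mem_filter, Finset.mem_univ, true_and, Finset.mem_product,
      Finset.mem_insert, and_true] at ht ⊢
    rintro y (rfl | hy)
    · simp
    · rw [Function.update_of_ne (by rintro rfl; exact hx hy), ht y hy]
  · rintro ⟨t, a⟩ ht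
    simp only [straightOn, Finset.mem_filter, Finset.mem_univ, true_and, Finset.mem_product,
      Finset.mem_insert, and_true] at ht ⊢
    intro y hy
    rw [Function.update_of_ne (by rintro rfl; exact hx hy), ht y (.inr hy)]
  · intro t _
    simp
  · rintro ⟨t, a⟩ ht
    simp only [straightOn, Finset.mem_filter, Finset.mem_univ, true_and, Finset.mem_product,
      Finset.mem_insert, and_true] at ht
    simp [← ht x (.inl rfl)]
  · intro t _
    simp only [Function.update_idem, Function.update_eq_self]
    rw [← mul_assoc, ← hc, Function.update_idem, Function.update_eq_self]

/-- The curves of the diagram with the crossings in `S` removed, the strands becoming bends there.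
-/
theorem respects_joins_remove {S : Finset D.C} {t : {x : D.C // x ∉ S} → Smoothing} {γ : Type}
    {f : D.P × Bool → γ} :
    Respects ((D.remove S).joins (∅ : Finset {x : D.C // x ∉ S}) t) f ↔
      (∀ p, f (p, true) = f (D.next p, false)) ∧
      (∀ p, (∀ x ∉ S, ∀ b, p ≠ D.strand (x, b)) → f (p, true) = f (p, false)) ∧
      ∀ x : {x : D.C // x ∉ S}, ∀ e ∈ (t x).pairs (D.ends x.1), f e.1 = f e.2 := by
  refine (respects_joins (D := D.remove S) (γ := γ)).trans ?_
  constructor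
  · rintro ⟨h1, h2, h3⟩
    exact ⟨h1, fun p hp => h2 p fun x b => hp x.1 x.2 b,
      fun x => h3 x (Finset.notMem_empty (α := {x : D.C // x ∉ S}) x)⟩
  · rintro ⟨h1, h2, h3⟩
    exact ⟨h1, fun p hp => h2 p fun x hx b => hp ⟨x, hx⟩ b, fun x _ => h3 x⟩

/-- Removing crossings amounts to letting the strands go straight there. -/
theorem stateSum_remove (S : Finset D.C) :
    (D.remove S).stateSum =
      ∑ t ∈ D.straightOn S, D.coeffOff S t * circleValue ^ classes (D.joins ∅ t) := by
  classical
  have h0 : (D.remove S).stateSum = ∑ t : {x : D.C // x ∉ S} → Smoothing,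
      (∏ x, (D.kind x.1).coeff (t x)) *
        circleValue ^ classes ((D.remove S).joins (∅ : Finset {x : D.C // x ∉ S}) t) := by
    refine Finset.sum_congr (Finset.filter_true_of_mem ?_) fun t _ => ?_
    · exact fun t _ x hx => absurd hx (Finset.notMem_empty (α := {x : D.C // x ∉ S}) x)
    · congr 1
      exact Finset.prod_congr (Finset.compl_empty (α := {x : D.C // x ∉ S})) fun _ _ => rfl
  rw [h0]
  refine Finset.sum_nbij' (fun t x => if hx : x ∈ S then .straight else t ⟨x, hx⟩)
    (fun t x => t x.1) ?_ ?_ ?_ ?_ ?_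
  · intro t _
    simp +contextual [straightOn]
  · intro t _
    simp
  · intro t _
    funext x
    exact dif_neg x.2
  · intro t ht
    funext x
    simp only [straightOn, Finset.mem_filter, Finset.mem_univ, true_and] at ht
    by_cases hx : x ∈ S <;> simp [hx, ht]
  · intro t _
    congr 1
    · have h : (Finset.univ : Finset {x : D.C // x ∉ S}).map (Function.Embedding.subtype _) =
          Sᶜ := by
        ext x
        simp
      rw [coeffOff, ← h, Finset.prod_map]
      refine Finset.prod_congr rfl fun x _ => ?_
      change _ = (D.kind x.1).coeff (if hx : x.1 ∈ S then .straight else t ⟨x.1, hx⟩)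
      rw [dif_neg x.2]
    · congr 1
      refine classes_congr (α := D.P × Bool) fun γ f => ?_
      refine respects_joins_remove.trans (Iff.trans ?_ respects_joins.symm)
      refine and_congr Iff.rfl ?_
      constructor
      · rintro ⟨h1, h2⟩
        refine ⟨fun p hp => h1 p fun x _ b => hp x b, fun x _ => ?_⟩
        by_cases hx : x ∈ S
        · rw [dif_pos hx, pairs_ends false true]
          have : ∀ b, f (D.strand (x, b), true) = f (D.strand (x, b), false) := by
            intro b
            refine h1 _ fun y hyS b' hy => hyS ?_
            have : x = y := congrArg Prod.fst (D.strand.injective hy)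
            exact this ▸ hx
          exact ⟨this _, this _⟩
        · rw [dif_neg hx]
          exact h2 ⟨x, hx⟩
      · rintro ⟨h1, h2⟩
        refine ⟨fun p hp => ?_, fun x => ?_⟩
        · by_cases hp' : ∀ x b, p ≠ D.strand (x, b)
          · exact h1 p hp'
          · push Not at hp'
            obtain ⟨x, b, rfl⟩ := hp'
            by_cases hx : x ∈ S
            · have := h2 x (by simp)
              rw [dif_pos hx, pairs_ends b true] at this
              exact this.1
            · exact absurd rfl (hp x hx b)
        · have := h2 x.1 (by simp)
          rw [dif_neg x.2] at this
          exact this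

/-- The smoothing of a crossing of the diagram which has the given coefficient in the bracket. -/
def smoothingOf : CrossingKind → Bool → Smoothing
  | .virtual, _ => .straight
  | .positive, true => .oriented
  | .positive, false => .disoriented
  | .negative, true => .disoriented
  | .negative, false => .oriented

theorem smoothingOf_injective {κ : CrossingKind} (hκ : κ ≠ .virtual) :
    Function.Injective (smoothingOf κ) := by
  intro b b' h
  cases κ <;> cases b <;> cases b' <;> simp_all [smoothingOf]

theorem mem_shadow_actual {x : D.C} : D.shadow.actual x = true ↔ D.kind x ≠ .virtual := by
  change decide _ = true ↔ _
  simp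

/-- The curves of a state of the unoriented diagram. -/
theorem respects_stateRel (s : D.unoriented.Vertex → Bool) (t : D.C → Smoothing)
    (ht : ∀ v : D.unoriented.Vertex, t v.1 = smoothingOf (D.kind v.1) (s v))
    (ht' : ∀ x, D.kind x = .virtual → t x = .straight) {γ : Type} (f : D.P × Bool → γ) :
    Respects (D.unoriented.StateRel s) f ↔ Respects (D.joins ∅ t) f := by
  rw [respects_joins]
  constructor
  · intro h
    refine ⟨fun p => h _ _ (.inl rfl), fun p hp => ?_, fun x _ => ?_⟩
    · refine h (p, true) (p, false) (.inr (.inl ⟨?_, rfl⟩))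
      intro v i hv
      fin_cases i <;> exact hp _ _ (congrArg Prod.fst hv)
    · by_cases hx : D.kind x = .virtual
      · have h' : ∀ b, f (D.strand (x, b), true) = f (D.strand (x, b), false) := by
          intro b
          refine h (D.strand (x, b), true) (D.strand (x, b), false) (.inr (.inl ⟨?_, rfl⟩))
          intro v i hv
          have hxv : x = v.1 := by
            fin_cases i <;>
              exact congrArg Prod.fst (D.strand.injective (congrArg Prod.fst hv))
          have := mem_shadow_actual.1 v.2
          rw [← hxv] at this
          exact this hx
        rw [ht' x hx, pairs_ends false true]
        exact ⟨h' _, h' _⟩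
      · let v : D.unoriented.Vertex := ⟨x, mem_shadow_actual.2 hx⟩
        have hS : ∀ i h k, (i = D.unoriented.overPort v ∨ i = D.unoriented.overPort v + 2) →
            ((s v = true ∧ h = D.ends x (i + 1) ∧ k = D.ends x (i + 2)) ∨
              (s v = false ∧ h = D.ends x i ∧ k = D.ends x (i + 1))) → f h = f k :=
          fun i a b hi hab => h a b (.inr (.inr ⟨v, i, hi, hab⟩))
        rw [show t x = _ from ht v]
        have ho : D.unoriented.overPort v = if D.kind x = .positive then 0 else 1 := rfl
        rw [ho] at hS
        change ∀ e ∈ (smoothingOf (D.kind x) (s v)).pairs (D.ends x), f e.1 = f e.2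
        have h0 := fun i => hS i (D.ends x (i + 1)) (D.ends x (i + 2))
        have h1 := fun i => hS i (D.ends x i) (D.ends x (i + 1))
        have h00 := h0 0
        have h01 := h0 1
        have h02 := h0 2
        have h03 := h0 3
        have h10 := h1 0
        have h11 := h1 1
        have h12 := h1 2
        have h13 := h1 3
        cases hk : D.kind x <;> cases hs : s v <;>
          simp [hk, hs] at hx h00 h01 h02 h03 h10 h11 h12 h13 <;>
          simp [Smoothing.pairs, smoothingOf, *]
  · rintro ⟨h1, h2, h3⟩ h k (rfl | ⟨hh, rfl⟩ | ⟨v, i, hi, hik⟩)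
    · obtain ⟨p, _ | _⟩ := h
      · have := h1 (D.next.symm p)
        simp only [Equiv.apply_symm_apply] at this
        exact this.symm
      · exact h1 p
    · obtain ⟨p, β⟩ := h
      have key : f (p, true) = f (p, false) := by
        by_cases hp' : ∀ x b, p ≠ D.strand (x, b)
        · exact h2 p hp'
        · push Not at hp'
          obtain ⟨x, b, rfl⟩ := hp'
          have hx : D.kind x = .virtual := by
            by_contra hx
            let v : D.unoriented.Vertex := ⟨x, mem_shadow_actual.2 hx⟩
            cases b <;> cases β
            exacts [hh v 2 rfl, hh v 0 rfl, hh v 3 rfl, hh v 1 rfl]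
          have := h3 x (by simp)
          rw [ht' x hx, pairs_ends b true] at this
          exact this.1
      cases β
      exacts [key.symm, key]
    · have hx : D.kind v.1 ≠ .virtual := mem_shadow_actual.1 v.2
      have h4 : ∀ e ∈ (smoothingOf (D.kind v.1) (s v)).pairs (D.ends v.1), f e.1 = f e.2 :=
        ht v ▸ h3 (v.1 : D.C) (Finset.notMem_empty (α := D.C) _)
      have ho : D.unoriented.overPort v = if D.kind v.1 = .positive then 0 else 1 := rfl
      rw [ho] at hi
      change (s v = true ∧ h = D.ends v.1 (i + 1) ∧ k = D.ends v.1 (i + 2)) ∨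
        (s v = false ∧ h = D.ends v.1 i ∧ k = D.ends v.1 (i + 1)) at hik
      generalize D.ends v.1 = e at *
      rcases hik with ⟨hs, rfl, rfl⟩ | ⟨hs, rfl, rfl⟩ <;> rcases hi with rfl | rfl <;>
        cases hk : D.kind v.1 <;> simp_all [Smoothing.pairs, smoothingOf]

/-- The state sum has one factor `circleValue` per circle, the bracket one factor less. -/
theorem stateSum_eq_bracket [Nonempty D.P] :
    D.stateSum = circleValue * D.unoriented.bracket := by
  have hone : ∀ s, 1 ≤ D.unoriented.loops s := fun s => by
    have : Nonempty D.unoriented.Half := inferInstanceAs (Nonempty (D.P × Bool))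
    exact one_le_classes (D.unoriented.StateRel s)
  rw [UnorientedDiagram.bracket, Finset.mul_sum]
  symm
  let T : (D.unoriented.Vertex → Bool) → D.C → Smoothing := fun s x =>
    if hx : D.kind x ≠ .virtual then smoothingOf (D.kind x) (s ⟨x, mem_shadow_actual.2 hx⟩)
    else .straight
  have hT : ∀ s (v : D.unoriented.Vertex), T s v.1 = smoothingOf (D.kind v.1) (s v) :=
    fun s v => dif_pos (mem_shadow_actual.1 v.2)
  have hT' : ∀ s x, D.kind x = .virtual → T s x = .straight := fun s x hx => by simp [T, hx]
  refine Finset.sum_of_injOn T ?_ ?_ ?_ ?_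
  · intro s _ s' _ hs
    funext v
    have := congrFun hs v.1
    rw [hT, hT] at this
    exact smoothingOf_injective (mem_shadow_actual.1 v.2) this
  · intro s _
    simp [straightOn]
  · intro t _ ht
    rw [mul_eq_zero]
    left
    by_contra hne
    rw [coeffOff, Finset.prod_eq_zero_iff] at hne
    push Not at hne
    refine ht ⟨fun v => decide (t v.1 = smoothingOf (D.kind v.1) true),
      Finset.mem_coe.2 (Finset.mem_univ _), ?_⟩
    funext x
    have hx := hne x (by simp)
    cases hk : D.kind x <;> cases htx : t x <;>
      simp_all [T, CrossingKind.coeff, smoothingOf]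
  · intro s _
    have h1 : classes (D.joins ∅ (T s)) = D.unoriented.loops s :=
      (classes_congr fun γ f => respects_stateRel s (T s) (hT s) (hT' s) f).symm
    rw [h1, ← Nat.sub_add_cancel (hone s), pow_succ, mul_comm, mul_assoc, Nat.add_sub_cancel]
    change _ * (circleValue ^ _ * _) = _
    congr 1
    have key : ∀ (p : D.C → Prop) (_ : DecidablePred p) (g : D.C → ℤ[T;T⁻¹]),
        (∀ x, ¬ p x → g x = 1) →
        ∏ v : {x // p x}, g v.1 = ∏ x, g x := by
      intro p hp g hg
      rw [← Finset.prod_subset (Finset.subset_univ (Finset.univ.filter p)) (by simpa using hg),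
        ← Finset.prod_subtype_eq_prod_filter, Finset.subtype_univ]
    rw [coeffOff, Finset.compl_empty]
    refine Eq.trans (Finset.prod_congr rfl fun v _ => ?_)
      (key (fun x => D.shadow.actual x = true)
        (fun x => instDecidableEqBool (D.shadow.actual x) true)
        (fun x => (D.kind x).coeff (T s x)) ?_)
    · have h2 := mem_shadow_actual.1 v.2
      refine Eq.trans ?_ (congrArg (D.kind v.1).coeff (hT s v)).symm
      cases hk : D.kind v.1 <;> cases hs : s v <;> simp_all [CrossingKind.coeff, smoothingOf]
    · intro x hx
      have hk : D.kind x = .virtual := by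
        by_contra h
        exact hx (mem_shadow_actual.2 h)
      simp only [hT' s x hk, hk]
      rfl

end DiagramData

/-! ### Connecting the ends of a tangle -/

/-- The ends `u` and `u'` are connected by a segment and to nothing else: together they form a class
of the equivalence relation generated by `r`. -/
structure IsSegment {α : Type} (r : α → α → Prop) (u u' : α) : Prop where
  respects : Respects r fun x => x = u ∨ x = u'
  eq : ∀ {γ : Type} {f : α → γ}, Respects r f → f u = f u'

theorem IsSegment.symm {α : Type} {r : α → α → Prop} {u u' : α} (h : IsSegment r u u') :
    IsSegment r u' u where
  respects x y hxy := by
    have := h.respects x y hxy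
    simpa only [or_comm] using this
  eq hf := (h.eq hf).symm

/-- The ways to connect four ends `u`, `a`, `v`, `b` at a crossing with strands `u`, `a` and
`v`, `b`. -/
def Smoothing.link {α : Type} (s : Smoothing) (u a v b : α) : List (α × α) :=
  match s with
  | straight => [(u, a), (v, b)]
  | oriented => [(u, b), (a, v)]
  | disoriented => [(u, v), (a, b)]

/-- The number of curves obtained from `r` by connecting the ends `e i` according to `l`. -/
def linked {α ι : Type} (r : α → α → Prop) (e : ι → α) (l : List (ι × ι)) : ℕ :=
  classes (glue r (l.map (Prod.map e e)))

section linked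

variable {α ι : Type} {r : α → α → Prop} {e : ι → α}

theorem respects_glue_map {l : List (ι × ι)} {γ : Type} {f : α → γ} :
    Respects (glue r (l.map (Prod.map e e))) f ↔
      Respects r f ∧ ∀ p ∈ l, (f ∘ e) p.1 = (f ∘ e) p.2 := by
  rw [respects_glue]
  simp only [List.forall_mem_map, Prod.map_fst, Prod.map_snd, Function.comp_apply]

/-- The number of curves does not change if the pairs to be linked are replaced by others which are
equivalent in the presence of the given segments. -/
theorem linked_congr {l l' : List (ι × ι)} (m : List (ι × ι))
    (hm : ∀ p ∈ m, IsSegment r (e p.1) (e p.2))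
    (h : ∀ (γ : Type) (f : ι → γ), (∀ p ∈ m, f p.1 = f p.2) →
      ((∀ p ∈ l, f p.1 = f p.2) ↔ ∀ p ∈ l', f p.1 = f p.2)) :
    linked r e l = linked r e l' := by
  refine classes_congr fun γ f => ?_
  rw [respects_glue_map, respects_glue_map]
  exact and_congr_right fun hf => h γ (f ∘ e) fun p hp => (hm p hp).eq hf

/-- Attaching a free segment to another end. -/
theorem linked_cons [Finite α] [DecidableEq ι] (he : Function.Injective e) {l : List (ι × ι)}
    {i i' j : ι} (h : IsSegment r (e i) (e i'))
    (hl : ∀ p ∈ l, (p.1 = i ∨ p.1 = i') ↔ (p.2 = i ∨ p.2 = i')) (hj : ¬ (j = i ∨ j = i')) :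
    linked r e ((i, j) :: l) + 1 = linked r e l := by
  refine classes_glue_cons _ h.respects ?_ (.inl rfl) ?_
  · simp only [List.mem_map]
    rintro _ ⟨p, hp, rfl⟩
    simpa [he.eq_iff] using hl p hp
  · simpa [he.eq_iff] using hj

end linked

/-- The value of the crossings of a second move, as a linear combination of numbers of curves.  The
inner segments are `0 1` and `2 3`, the outer ends continuing `0, 1, 2, 3` are `4, 5, 6, 7`. -/
theorem bigon_linked {α : Type} [Finite α] {r : α → α → Prop} {e : Fin 8 → α}
    (he : Function.Injective e) (h01 : IsSegment r (e 0) (e 1)) (h23 : IsSegment r (e 2) (e 3))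
    {κ : CrossingKind} :
    ∑ s, κ.coeff s * ∑ s', κ.switch.coeff s' *
        circleValue ^ linked r e (Smoothing.link s 0 4 2 6 ++ Smoothing.link s' 1 5 3 7) =
      circleValue ^ linked r e (Smoothing.link .straight 0 4 2 6 ++
        Smoothing.link .straight 1 5 3 7) := by
  have hcongr : ∀ {l l' : List (Fin 8 × Fin 8)}, (∀ (γ : Type) (f : Fin 8 → γ), f 0 = f 1 →
      f 2 = f 3 → ((∀ p ∈ l, f p.1 = f p.2) ↔ ∀ p ∈ l', f p.1 = f p.2)) →
      linked r e l = linked r e l' := by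
    intro l l' h
    refine linked_congr [(0, 1), (2, 3)] ?_ ?_
    · simpa using ⟨h01, h23⟩
    · simpa using h
  have hP : linked r e (Smoothing.link .oriented 0 4 2 6 ++ Smoothing.link .oriented 1 5 3 7) =
      linked r e (Smoothing.link .straight 0 4 2 6 ++ Smoothing.link .straight 1 5 3 7) := by
    have h1 := linked_cons (i := 0) (i' := 1) (j := 4) (l := [(2, 6), (4, 5), (6, 7)]) he h01
      (by decide) (by decide)
    have h2 := linked_cons (i := 2) (i' := 3) (j := 6) (l := [(4, 5), (6, 7)]) he h23
      (by decide) (by decide)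
    have h3 := linked_cons (i := 0) (i' := 1) (j := 6) (l := [(2, 4), (4, 5), (6, 7)]) he h01
      (by decide) (by decide)
    have h4 := linked_cons (i := 2) (i' := 3) (j := 4) (l := [(4, 5), (6, 7)]) he h23
      (by decide) (by decide)
    have h5 : linked r e (Smoothing.link .oriented 0 4 2 6 ++ Smoothing.link .oriented 1 5 3 7) =
        linked r e [(0, 6), (2, 4), (4, 5), (6, 7)] :=
      hcongr fun γ f hu hv => by simp [Smoothing.link]; grind
    have h6 : linked r e (Smoothing.link .straight 0 4 2 6 ++ Smoothing.link .straight 1 5 3 7) =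
        linked r e [(0, 4), (2, 6), (4, 5), (6, 7)] :=
      hcongr fun γ f hu hv => by simp [Smoothing.link]; grind
    omega
  have hN : linked r e (Smoothing.link .disoriented 0 4 2 6 ++
      Smoothing.link .disoriented 1 5 3 7) = linked r e [(0, 2), (4, 6), (5, 7)] :=
    hcongr fun γ f hu hv => by simp [Smoothing.link]; grind
  have hPN : linked r e (Smoothing.link .oriented 0 4 2 6 ++
      Smoothing.link .disoriented 1 5 3 7) + 1 = linked r e [(0, 2), (4, 6), (5, 7)] := by
    have h1 := linked_cons (i := 0) (i' := 1) (j := 4) (l := [(2, 4), (4, 6), (5, 7)]) he h01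
      (by decide) (by decide)
    have h2 := linked_cons (i := 2) (i' := 3) (j := 4) (l := [(4, 6), (5, 7)]) he h23
      (by decide) (by decide)
    have h3 := linked_cons (i := 0) (i' := 1) (j := 2) (l := [(4, 6), (5, 7)]) he h01
      (by decide) (by decide)
    have h5 : linked r e (Smoothing.link .oriented 0 4 2 6 ++
        Smoothing.link .disoriented 1 5 3 7) = linked r e [(0, 4), (2, 4), (4, 6), (5, 7)] :=
      hcongr fun γ f hu hv => by simp [Smoothing.link]; grind
    omega
  have hNP : linked r e (Smoothing.link .disoriented 0 4 2 6 ++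
      Smoothing.link .oriented 1 5 3 7) + 1 = linked r e [(0, 2), (4, 6), (5, 7)] := by
    have h1 := linked_cons (i := 0) (i' := 1) (j := 5) (l := [(2, 5), (4, 6), (5, 7)]) he h01
      (by decide) (by decide)
    have h2 := linked_cons (i := 2) (i' := 3) (j := 5) (l := [(4, 6), (5, 7)]) he h23
      (by decide) (by decide)
    have h3 := linked_cons (i := 0) (i' := 1) (j := 2) (l := [(4, 6), (5, 7)]) he h01
      (by decide) (by decide)
    have h5 : linked r e (Smoothing.link .disoriented 0 4 2 6 ++
        Smoothing.link .oriented 1 5 3 7) = linked r e [(0, 5), (2, 5), (4, 6), (5, 7)] :=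
      hcongr fun γ f hu hv => by simp [Smoothing.link]; grind
    omega
  have hq : q 1 * q (-1) = 1 := by rw [q_mul_q]; exact q_zero
  have hδ : circleValue = -(q (-1) * q (-1)) - q 1 * q 1 := by
    rw [q_mul_q, q_mul_q]; rfl
  cases κ
  · simp only [Smoothing.sum_univ, CrossingKind.switch, CrossingKind.coeff, zero_mul, zero_add]
    rw [hP, hN, ← hPN, show linked r e (Smoothing.link .disoriented 0 4 2 6 ++
      Smoothing.link .oriented 1 5 3 7) = linked r e (Smoothing.link .oriented 0 4 2 6 ++
      Smoothing.link .disoriented 1 5 3 7) by omega, pow_succ]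
    generalize circleValue ^ _ = A
    generalize circleValue ^ _ = B
    rw [hδ]
    linear_combination (A - (q 1 * q 1 + q (-1) * q (-1)) * B) * hq
  · simp only [Smoothing.sum_univ, CrossingKind.switch, CrossingKind.coeff, zero_mul, zero_add]
    rw [hP, hN, ← hPN, show linked r e (Smoothing.link .disoriented 0 4 2 6 ++
      Smoothing.link .oriented 1 5 3 7) = linked r e (Smoothing.link .oriented 0 4 2 6 ++
      Smoothing.link .disoriented 1 5 3 7) by omega, pow_succ]
    generalize circleValue ^ _ = A
    generalize circleValue ^ _ = B
    rw [hδ]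
    linear_combination (A - (q 1 * q 1 + q (-1) * q (-1)) * B) * hq
  · simp [Smoothing.sum_univ, CrossingKind.switch, CrossingKind.coeff]

/-- The value of a triangle with crossings of the given kinds.  The three strands carry the ends
`0, 1, 2, 3`, `4, 5, 6, 7` and `8, 9, 10, 11`, in this order; the middle two ends of each strand
belong to a side of the triangle. -/
def triangleSum {α : Type} (r : α → α → Prop) (e : Fin 12 → α) (κ κ' κ'' : CrossingKind) :
    ℤ[T;T⁻¹] :=
  ∑ s, κ.coeff s * ∑ s', κ'.coeff s' * ∑ s'', κ''.coeff s'' *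
    circleValue ^ linked r e (Smoothing.link s 1 0 5 4 ++ Smoothing.link s' 2 3 9 8 ++
      Smoothing.link s'' 6 7 10 11)

/-- Exchanging the two crossings on each strand of a triangle. -/
def flipTriangle : Fin 12 → Fin 12 := ![3, 2, 1, 0, 7, 6, 5, 4, 11, 10, 9, 8]

section triangle

variable {α : Type} {r : α → α → Prop} {e : Fin 12 → α}

theorem triangle_congr (h12 : IsSegment r (e 1) (e 2)) (h56 : IsSegment r (e 5) (e 6))
    (h90 : IsSegment r (e 9) (e 10)) {l l' : List (Fin 12 × Fin 12)}
    (h : ∀ (γ : Type) (f : Fin 12 → γ), f 1 = f 2 → f 5 = f 6 → f 9 = f 10 →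
      ((∀ p ∈ l, f p.1 = f p.2) ↔ ∀ p ∈ l', f p.1 = f p.2)) :
    linked r e l = linked r e l' := by
  refine linked_congr [(1, 2), (5, 6), (9, 10)] ?_ ?_
  · simpa using ⟨h12, h56, h90⟩
  · simpa using h

/-- The ends of a triangle which do not belong to its sides. -/
def outerEnds : Finset (Fin 12) := {0, 3, 4, 7, 8, 11}

/-- If each side of the triangle is attached to an outer end, then only the connections between the
outer ends matter. -/
theorem triangle_attach [Finite α] (he : Function.Injective e) (h12 : IsSegment r (e 1) (e 2))
    (h56 : IsSegment r (e 5) (e 6)) (h90 : IsSegment r (e 9) (e 10)) (i j k : Fin 12)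
    (l : List (Fin 12 × Fin 12)) (hi : i ∈ outerEnds) (hj : j ∈ outerEnds) (hk : k ∈ outerEnds)
    (hl : ∀ p ∈ l, p.1 ∈ outerEnds ∧ p.2 ∈ outerEnds) :
    linked r e ((1, i) :: (5, j) :: (9, k) :: l) + 3 = linked r e l := by
  have ho : ∀ i ∈ outerEnds, (¬ (i = 1 ∨ i = 2)) ∧ (¬ (i = 5 ∨ i = 6)) ∧ ¬ (i = 9 ∨ i = 10) := by
    decide
  have h1 := linked_cons (i := 9) (i' := 10) (j := k) (l := l) he h90
    (fun p hp => by simp only [ho _ (hl p hp).1, ho _ (hl p hp).2]) (ho k hk).2.2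
  have h2 := linked_cons (i := 5) (i' := 6) (j := j) (l := (9, k) :: l) he h56
    (by
      rintro p (_ | ⟨_, hp⟩)
      · simp only [ho k hk]
        decide
      · simp only [ho _ (hl p hp).1, ho _ (hl p hp).2]) (ho j hj).2.1
  have h3 := linked_cons (i := 1) (i' := 2) (j := i) (l := (5, j) :: (9, k) :: l) he h12
    (by
      rintro p (_ | ⟨_, _ | ⟨_, hp⟩⟩)
      · simp only [ho j hj]
        decide
      · simp only [ho k hk]
        decide
      · simp only [ho _ (hl p hp).1, ho _ (hl p hp).2]) (ho i hi).1
  omega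

/-- A side of the triangle closing up to a circle disjoint from the outer ends. -/
theorem triangle_attach_circle [Finite α] (he : Function.Injective e)
    (h12 : IsSegment r (e 1) (e 2)) (h56 : IsSegment r (e 5) (e 6)) (h90 : IsSegment r (e 9) (e 10))
    (l : List (Fin 12 × Fin 12)) (hl : ∀ p ∈ l, p.1 ∈ outerEnds ∧ p.2 ∈ outerEnds) :
    linked r e ((1, 5) :: (5, 9) :: l) = linked r e l - 3 + 1 := by
  have ho : ∀ i ∈ outerEnds, (¬ (i = 1 ∨ i = 2)) ∧ (¬ (i = 5 ∨ i = 6)) ∧ ¬ (i = 9 ∨ i = 10) := by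
    decide
  have h1 := linked_cons (i := 5) (i' := 6) (j := 9) (l := l) he h56
    (fun p hp => by simp only [ho _ (hl p hp).1, ho _ (hl p hp).2]) (by decide)
  have h2 := linked_cons (i := 1) (i' := 2) (j := 5) (l := (5, 9) :: l) he h12
    (by
      rintro p (_ | ⟨_, hp⟩)
      · decide
      · simp only [ho _ (hl p hp).1, ho _ (hl p hp).2]) (by decide)
  have h3 := triangle_attach he h12 h56 h90 0 0 0 l (by decide) (by decide) (by decide) hl
  omega

/-- The value of a triangle of classical crossings as a combination of the five ways to connect the
outer ends without crossings. -/
theorem triangleSum_eq [Finite α] (he : Function.Injective e) (h12 : IsSegment r (e 1) (e 2))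
    (h56 : IsSegment r (e 5) (e 6)) (h90 : IsSegment r (e 9) (e 10)) {κ : CrossingKind}
    (hκ : κ ≠ .virtual) :
    triangleSum r e κ κ.switch κ =
      κ.coeff .oriented ^ 3 * circleValue ^ (linked r e [(4, 7), (0, 11), (3, 8)] - 3) +
      κ.coeff .oriented * (circleValue ^ (linked r e [(0, 4), (3, 8), (7, 11)] - 3) +
        circleValue ^ (linked r e [(4, 8), (3, 7), (0, 11)] - 3)) +
      κ.coeff .disoriented * (circleValue ^ (linked r e [(8, 11), (3, 7), (0, 4)] - 3) +
        circleValue ^ (linked r e [(4, 8), (0, 3), (7, 11)] - 3)) := by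
  have A := fun i j k l hi hj hk hl =>
    Nat.eq_sub_of_add_eq (triangle_attach he h12 h56 h90 i j k l hi hj hk hl)
  -- The three letters in the names of the following equations tell whether the smoothing of the
  -- crossing has the coefficient of the oriented (`P`) or of the disoriented smoothing (`N`) at a
  -- crossing of kind `κ`.
  have hPPP : linked r e (Smoothing.link .oriented 1 0 5 4 ++ Smoothing.link .disoriented 2 3 9 8 ++
      Smoothing.link .oriented 6 7 10 11) = linked r e [(4, 7), (0, 11), (3, 8)] - 3 := by
    rw [← A 4 0 4 _ (by decide) (by decide) (by decide) (by simp [outerEnds])]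
    exact triangle_congr h12 h56 h90 fun γ f hu hv hw => by simp [Smoothing.link]; grind
  have hPPN : linked r e (Smoothing.link .oriented 1 0 5 4 ++ Smoothing.link .disoriented 2 3 9 8 ++
      Smoothing.link .disoriented 6 7 10 11) = linked r e [(0, 4), (3, 8), (7, 11)] - 3 := by
    rw [← A 4 4 4 _ (by decide) (by decide) (by decide) (by simp [outerEnds])]
    exact triangle_congr h12 h56 h90 fun γ f hu hv hw => by simp [Smoothing.link]; grind
  have hPNP : linked r e (Smoothing.link .oriented 1 0 5 4 ++ Smoothing.link .oriented 2 3 9 8 ++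
      Smoothing.link .oriented 6 7 10 11) = linked r e [(4, 8), (3, 7), (0, 11)] - 3 := by
    rw [← A 4 0 3 _ (by decide) (by decide) (by decide) (by simp [outerEnds])]
    exact triangle_congr h12 h56 h90 fun γ f hu hv hw => by simp [Smoothing.link]; grind
  have hNPP : linked r e (Smoothing.link .disoriented 1 0 5 4 ++
      Smoothing.link .disoriented 2 3 9 8 ++ Smoothing.link .oriented 6 7 10 11) =
        linked r e [(0, 4), (3, 8), (7, 11)] - 3 := by
    rw [← A 7 7 7 _ (by decide) (by decide) (by decide) (by simp [outerEnds])]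
    exact triangle_congr h12 h56 h90 fun γ f hu hv hw => by simp [Smoothing.link]; grind
  have hNNP : linked r e (Smoothing.link .disoriented 1 0 5 4 ++ Smoothing.link .oriented 2 3 9 8 ++
      Smoothing.link .oriented 6 7 10 11) = linked r e [(8, 11), (3, 7), (0, 4)] - 3 := by
    rw [← A 8 8 3 _ (by decide) (by decide) (by decide) (by simp [outerEnds])]
    exact triangle_congr h12 h56 h90 fun γ f hu hv hw => by simp [Smoothing.link]; grind
  have hNPN : linked r e (Smoothing.link .disoriented 1 0 5 4 ++
      Smoothing.link .disoriented 2 3 9 8 ++ Smoothing.link .disoriented 6 7 10 11) =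
        linked r e [(0, 4), (3, 8), (7, 11)] - 3 + 1 := by
    rw [← triangle_attach_circle he h12 h56 h90 _ (by simp [outerEnds])]
    exact triangle_congr h12 h56 h90 fun γ f hu hv hw => by simp [Smoothing.link]; grind
  have hPNN : linked r e (Smoothing.link .oriented 1 0 5 4 ++ Smoothing.link .oriented 2 3 9 8 ++
      Smoothing.link .disoriented 6 7 10 11) = linked r e [(4, 8), (0, 3), (7, 11)] - 3 := by
    rw [← A 4 0 0 _ (by decide) (by decide) (by decide) (by simp [outerEnds])]
    exact triangle_congr h12 h56 h90 fun γ f hu hv hw => by simp [Smoothing.link]; grind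
  have hNNN : linked r e (Smoothing.link .disoriented 1 0 5 4 ++ Smoothing.link .oriented 2 3 9 8 ++
      Smoothing.link .disoriented 6 7 10 11) = linked r e [(0, 4), (3, 8), (7, 11)] - 3 := by
    rw [← A 8 8 8 _ (by decide) (by decide) (by decide) (by simp [outerEnds])]
    exact triangle_congr h12 h56 h90 fun γ f hu hv hw => by simp [Smoothing.link]; grind
  have hq : q 1 * q (-1) = 1 := by rw [q_mul_q]; exact q_zero
  have hδ : circleValue = -(q (-1) * q (-1)) - q 1 * q 1 := by
    rw [q_mul_q, q_mul_q]; rfl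
  cases κ
  · simp only [triangleSum, Smoothing.sum_univ, CrossingKind.switch, CrossingKind.coeff, zero_mul,
      zero_add, hPPP, hPPN, hPNP, hNPP, hNNP, hNPN, hPNN, hNNN, pow_succ _ (_ - 3)]
    generalize circleValue ^ (linked r e [(4, 7), (0, 11), (3, 8)] - 3) = m₁
    generalize circleValue ^ (linked r e [(0, 4), (3, 8), (7, 11)] - 3) = m₂
    generalize circleValue ^ (linked r e [(4, 8), (3, 7), (0, 11)] - 3) = m₃
    generalize circleValue ^ (linked r e [(8, 11), (3, 7), (0, 4)] - 3) = m₄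
    generalize circleValue ^ (linked r e [(4, 8), (0, 3), (7, 11)] - 3) = m₅
    rw [hδ]
    linear_combination (q 1 * m₃ + q (-1) * (m₄ + m₅) -
      (q (-1) ^ 3 + q 1 * (q 1 * q (-1) - 1)) * m₂) * hq
  · simp only [triangleSum, Smoothing.sum_univ, CrossingKind.switch, CrossingKind.coeff, zero_mul,
      zero_add, hPPP, hPPN, hPNP, hNPP, hNNP, hNPN, hPNN, hNNN, pow_succ _ (_ - 3)]
    generalize circleValue ^ (linked r e [(4, 7), (0, 11), (3, 8)] - 3) = m₁
    generalize circleValue ^ (linked r e [(0, 4), (3, 8), (7, 11)] - 3) = m₂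
    generalize circleValue ^ (linked r e [(4, 8), (3, 7), (0, 11)] - 3) = m₃
    generalize circleValue ^ (linked r e [(8, 11), (3, 7), (0, 4)] - 3) = m₄
    generalize circleValue ^ (linked r e [(4, 8), (0, 3), (7, 11)] - 3) = m₅
    rw [hδ]
    linear_combination (q (-1) * m₃ + q 1 * (m₄ + m₅) -
      (q 1 ^ 3 + q (-1) * (q 1 * q (-1) - 1)) * m₂) * hq
  · exact absurd rfl hκ

/-- Third moves do not change the value of a triangle. -/
theorem triangleSum_flip [Finite α] (he : Function.Injective e) (h12 : IsSegment r (e 1) (e 2))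
    (h56 : IsSegment r (e 5) (e 6)) (h90 : IsSegment r (e 9) (e 10)) {κ κ' κ'' : CrossingKind}
    (hκ : κ ≠ .virtual ∧ κ' = κ.switch ∧ κ'' = κ ∨ κ = .virtual ∧ κ' = .virtual ∨
      κ = .virtual ∧ κ'' = .virtual ∨ κ' = .virtual ∧ κ'' = .virtual) :
    triangleSum r (e ∘ flipTriangle) κ κ' κ'' = triangleSum r e κ κ' κ'' := by
  have hlink : ∀ l, linked r (e ∘ flipTriangle) l =
      linked r e (l.map (Prod.map flipTriangle flipTriangle)) := by
    intro l
    rw [linked, linked, List.map_map, Prod.map_comp_map]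
  have A := fun i j k l hi hj hk hl =>
    Nat.eq_sub_of_add_eq (triangle_attach he h12 h56 h90 i j k l hi hj hk hl)
  have C := fun l l' => triangle_congr (l := l) (l' := l') h12 h56 h90
  rcases hκ with ⟨hκ, rfl, rfl⟩ | ⟨rfl, rfl⟩ | ⟨rfl, rfl⟩ | ⟨rfl, rfl⟩
  · rw [triangleSum_eq (he.comp (by decide)) h12.symm h56.symm h90.symm hκ,
      triangleSum_eq he h12 h56 h90 hκ]
    simp only [hlink]
    have h1 : linked r e ([(4, 7), (0, 11), (3, 8)].map (Prod.map flipTriangle flipTriangle)) =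
        linked r e [(4, 7), (0, 11), (3, 8)] :=
      C _ _ fun γ f _ _ _ => by simp [flipTriangle]; grind
    have h2 : linked r e ([(0, 4), (3, 8), (7, 11)].map (Prod.map flipTriangle flipTriangle)) =
        linked r e [(4, 8), (3, 7), (0, 11)] :=
      C _ _ fun γ f _ _ _ => by simp [flipTriangle]; grind
    have h3 : linked r e ([(4, 8), (3, 7), (0, 11)].map (Prod.map flipTriangle flipTriangle)) =
        linked r e [(0, 4), (3, 8), (7, 11)] :=
      C _ _ fun γ f _ _ _ => by simp [flipTriangle]; grind
    have h4 : linked r e ([(8, 11), (3, 7), (0, 4)].map (Prod.map flipTriangle flipTriangle)) =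
        linked r e [(8, 11), (3, 7), (0, 4)] :=
      C _ _ fun γ f _ _ _ => by simp [flipTriangle]; grind
    have h5 : linked r e ([(4, 8), (0, 3), (7, 11)].map (Prod.map flipTriangle flipTriangle)) =
        linked r e [(4, 8), (0, 3), (7, 11)] :=
      C _ _ fun γ f _ _ _ => by simp [flipTriangle]; grind
    rw [h1, h2, h3, h4, h5, add_comm (circleValue ^ (linked r e [(4, 8), (3, 7), (0, 11)] - 3))]
  · have hs : ∀ s, linked r (e ∘ flipTriangle) (Smoothing.link .straight 1 0 5 4 ++
          Smoothing.link .straight 2 3 9 8 ++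
          Smoothing.link s 6 7 10 11) =
        linked r e (Smoothing.link .straight 1 0 5 4 ++ Smoothing.link .straight 2 3 9 8 ++
          Smoothing.link s 6 7 10 11) := by
      intro s
      have h1 : linked r e (Smoothing.link .straight 1 0 5 4 ++ Smoothing.link .straight 2 3 9 8 ++
          Smoothing.link s 6 7 10 11) =
          linked r e ((0, 3) :: Smoothing.link s 4 7 8 11) - 3 := by
        rw [← A 0 4 8 _ (by decide) (by decide) (by decide)
          (by cases s <;> simp [Smoothing.link, outerEnds])]
        exact C _ _ fun γ f hu hv hw => by cases s <;> simp [Smoothing.link] <;> grind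
      have h2 : linked r (e ∘ flipTriangle) (Smoothing.link .straight 1 0 5 4 ++
          Smoothing.link .straight 2 3 9 8 ++
          Smoothing.link s 6 7 10 11) =
          linked r e ((0, 3) :: Smoothing.link s 4 7 8 11) - 3 := by
        rw [hlink, ← A 3 7 11 _ (by decide) (by decide) (by decide)
          (by cases s <;> simp [Smoothing.link, outerEnds])]
        exact C _ _ fun γ f hu hv hw => by
          cases s <;> simp [Smoothing.link, flipTriangle] <;> grind
      rw [h1, h2]
    simp only [triangleSum, Smoothing.sum_univ, CrossingKind.coeff, zero_mul, add_zero, one_mul, hs]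
  · have hs : ∀ s, linked r (e ∘ flipTriangle) (Smoothing.link .straight 1 0 5 4 ++
          Smoothing.link s 2 3 9 8 ++
          Smoothing.link .straight 6 7 10 11) =
        linked r e (Smoothing.link .straight 1 0 5 4 ++ Smoothing.link s 2 3 9 8 ++
          Smoothing.link .straight 6 7 10 11) := by
      intro s
      have h1 : linked r e (Smoothing.link .straight 1 0 5 4 ++ Smoothing.link s 2 3 9 8 ++
          Smoothing.link .straight 6 7 10 11) =
          linked r e ((4, 7) :: Smoothing.link s 0 3 11 8) - 3 := by
        rw [← A 0 4 11 _ (by decide) (by decide) (by decide)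
          (by cases s <;> simp [Smoothing.link, outerEnds])]
        exact C _ _ fun γ f hu hv hw => by cases s <;> simp [Smoothing.link] <;> grind
      have h2 : linked r (e ∘ flipTriangle) (Smoothing.link .straight 1 0 5 4 ++
          Smoothing.link s 2 3 9 8 ++
          Smoothing.link .straight 6 7 10 11) =
          linked r e ((4, 7) :: Smoothing.link s 0 3 11 8) - 3 := by
        rw [hlink, ← A 3 7 8 _ (by decide) (by decide) (by decide)
          (by cases s <;> simp [Smoothing.link, outerEnds])]
        exact C _ _ fun γ f hu hv hw => by
          cases s <;> simp [Smoothing.link, flipTriangle] <;> grind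
      rw [h1, h2]
    simp only [triangleSum, Smoothing.sum_univ, CrossingKind.coeff, zero_mul, add_zero, one_mul, hs]
  · have hs : ∀ s, linked r (e ∘ flipTriangle) (Smoothing.link s 1 0 5 4 ++
          Smoothing.link .straight 2 3 9 8 ++
          Smoothing.link .straight 6 7 10 11) =
        linked r e (Smoothing.link s 1 0 5 4 ++ Smoothing.link .straight 2 3 9 8 ++
          Smoothing.link .straight 6 7 10 11) := by
      intro s
      have h1 : linked r e (Smoothing.link s 1 0 5 4 ++ Smoothing.link .straight 2 3 9 8 ++
          Smoothing.link .straight 6 7 10 11) =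
          linked r e ((8, 11) :: Smoothing.link s 3 0 7 4) - 3 := by
        rw [← A 3 7 8 _ (by decide) (by decide) (by decide)
          (by cases s <;> simp [Smoothing.link, outerEnds])]
        exact C _ _ fun γ f hu hv hw => by cases s <;> simp [Smoothing.link] <;> grind
      have h2 : linked r (e ∘ flipTriangle) (Smoothing.link s 1 0 5 4 ++
          Smoothing.link .straight 2 3 9 8 ++
          Smoothing.link .straight 6 7 10 11) =
          linked r e ((8, 11) :: Smoothing.link s 3 0 7 4) - 3 := by
        rw [hlink, ← A 0 4 11 _ (by decide) (by decide) (by decide)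
          (by cases s <;> simp [Smoothing.link, outerEnds])]
        exact C _ _ fun γ f hu hv hw => by
          cases s <;> simp [Smoothing.link, flipTriangle] <;> grind
      rw [h1, h2]
    simp only [triangleSum, Smoothing.sum_univ, CrossingKind.coeff, zero_mul, add_zero, one_mul, hs]

end triangle

/-! ### State sums and the generalized Reidemeister moves -/

/-- Exchanging the two smoothings without virtual crossings if `b = false`. -/
def Smoothing.twist (b : Bool) (s : Smoothing) : Smoothing :=
  match b, s with
  | false, .oriented => .disoriented
  | false, .disoriented => .oriented
  | _, s => s

/-- The kind of crossing with the coefficients of the two smoothings exchanged if `b = false`. -/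
def CrossingKind.twist (b : Bool) (κ : CrossingKind) : CrossingKind :=
  if b = true then κ else κ.switch

theorem sum_coeff_twist (κ : CrossingKind) (b : Bool) (F : Smoothing → ℤ[T;T⁻¹]) :
    ∑ s, κ.coeff s * F (s.twist b) = ∑ s, (κ.twist b).coeff s * F s := by
  cases κ <;> cases b <;>
    simp [Smoothing.sum_univ, CrossingKind.coeff, Smoothing.twist, CrossingKind.twist,
      CrossingKind.switch, add_comm]

theorem sum_sum_coeff_twist (κ κ' : CrossingKind) (b b' : Bool)
    (F : Smoothing → Smoothing → ℤ[T;T⁻¹]) :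
    ∑ s, κ.coeff s * ∑ s', κ'.coeff s' * F (s.twist b) (s'.twist b') =
      ∑ s, (κ.twist b).coeff s * ∑ s', (κ'.twist b').coeff s' * F s s' := by
  simp only [sum_coeff_twist κ' b' (F _)]
  exact sum_coeff_twist κ b fun s => ∑ s', (κ'.twist b').coeff s' * F s s'

theorem sum_sum_sum_coeff_twist (κ κ' κ'' : CrossingKind) (b b' b'' : Bool)
    (F : Smoothing → Smoothing → Smoothing → ℤ[T;T⁻¹]) :
    ∑ s, κ.coeff s * ∑ s', κ'.coeff s' * ∑ s'', κ''.coeff s'' *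
        F (s.twist b) (s'.twist b') (s''.twist b'') =
      ∑ s, (κ.twist b).coeff s * ∑ s', (κ'.twist b').coeff s' * ∑ s'', (κ''.twist b'').coeff s'' *
        F s s' s'' := by
  simp only [sum_coeff_twist κ'' b'' (F _ _)]
  exact sum_sum_coeff_twist κ κ' b b' fun s s' => ∑ s'', (κ''.twist b'').coeff s'' * F s s' s''

theorem Smoothing.map_link {α β : Type} (e : α → β) (s : Smoothing) (u a v b : α) :
    (s.link u a v b).map (Prod.map e e) = s.link (e u) (e a) (e v) (e b) := by
  cases s <;> rfl

namespace DiagramData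

variable {D : DiagramData}

/-- The ends at a crossing are connected as described by `Smoothing.link`, the directions of the
ends `u` and `v` being `β` and `β'`. -/
theorem pairs_iff_link {x : D.C} (i β β' : Bool) (s : Smoothing) {γ : Type} {f : D.P × Bool → γ} :
    (∀ e ∈ s.pairs (D.ends x), f e.1 = f e.2) ↔
      ∀ e ∈ (s.twist (β == β')).link (D.strand (x, i), β) (D.strand (x, i), !β)
        (D.strand (x, !i), β') (D.strand (x, !i), !β'), f e.1 = f e.2 := by
  rw [pairs_ends i β]
  cases s <;> cases β <;> cases β' <;> simp [Smoothing.twist, Smoothing.link] <;> grind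

theorem isSegment_joins {S : Finset D.C} {t : D.C → Smoothing} {x y : D.C} {b b' o : Bool}
    (h : D.Consecutive o (D.strand (x, b)) (D.strand (y, b'))) (hx : x ∈ S) (hy : y ∈ S) :
    IsSegment (D.joins S t) (D.strand (x, b), o) (D.strand (y, b'), !o) := by
  have key : ∀ {x y : D.C} {b b' : Bool}, D.next (D.strand (x, b)) = D.strand (y, b') → x ∈ S →
      y ∈ S → IsSegment (D.joins S t) (D.strand (x, b), true) (D.strand (y, b'), false) := by
    intro x y b b' h hx hy
    constructor
    · rw [respects_joins]
      refine ⟨fun p => ?_, fun p hp => ?_, fun z hz e he => ?_⟩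
      · simp [← h]
      · simp [hp]
      · have h1 : ∀ c, (D.strand (z, c) = D.strand (x, b)) = False := fun c => by
          simp only [EmbeddingLike.apply_eq_iff_eq, Prod.mk.injEq, eq_iff_iff, iff_false]
          rintro ⟨rfl, _⟩
          exact hz hx
        have h2 : ∀ c, (D.strand (z, c) = D.strand (y, b')) = False := fun c => by
          simp only [EmbeddingLike.apply_eq_iff_eq, Prod.mk.injEq, eq_iff_iff, iff_false]
          rintro ⟨rfl, _⟩
          exact hz hy
        have h3 : ∀ k, ((D.ends z k = (D.strand (x, b), true) ∨
            D.ends z k = (D.strand (y, b'), false)) : Prop) = False := by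
          intro k
          fin_cases k <;> simp [ends, h1, h2]
        cases ht : t z <;> rw [ht] at he <;> simp only [Smoothing.pairs, List.mem_cons,
          List.not_mem_nil, or_false] at he <;> rcases he with rfl | rfl <;> simp only [h3]
    · intro γ f hf
      rw [respects_joins] at hf
      rw [← h]
      exact hf.1 _
  cases o
  · exact (key (by simpa [Consecutive] using h) hy hx).symm
  · exact key (by simpa [Consecutive] using h) hx hy

/-- The two smoothings of the crossing of a monogon: one of them gives as many curves as going
straight on, the other one splits off a circle.  The side of the monogon is `0 1`, the outer ends
continuing `0` and `1` are `2` and `3`. -/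
theorem monogon_linked {α : Type} [Finite α] {r : α → α → Prop} {e : Fin 4 → α}
    (he : Function.Injective e) (h01 : IsSegment r (e 0) (e 1)) :
    linked r e (Smoothing.link .oriented 0 2 1 3) = linked r e (Smoothing.link .straight 0 2 1 3) ∧
    linked r e (Smoothing.link .disoriented 0 2 1 3) =
      linked r e (Smoothing.link .straight 0 2 1 3) + 1 := by
  have hcongr : ∀ {l l' : List (Fin 4 × Fin 4)}, (∀ (γ : Type) (f : Fin 4 → γ), f 0 = f 1 →
      ((∀ p ∈ l, f p.1 = f p.2) ↔ ∀ p ∈ l', f p.1 = f p.2)) →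
      linked r e l = linked r e l' := by
    intro l l' h
    refine linked_congr [(0, 1)] ?_ ?_
    · simpa using h01
    · simpa using h
  constructor
  · exact hcongr fun γ f hu => by simp [Smoothing.link]; grind
  · have h1 := linked_cons (i := 0) (i' := 1) (j := 2) (l := [(2, 3)]) he h01
      (by decide) (by decide)
    have h2 : linked r e (Smoothing.link .straight 0 2 1 3) = linked r e [(0, 2), (2, 3)] :=
      hcongr fun γ f hu => by simp [Smoothing.link]; grind
    have h3 : linked r e (Smoothing.link .disoriented 0 2 1 3) = linked r e [(2, 3)] :=
      hcongr fun γ f hu => by simp [Smoothing.link]; grind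
    omega

/-- The factor `-q³`, `-q⁻³` or `1` contributed by a monogon. -/
def kinkValue : CrossingKind → ℤ[T;T⁻¹]
  | .positive => -q 3
  | .negative => -q (-3)
  | .virtual => 1

theorem update_straight {S : Finset D.C} {t : D.C → Smoothing} (ht : t ∈ D.straightOn S) {x : D.C}
    (hx : x ∈ S) : Function.update t x .straight = t := by
  rw [← (Finset.mem_filter.1 ht).2 x hx, Function.update_eq_self]

theorem stateSum_eq_of_monogon {x : D.C} (h : D.Monogon x) :
    D.stateSum = kinkValue (D.kind x) * (D.remove {x}).stateSum := by
  obtain ⟨b, h⟩ := h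
  rw [stateSum_remove, stateSum, sum_straightOn (Finset.notMem_empty x), Finset.mul_sum,
    insert_empty_eq]
  refine Finset.sum_congr rfl fun t ht => ?_
  rw [mul_left_comm]
  congr 1
  let e : Fin 4 → D.P × Bool := ![(D.strand (x, b), true), (D.strand (x, !b), false),
    (D.strand (x, b), false), (D.strand (x, !b), true)]
  have he : Function.Injective e := by
    intro i j hij
    fin_cases i <;> fin_cases j <;> simp [e] at hij ⊢
  have h01 : IsSegment (D.joins {x} t) (e 0) (e 1) :=
    isSegment_joins (o := true) (by simpa [Consecutive] using h) (by simp) (by simp)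
  have hc : ∀ s : Smoothing, classes (D.joins ∅ (Function.update t x s)) =
      linked (D.joins {x} t) e (Smoothing.link (s.twist false) 0 2 1 3) := by
    intro s
    refine classes_congr fun γ f => ?_
    rw [respects_joins_update (Finset.notMem_empty x), respects_glue, Smoothing.map_link,
      pairs_iff_link b true false]
    rfl
  obtain ⟨h1, h2⟩ := monogon_linked he h01
  have h3 : classes (D.joins ∅ t) =
      linked (D.joins {x} t) e (Smoothing.link .straight 0 2 1 3) := by
    have := hc .straight
    rwa [update_straight ht (by simp)] at this
  simp only [hc]
  refine (sum_coeff_twist _ _ fun s =>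
    circleValue ^ linked (D.joins {x} t) e (Smoothing.link s 0 2 1 3)).trans ?_
  rw [h3]
  have hδ : circleValue = -q (-2) - q 2 := rfl
  have e1 : q 1 * q (-2) = q (-1) := q_mul_q _ _
  have e2 : q 1 * q 2 = q 3 := q_mul_q _ _
  have e3 : q (-1) * q (-2) = q (-3) := q_mul_q _ _
  have e4 : q (-1) * q 2 = q 1 := q_mul_q _ _
  cases D.kind x <;> simp only [Smoothing.sum_univ, CrossingKind.twist, CrossingKind.switch,
    CrossingKind.coeff, zero_mul, zero_add, add_zero, one_mul, h1, h2, pow_succ, kinkValue,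
    Bool.false_eq_true, if_false] <;>
    generalize circleValue ^ linked (D.joins {x} t) e (Smoothing.link .straight 0 2 1 3) = A
  · rw [hδ]
    linear_combination -A * e1 - A * e2
  · rw [hδ]
    linear_combination -A * e3 - A * e4

theorem stateSum_eq_of_bigon {x y : D.C} (h : D.Bigon x y)
    (hk : D.kind y = (D.kind x).switch) : D.stateSum = (D.remove {x, y}).stateSum := by
  obtain ⟨hxy, b, o, h, h'⟩ := h
  have hx : x ∉ ({y} : Finset D.C) := by simpa using hxy
  rw [stateSum_remove, stateSum, sum_straightOn (Finset.notMem_empty y), insert_empty_eq,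
    sum_straightOn hx]
  refine Finset.sum_congr rfl fun t ht => congrArg _ ?_
  let e : Fin 8 → D.P × Bool := ![(D.strand (x, b), true), (D.strand (y, !b), false),
    (D.strand (x, !b), o), (D.strand (y, b), !o), (D.strand (x, b), false),
    (D.strand (y, !b), true), (D.strand (x, !b), !o), (D.strand (y, b), o)]
  have he : Function.Injective e := by
    have hyx := hxy.symm
    intro i j hij
    fin_cases i <;> fin_cases j <;> simp [e, hxy, hyx] at hij ⊢
  have h01 : IsSegment (D.joins {x, y} t) (e 0) (e 1) :=
    isSegment_joins (o := true) (by simpa [Consecutive] using h) (by simp) (by simp)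
  have h23 : IsSegment (D.joins {x, y} t) (e 2) (e 3) :=
    isSegment_joins h' (by simp) (by simp)
  have hc : ∀ s s' : Smoothing,
      classes (D.joins ∅ (Function.update (Function.update t x s) y s')) =
      linked (D.joins {x, y} t) e (Smoothing.link (s.twist (true == o)) 0 4 2 6 ++
        Smoothing.link (s'.twist (true == o)) 1 5 3 7) := by
    intro s s'
    refine classes_congr fun γ f => ?_
    rw [respects_joins_update (Finset.notMem_empty y), insert_empty_eq, respects_joins_update hx,
      respects_glue, List.map_append, Smoothing.map_link, Smoothing.map_link,
      pairs_iff_link b true o, pairs_iff_link (!b) false (!o), and_assoc, List.forall_mem_append,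
      show (false == !o) = (true == o) by cases o <;> rfl]
    simp only [Bool.not_not, Bool.not_false]
    rfl
  have h3 : classes (D.joins ∅ t) = linked (D.joins {x, y} t) e
      (Smoothing.link .straight 0 4 2 6 ++ Smoothing.link .straight 1 5 3 7) := by
    have := hc .straight .straight
    rw [update_straight ht (by simp), update_straight ht (by simp)] at this
    rw [this]
    cases o <;> rfl
  simp only [hc]
  refine (sum_sum_coeff_twist _ _ _ _ fun s s' => circleValue ^ linked (D.joins {x, y} t) e
    (Smoothing.link s 0 4 2 6 ++ Smoothing.link s' 1 5 3 7)).trans ?_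
  rw [h3, ← bigon_linked he h01 h23 (κ := (D.kind x).twist (true == o)), hk,
    show ((D.kind x).twist (true == o)).switch = (D.kind x).switch.twist (true == o) by
      cases D.kind x <;> cases o <;> rfl]

/-- The ends at the crossings of a triangle, in the order used in `triangleSum`. -/
def triangleEnds {P C : Type} (s : C × Bool → P) (x y z : C) (i j k oX oY oZ : Bool) :
    Fin 12 → P × Bool :=
  ![(s (x, i), !oX), (s (x, i), oX), (s (y, j), !oX), (s (y, j), oX),
    (s (x, !i), !oY), (s (x, !i), oY), (s (z, k), !oY), (s (z, k), oY),
    (s (y, !j), !oZ), (s (y, !j), oZ), (s (z, !k), !oZ), (s (z, !k), oZ)]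

/-- Expanding the state sum at the crossings of a triangle. -/
theorem stateSum_eq_sum_triangleSum {x y z : D.C} (hxy : x ≠ y) (hxz : x ≠ z) (hyz : y ≠ z)
    (i j k oX oY oZ : Bool) :
    D.stateSum = ∑ t ∈ D.straightOn {x, y, z}, D.coeffOff {x, y, z} t *
      triangleSum (D.joins {x, y, z} t) (triangleEnds D.strand x y z i j k oX oY oZ)
        ((D.kind x).twist (oX == oY)) ((D.kind y).twist ((!oX) == oZ))
        ((D.kind z).twist ((!oY) == (!oZ))) := by
  have hy : y ∉ ({z} : Finset D.C) := by simpa using hyz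
  have hx : x ∉ ({y, z} : Finset D.C) := by simp [hxy, hxz]
  rw [stateSum, sum_straightOn (Finset.notMem_empty z), insert_empty_eq, sum_straightOn hy,
    sum_straightOn hx]
  refine Finset.sum_congr rfl fun t _ => congrArg _ ?_
  set e := triangleEnds D.strand x y z i j k oX oY oZ with he
  have hc : ∀ s s' s'' : Smoothing,
      classes (D.joins ∅ (Function.update (Function.update (Function.update t x s) y s') z s'')) =
      linked (D.joins {x, y, z} t) e (Smoothing.link (s.twist (oX == oY)) 1 0 5 4 ++
        Smoothing.link (s'.twist ((!oX) == oZ)) 2 3 9 8 ++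
        Smoothing.link (s''.twist ((!oY) == (!oZ))) 6 7 10 11) := by
    intro s s' s''
    refine classes_congr fun γ f => ?_
    rw [respects_joins_update (Finset.notMem_empty z), insert_empty_eq, respects_joins_update hy,
      respects_joins_update hx, respects_glue, List.map_append, List.map_append,
      Smoothing.map_link, Smoothing.map_link, Smoothing.map_link,
      pairs_iff_link i oX oY, pairs_iff_link j (!oX) oZ, pairs_iff_link k (!oY) (!oZ), and_assoc,
      and_assoc, List.forall_mem_append, List.forall_mem_append, and_assoc]
    simp only [Bool.not_not]
    rfl
  simp only [hc]
  exact sum_sum_sum_coeff_twist _ _ _ _ _ _ fun s s' s'' =>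
    circleValue ^ linked (D.joins {x, y, z} t) e
    (Smoothing.link s 1 0 5 4 ++ Smoothing.link s' 2 3 9 8 ++ Smoothing.link s'' 6 7 10 11)

theorem triangleEnds_injective {x y z : D.C} (hxy : x ≠ y) (hxz : x ≠ z) (hyz : y ≠ z)
    (i j k oX oY oZ : Bool) :
    Function.Injective (triangleEnds D.strand x y z i j k oX oY oZ) := by
  have hyx := hxy.symm
  have hzx := hxz.symm
  have hzy := hyz.symm
  intro a b hab
  fin_cases a <;> fin_cases b <;> simp [triangleEnds, *] at hab ⊢

/-- Rearranging the preimages of the crossings in `S` does not change the strands elsewhere. -/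
theorem joins_rearrange {τ : Equiv.Perm D.P} {σ : Equiv.Perm (D.C × Bool)}
    (hσ : ∀ w, τ (D.strand w) = D.strand (σ w)) {S : Finset D.C}
    (hS : ∀ x ∉ S, ∀ b, σ (x, b) = (x, b)) (t : D.C → Smoothing) :
    (D.rearrange τ).joins S t = D.joins S t := by
  funext h k
  have h1 : (∀ x b, h.1 ≠ τ (D.strand (x, b))) ↔ ∀ x b, h.1 ≠ D.strand (x, b) := by
    simp only [hσ]
    constructor
    · intro hh x b
      have := hh (σ.symm (x, b)).1 (σ.symm (x, b)).2
      simpa using this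
    · exact fun hh x b => hh (σ (x, b)).1 (σ (x, b)).2
  have h2 : ∀ x ∉ S, (D.rearrange τ).ends x = D.ends x := by
    intro x hx
    have : ∀ b, (D.rearrange τ).strand (x, b) = D.strand (x, b) := fun b =>
      (hσ _).trans (congrArg _ (hS x hx b))
    funext i
    fin_cases i
    exacts [congrArg (·, true) (this false), congrArg (·, true) (this true),
      congrArg (·, false) (this false), congrArg (·, false) (this true)]
  refine propext (or_congr Iff.rfl (or_congr (and_congr_left' h1)
    (exists_congr fun x => and_congr_right fun hx => ?_)))
  exact iff_of_eq (congrArg (fun e => (h, k) ∈ (t x).pairs e) (h2 x hx))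

/-- Third moves leave the state sum unchanged: after the rearrangement the same ends belong to the
triangle, with the two crossings on each strand exchanged. -/
theorem stateSum_rearrange {x y z : D.C} {i j k oX oY oZ : Bool}
    (h : D.Triangle x y z i j k oX oY oZ) (hk : D.Slidable x y z i j k) :
    (D.rearrange (Equiv.swap (D.strand (x, i)) (D.strand (y, j)) *
      Equiv.swap (D.strand (x, !i)) (D.strand (z, k)) *
      Equiv.swap (D.strand (y, !j)) (D.strand (z, !k)))).stateSum = D.stateSum := by
  obtain ⟨hxy, hxz, hyz, hX, hY, hZ, hside, hturn⟩ := h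
  set τ : Equiv.Perm D.P := Equiv.swap (D.strand (x, i)) (D.strand (y, j)) *
      Equiv.swap (D.strand (x, !i)) (D.strand (z, k)) *
      Equiv.swap (D.strand (y, !j)) (D.strand (z, !k)) with hτ
  let σ : Equiv.Perm (D.C × Bool) := Equiv.swap (x, i) (y, j) *
      Equiv.swap (x, !i) (z, k) * Equiv.swap (y, !j) (z, !k)
  have hσ : ∀ w, τ (D.strand w) = D.strand (σ w) := fun w => by
    simp [hτ, σ, D.strand.injective.swap_apply]
  have hS : ∀ w ∉ ({x, y, z} : Finset D.C), ∀ b, σ (w, b) = (w, b) := by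
    intro w hw b
    simp only [Finset.mem_insert, Finset.mem_singleton, not_or] at hw
    simp [σ, Equiv.swap_apply_def, hw]
  have hyx := hxy.symm
  have hzx := hxz.symm
  have hzy := hyz.symm
  have hends : triangleEnds (fun w => τ (D.strand w)) x y z i j k (!oX) (!oY) (!oZ) =
      triangleEnds D.strand x y z i j k oX oY oZ ∘ flipTriangle := by
    have h1 : σ (x, i) = (y, j) := by simp [σ, Equiv.swap_apply_def, *]
    have h2 : σ (y, j) = (x, i) := by simp [σ, Equiv.swap_apply_def, *]
    have h3 : σ (x, !i) = (z, k) := by simp [σ, Equiv.swap_apply_def, *]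
    have h4 : σ (z, k) = (x, !i) := by simp [σ, Equiv.swap_apply_def, *]
    have h5 : σ (y, !j) = (z, !k) := by simp [σ, Equiv.swap_apply_def, *]
    have h6 : σ (z, !k) = (y, !j) := by simp [σ, Equiv.swap_apply_def, *]
    funext a
    fin_cases a <;> simp [triangleEnds, flipTriangle, hσ, h1, h2, h3, h4, h5, h6]
  have h1 := stateSum_eq_sum_triangleSum (D := D) hxy hxz hyz i j k oX oY oZ
  have h2 := stateSum_eq_sum_triangleSum (D := D.rearrange τ) hxy hxz hyz i j k (!oX) (!oY) (!oZ)
  rw [h1]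
  refine h2.trans (Finset.sum_congr rfl fun t _ => congrArg _ ?_)
  have h3 : triangleSum (D.joins {x, y, z} t)
      (triangleEnds (fun w => τ (D.strand w)) x y z i j k (!oX) (!oY) (!oZ))
        ((D.kind x).twist (oX == oY)) ((D.kind y).twist ((!oX) == oZ))
        ((D.kind z).twist ((!oY) == (!oZ))) = triangleSum (D.joins {x, y, z} t)
      (triangleEnds D.strand x y z i j k oX oY oZ)
        ((D.kind x).twist (oX == oY)) ((D.kind y).twist ((!oX) == oZ))
        ((D.kind z).twist ((!oY) == (!oZ))) := by
    have hs1 : IsSegment (D.joins {x, y, z} t) (D.strand (x, i), oX) (D.strand (y, j), !oX) :=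
      isSegment_joins hX (by simp) (by simp)
    have hs2 : IsSegment (D.joins {x, y, z} t) (D.strand (x, !i), oY) (D.strand (z, k), !oY) :=
      isSegment_joins hY (by simp) (by simp)
    have hs3 : IsSegment (D.joins {x, y, z} t) (D.strand (y, !j), oZ) (D.strand (z, !k), !oZ) :=
      isSegment_joins hZ (by simp) (by simp)
    rw [hends]
    refine triangleSum_flip (triangleEnds_injective hxy hxz hyz i j k oX oY oZ) hs1 hs2 hs3 ?_
    rcases hk with ⟨h1, h2, h3⟩ | ⟨h1, h2⟩ | ⟨h1, h2⟩ | ⟨h1, h2⟩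
    · left
      rw [h1, h2, h3]
      clear * - hside hturn
      revert i j k oX oY oZ
      decide
    · right; left
      rw [h1, h2]
      cases oX <;> cases oY <;> cases oZ <;> exact ⟨rfl, rfl⟩
    · right; right; left
      rw [h1, h2]
      cases oX <;> cases oY <;> cases oZ <;> exact ⟨rfl, rfl⟩
    · right; right; right
      rw [h1, h2]
      cases oX <;> cases oY <;> cases oZ <;> exact ⟨rfl, rfl⟩
  have hr : (D.rearrange τ).joins ({x, y, z} : Finset D.C) t = D.joins {x, y, z} t :=
    joins_rearrange hσ hS t
  have hb : ∀ b b' : Bool, ((!b) == (!b')) = (b == b') := by decide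
  have e1 := hb oX oY
  have e2 := hb (!oX) oZ
  have e3 := hb (!oY) (!oZ)
  rw [← h3, ← e1, ← e2, ← e3]
  exact congrArg (fun r => triangleSum r _ _ _ _) hr

end DiagramData

/-! ### Invariance of the Jones-Kauffman polynomial -/

/-- The contribution of a crossing to the writhe. -/
def CrossingKind.sign : CrossingKind → ℤ
  | .positive => 1
  | .negative => -1
  | .virtual => 0

namespace DiagramData

variable {D : DiagramData}

theorem stateSum_congr {D D' : DiagramData} (e : D.C ≃ D'.C) (hk : ∀ x, D.kind x = D'.kind (e x))
    (hc : ∀ t : D'.C → Smoothing, classes (D.joins ∅ (t ∘ e)) = classes (D'.joins ∅ t)) :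
    D.stateSum = D'.stateSum := by
  have h : ∀ D : DiagramData, D.stateSum = ∑ t : D.C → Smoothing,
      (∏ x, (D.kind x).coeff (t x)) * circleValue ^ classes (D.joins ∅ t) := by
    intro D
    simp [stateSum, straightOn, coeffOff]
  rw [h, h]
  symm
  refine Fintype.sum_equiv (e.symm.arrowCongr (Equiv.refl _)) _ _ fun t => ?_
  have ht : (e.symm.arrowCongr (Equiv.refl _)) t = t ∘ e := rfl
  rw [ht, hc, ← Equiv.prod_comp e]
  simp [hk]

theorem stateSum_iso {D D' : DiagramData} (e : Iso D D') : D.stateSum = D'.stateSum := by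
  refine stateSum_congr e.onC e.kind fun t => ?_
  have hends : ∀ x k, Prod.map e.onP id (D.ends x k) = D'.ends (e.onC x) k := by
    intro x k
    fin_cases k <;> simp [ends, e.strand]
  have hpairs : ∀ (a : Smoothing) (x : D.C), a.pairs (D'.ends (e.onC x)) =
      (a.pairs (D.ends x)).map (Prod.map (Prod.map e.onP id) (Prod.map e.onP id)) := by
    intro a x
    cases a <;> simp [Smoothing.pairs, hends]
  have hiff : ∀ (γ : Type) (f : D'.P × Bool → γ), Respects (D'.joins ∅ t) f ↔
      Respects (D.joins ∅ (t ∘ e.onC)) (f ∘ Prod.map e.onP id) := by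
    intro γ f
    rw [respects_joins, respects_joins]
    simp only [← e.onP.forall_congr_right (q := fun p => f (p, true) = f (D'.next p, false)),
      ← e.onP.forall_congr_right (q := fun p => (∀ x b, p ≠ D'.strand (x, b)) →
        f (p, true) = f (p, false)),
      ← e.onC.forall_congr_right (q := fun x => ∀ b, e.onP _ ≠ D'.strand (x, b)),
      ← e.onC.forall_congr_right (q := fun x => x ∉ (∅ : Finset D'.C) →
        ∀ p ∈ (t x).pairs (D'.ends x), f p.1 = f p.2), hpairs, List.forall_mem_map,
      ← e.next, ← e.strand, ne_eq, EmbeddingLike.apply_eq_iff_eq]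
    simp
  refine classes_eq_of_maps (Prod.map e.onP id) (Prod.map e.onP.symm id) ?_ ?_ ?_ ?_
  · exact (hiff _ _).1 (respects_mk _)
  · rw [hiff]
    simpa [Function.comp_assoc, Prod.map_comp_map] using respects_mk (D.joins ∅ (t ∘ e.onC))
  · simp
  · simp

theorem respects_joins_addBend {p : D.P} {t : D.C → Smoothing} {γ : Type}
    {f : Option D.P × Bool → γ} :
    Respects ((D.addBend p).joins (∅ : Finset D.C) t) f ↔
      (∀ p' : Option D.P, f (p', true) =
        f (Equiv.optionCongr D.next (Equiv.swap (some p) none p'), false)) ∧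
      (∀ p' : Option D.P, (∀ x b, p' ≠ some (D.strand (x, b))) → f (p', true) = f (p', false)) ∧
      ∀ x, ∀ e ∈ (t x).pairs (D.ends x), f (some e.1.1, e.1.2) = f (some e.2.1, e.2.2) := by
  refine (respects_joins (D := D.addBend p) (γ := γ)).trans ?_
  have hends : ∀ x : D.C, (D.addBend p).ends x =
      fun k => (some (D.ends x k).1, (D.ends x k).2) := by
    intro x
    funext k
    fin_cases k <;> rfl
  have hpairs : ∀ x : D.C, (∀ e ∈ (t x).pairs ((D.addBend p).ends x), f e.1 = f e.2) ↔
      ∀ e ∈ (t x).pairs (D.ends x), f (some e.1.1, e.1.2) = f (some e.2.1, e.2.2) := by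
    intro x
    rw [hends]
    cases t x <;> simp [Smoothing.pairs]
  exact and_congr Iff.rfl (and_congr Iff.rfl (forall_congr' (α := D.C) fun x =>
    Iff.trans ⟨fun h => h (Finset.notMem_empty (α := D.C) x), fun h _ => h⟩ (hpairs x)))

/-- A new bend does not change the circles: both of its ends belong to the circle through `p`. -/
theorem stateSum_addBend (p : D.P) : (D.addBend p).stateSum = D.stateSum := by
  refine (stateSum_congr (D := D) (D' := D.addBend p) (Equiv.refl D.C) (fun _ => rfl)
    fun t => ?_).symm
  let g : Option D.P × Bool → D.P × Bool := fun h => h.1.elim (p, true) fun p' => (p', h.2)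
  have hnone := fun (γ : Type) (f : Option D.P × Bool → γ)
      (hf : Respects ((D.addBend p).joins (∅ : Finset D.C) t) f) =>
    (respects_joins_addBend.1 hf).2.1 none (by simp)
  have hnext := fun (γ : Type) (f : Option D.P × Bool → γ)
      (hf : Respects ((D.addBend p).joins (∅ : Finset D.C) t) f) =>
    (respects_joins_addBend.1 hf).1
  refine classes_eq_of_maps (α := D.P × Bool) (β := Option D.P × Bool)
    (fun h => (some h.1, h.2)) g ?_ ?_ ?_ ?_
  · have hmk := respects_mk ((D.addBend p).joins (∅ : Finset D.C) t)
    obtain ⟨h1, h2, h3⟩ := respects_joins_addBend.1 hmk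
    refine respects_joins.2 ⟨fun p' => ?_, fun p' hp' => ?_, fun x _ e he => h3 x e he⟩
    · by_cases hp : p' = p
      · subst hp
        have e1 := h1 (some p')
        have e2 := h1 none
        have e3 := h2 none (by simp)
        simp only [Equiv.swap_apply_left, Equiv.swap_apply_right, Equiv.optionCongr_apply,
          Option.map_none, Option.map_some] at e1 e2
        exact e1.trans (e3.symm.trans e2)
      · have e1 := h1 (some p')
        rw [Equiv.swap_apply_of_ne_of_ne (by simpa using hp) (by simp)] at e1
        exact e1
    · exact h2 (some p') fun x b hx => hp' x b (Option.some_injective _ hx)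
  · have hmk := respects_mk (D.joins ∅ t)
    obtain ⟨h1, h2, h3⟩ := respects_joins.1 hmk
    refine respects_joins_addBend.2 ⟨?_, ?_, fun x e he => h3 x (by simp) e he⟩
    · rintro (_ | p')
      · rw [Equiv.swap_apply_right]
        exact h1 p
      · by_cases hp : p' = p
        · subst hp
          rw [Equiv.swap_apply_left]
          rfl
        · rw [Equiv.swap_apply_of_ne_of_ne (by simpa using hp) (by simp)]
          exact h1 p'
    · rintro (_ | p') hp'
      · rfl
      · exact h2 p' fun x b hx => hp' x b (congrArg some hx)
  · intro h
    rfl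
  · have hmk := respects_mk ((D.addBend p).joins (∅ : Finset D.C) t)
    have e1 := (respects_joins_addBend.1 hmk).1 (some p)
    have e3 := (respects_joins_addBend.1 hmk).2.1 none (by simp)
    rw [Equiv.swap_apply_left] at e1
    rintro ⟨_ | p', b⟩
    · cases b
      exacts [e1, e1.trans e3.symm]
    · rfl

theorem writhe_eq_sum (D : DiagramData) : D.writhe = ∑ x, (D.kind x).sign := by
  have h : ∀ x, (D.kind x).sign =
      (if D.kind x = .positive then 1 else 0) - (if D.kind x = .negative then 1 else 0) := by
    intro x
    cases D.kind x <;> simp [CrossingKind.sign]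
  rw [writhe, Finset.sum_congr rfl fun x _ => h x, Finset.sum_sub_distrib, Finset.sum_boole,
    Finset.sum_boole, Nat.card_eq_fintype_card, Nat.card_eq_fintype_card, Fintype.card_subtype,
    Fintype.card_subtype]

theorem writhe_remove (S : Finset D.C) :
    (D.remove S).writhe + ∑ x ∈ S, (D.kind x).sign = D.writhe := by
  rw [writhe_eq_sum D, ← Finset.sum_compl_add_sum S]
  congr 1
  exact (writhe_eq_sum _).trans
    (Finset.sum_subtype Sᶜ (fun x => Finset.mem_compl) fun x => (D.kind x).sign).symm

/-- The state sum, normalized to be invariant under the first move. -/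
def invariant (D : DiagramData) : ℤ[T;T⁻¹] :=
  ((Diagram.negQ ^ (-3 * D.writhe) : (ℤ[T;T⁻¹])ˣ) : ℤ[T;T⁻¹]) * D.stateSum

theorem negQ_zpow_mul_kinkValue (κ : CrossingKind) :
    ((Diagram.negQ ^ (-3 * κ.sign) : (ℤ[T;T⁻¹])ˣ) : ℤ[T;T⁻¹]) * kinkValue κ = 1 := by
  have h3 : ((Diagram.negQ ^ (3 : ℕ) : (ℤ[T;T⁻¹])ˣ) : ℤ[T;T⁻¹]) = -q 3 := by
    rw [Units.val_pow_eq_pow_val]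
    change (-q 1) ^ 3 = -q 3
    rw [show (3 : ℤ) = 1 + 1 + 1 by rfl, ← q_mul_q, ← q_mul_q]
    ring
  have hq : q 3 * q (-3) = 1 := (q_mul_q _ _).trans q_zero
  cases κ
  · change ((Diagram.negQ ^ (-3 : ℤ) : (ℤ[T;T⁻¹])ˣ) : ℤ[T;T⁻¹]) * -q 3 = 1
    rw [← h3, ← Units.val_mul, ← zpow_natCast, ← zpow_add]
    simp
  · change ((Diagram.negQ ^ (3 : ℕ) : (ℤ[T;T⁻¹])ˣ) : ℤ[T;T⁻¹]) * -q (-3) = 1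
    rw [h3, neg_mul_neg, hq]
  · simp [CrossingKind.sign, kinkValue]

theorem invariant_eq_of_step {D D' : DiagramData} (h : Step D D') : D.invariant = D'.invariant := by
  have hw : ∀ {D D' : DiagramData}, D.writhe = D'.writhe → D.stateSum = D'.stateSum →
      D.invariant = D'.invariant := by
    intro D D' h1 h2
    rw [invariant, invariant, h1, h2]
  cases h with
  | iso e =>
    refine hw ?_ (stateSum_iso e)
    rw [writhe_eq_sum, writhe_eq_sum, ← Equiv.sum_comp e.onC]
    simp [e.kind]
  | bend p => exact hw rfl (stateSum_addBend p).symm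
  | first x h =>
    have h1 := writhe_remove (D := D) {x}
    rw [Finset.sum_singleton] at h1
    rw [invariant, invariant, stateSum_eq_of_monogon h, ← h1, mul_add, zpow_add, Units.val_mul,
      mul_assoc, ← mul_assoc _ (kinkValue _), negQ_zpow_mul_kinkValue, one_mul]
  | second x y h hk =>
    refine hw ?_ (stateSum_eq_of_bigon h hk)
    rw [← writhe_remove {x, y}, Finset.sum_pair h.1, hk]
    cases D.kind x <;> simp [CrossingKind.sign, CrossingKind.switch]
  | third x y z i j k oX oY oZ h hk => exact hw rfl (stateSum_rearrange h hk).symm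

end DiagramData

theorem Diagram.circleValue_mul_jonesKauffman (D : Diagram) :
    circleValue * D.jonesKauffman = D.toDiagramData.invariant := by
  have := D.nonempty
  rw [Diagram.jonesKauffman, DiagramData.invariant, DiagramData.stateSum_eq_bracket, mul_left_comm]

/-- The Jones-Kauffman polynomial of a diagram only depends on the link. -/
theorem Diagram.jonesKauffman_eq {L : Link} {D D' : Diagram} (h : D.IsDiagramOf L)
    (h' : D'.IsDiagramOf L) : D.jonesKauffman = D'.jonesKauffman := by
  have hR : Relation.EqvGen
      (fun D D' : Diagram => DiagramData.Step D.toDiagramData D'.toDiagramData) D D' :=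
    Quotient.exact (s := Diagram.setoid) (h.trans h'.symm)
  refine mul_left_cancel₀ circleValue_ne_zero ?_
  rw [circleValue_mul_jonesKauffman, circleValue_mul_jonesKauffman]
  clear h h'
  induction hR with
  | rel _ _ h => exact DiagramData.invariant_eq_of_step h
  | refl => rfl
  | symm _ _ _ ih => exact ih.symm
  | trans _ _ _ _ _ ih ih' => exact ih.trans ih'

/-! ### Cycles of a permutation composed with a transposition -/

/-- The relation whose classes are the cycles of a permutation. -/
def permRel {E : Type} (σ : Equiv.Perm E) (x y : E) : Prop := y = σ x

theorem respects_permRel {E γ : Type} {σ : Equiv.Perm E} {f : E → γ} :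
    Respects (permRel σ) f ↔ ∀ x, f (σ x) = f x :=
  ⟨fun h x => (h x _ rfl).symm, fun h x y hxy => by rw [hxy, h]⟩

theorem mk_permRel_eq_iff {E : Type} {σ : Equiv.Perm E} {x y : E} :
    Quot.mk (permRel σ) x = Quot.mk (permRel σ) y ↔ σ.SameCycle x y := by
  constructor
  · intro h
    have hf : Respects (permRel σ) (Quotient.mk (Equiv.Perm.SameCycle.setoid σ)) :=
      respects_permRel.2 fun x => Quotient.sound (Equiv.Perm.sameCycle_apply_left.2 (.refl σ x))
    exact Quotient.exact (congrArg (Quot.lift _ hf) h)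
  · rintro ⟨i, rfl⟩
    have h1 : ∀ x, Quot.mk (permRel σ) (σ x) = Quot.mk (permRel σ) x :=
      respects_permRel.1 (respects_mk _)
    have h2 : ∀ (n : ℕ) x, Quot.mk (permRel σ) ((σ ^ n) x) = Quot.mk (permRel σ) x := by
      intro n
      induction n with
      | zero => simp
      | succ n ih => intro x; rw [pow_succ', Equiv.Perm.mul_apply, h1, ih]
    cases i with
    | ofNat n => exact (h2 n x).symm
    | negSucc n =>
      have := h2 (n + 1) ((σ ^ Int.negSucc n) x)
      rw [← this, zpow_negSucc, ← Equiv.Perm.mul_apply, mul_inv_cancel, Equiv.Perm.one_apply]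

section swap

variable {E : Type} [Finite E] [DecidableEq E] {σ : Equiv.Perm E} {a b : E}

/-- Composing with the transposition of elements of two different cycles joins these cycles. -/
theorem eq_of_swap_mul_invariant {β γ : Type} {g : E → β} (hg : ∀ x, g (σ x) = g x)
    (hab : g a ≠ g b) {f : E → γ} (hf : ∀ x, f ((Equiv.swap a b * σ) x) = f x) : f a = f b := by
  classical
  have := Fintype.ofFinite E
  by_contra hne
  -- On the set where `g` has the value `g b`, the function `f ∘ σ` differs from `f` only at `σ⁻¹
  -- b`, whereas `f` and `f ∘ σ` take the value `f b` equally often there.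
  let S : Finset E := Finset.univ.filter fun x => g x = g b ∧ f x = f b
  have hS : ∀ x, g x = g b → (f (σ x) = f b ↔ x = σ.symm b ∨ f x = f b) := by
    intro x hx
    by_cases h1 : σ x = b
    · have : x = σ.symm b := by rw [← h1, Equiv.symm_apply_apply]
      simp [this]
    · have h2 : σ x ≠ a := fun h => hab (by rw [← h, hg, hx])
      have h3 := hf x
      rw [Equiv.Perm.mul_apply, Equiv.swap_apply_of_ne_of_ne h2 h1] at h3
      have : x ≠ σ.symm b := fun h => h1 (by rw [h, Equiv.apply_symm_apply])
      simp [this, h3]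
  have hb : σ.symm b ∉ S := by
    intro h
    have h3 := hf (σ.symm b)
    rw [Equiv.Perm.mul_apply, Equiv.apply_symm_apply, Equiv.swap_apply_right] at h3
    exact hne (h3.trans (Finset.mem_filter.1 h).2.2)
  have hgb : g (σ.symm b) = g b := by rw [← hg, Equiv.apply_symm_apply]
  have h1 : S.map σ.symm.toEmbedding = insert (σ.symm b) S := by
    ext x
    simp only [Finset.mem_map_equiv, Equiv.symm_symm, S, Finset.mem_filter, Finset.mem_univ,
      true_and, Finset.mem_insert, hg]
    constructor
    · rintro ⟨h, h'⟩
      exact ((hS x h).1 h').imp_right fun h2 => ⟨h, h2⟩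
    · rintro (rfl | ⟨h, h'⟩)
      · exact ⟨hgb, (hS _ hgb).2 (.inl rfl)⟩
      · exact ⟨h, (hS x h).2 (.inr h')⟩
  have h2 := congrArg Finset.card h1
  rw [Finset.card_map, Finset.card_insert_of_notMem hb] at h2
  omega

/-- Composing with the transposition of two elements of a cycle separates them. -/
theorem not_sameCycle_swap_mul (hab : a ≠ b) (h : σ.SameCycle a b) :
    ¬ (Equiv.swap a b * σ).SameCycle a b := by
  classical
  have hex : ∃ n : ℕ, (σ ^ n) a = b := h.exists_nat_pow_eq
  let m := Nat.find hex
  have hm : (σ ^ m) a = b := Nat.find_spec hex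
  have hmin : ∀ i < m, (σ ^ i) a ≠ b := fun i hi => Nat.find_min hex hi
  have hm0 : 0 < m := Nat.pos_of_ne_zero fun h0 => hab (by rw [← hm, h0]; rfl)
  have ha : ∀ i, 0 < i → i < m → (σ ^ i) a ≠ a := by
    intro i hi him h'
    refine hmin (m - i) (by omega) ?_
    rw [← hm]
    conv_rhs => rw [← Nat.sub_add_cancel him.le, pow_add, Equiv.Perm.mul_apply, h']
  have key : ∀ n : ℕ, ∃ i < m, ((Equiv.swap a b * σ) ^ n) a = (σ ^ i) a := by
    intro n
    induction n with
    | zero => exact ⟨0, hm0, rfl⟩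
    | succ n ih =>
      obtain ⟨i, hi, hin⟩ := ih
      have hs : σ ((σ ^ i) a) = (σ ^ (i + 1)) a := by rw [pow_succ', Equiv.Perm.mul_apply]
      rw [pow_succ', Equiv.Perm.mul_apply, hin, Equiv.Perm.mul_apply, hs]
      rcases Nat.lt_or_ge (i + 1) m with h1 | h1
      · exact ⟨i + 1, h1, Equiv.swap_apply_of_ne_of_ne (ha _ (by omega) h1) (hmin _ h1)⟩
      · have h2 : i + 1 = m := by omega
        exact ⟨0, hm0, by rw [h2, hm, Equiv.swap_apply_right]; rfl⟩
  intro h'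
  obtain ⟨n, hn⟩ := h'.exists_nat_pow_eq
  obtain ⟨i, hi, hin⟩ := key n
  exact hmin i hi (hin.symm.trans hn)

end swap

/-! ### The expansion over Euler circuits -/

/-- A family of permutations of the directed edges of a graph, indexed by the smoothings of its
vertices.  The edges `out v` and `out' v` are the ones starting at the vertex `v`; changing the
smoothing of `v` exchanges them. -/
structure SmoothingSystem (E V : Type) [DecidableEq E] [DecidableEq V] where
  perm : (V → Bool) → Equiv.Perm E
  out : V → E
  out' : V → E
  out_ne : ∀ v, out v ≠ out' v
  perm_flip : ∀ s v, perm (Function.update s v (!s v)) = Equiv.swap (out v) (out' v) * perm s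
  perm_eq_or : ∀ s t x, perm s x = perm t x ∨ ∃ v, s v ≠ t v ∧
    (perm s x = out v ∧ perm t x = out' v ∨ perm s x = out' v ∧ perm t x = out v)

namespace SmoothingSystem

variable {E V : Type} [DecidableEq E] [DecidableEq V] (S : SmoothingSystem E V)

/-- Edges which are consecutive after smoothing the vertices outside `A`. -/
def rel (A : Finset V) (s : V → Bool) (x y : E) : Prop :=
  y = S.perm s x ∨ ∃ v ∈ A, x = S.out v ∧ y = S.out' v

/-- The edges starting at `v` belong to the same component of the graph obtained by smoothing the
vertices outside `A`. -/
def Joined (A : Finset V) (s : V → Bool) (v : V) : Prop :=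
  Quot.mk (S.rel A s) (S.out v) = Quot.mk (S.rel A s) (S.out' v)

/-- The other smoothing at the vertex `v`. -/
def flip (s : V → Bool) (v : V) : V → Bool := Function.update s v (!s v)

theorem flip_flip (s : V → Bool) (v : V) : flip (flip s v) v = s := by
  simp [flip]

theorem flip_self (s : V → Bool) (v : V) : flip s v v = !s v := by simp [flip]

theorem flip_of_ne (s : V → Bool) {u v : V} (h : u ≠ v) : flip s v u = s u := by simp [flip, h]

variable {S}

theorem respects_rel {A : Finset V} {s : V → Bool} {γ : Type} {f : E → γ} :
    Respects (S.rel A s) f ↔ (∀ x, f (S.perm s x) = f x) ∧ ∀ v ∈ A, f (S.out v) = f (S.out' v) := by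
  constructor
  · exact fun h => ⟨fun x => (h x _ (.inl rfl)).symm, fun v hv => h _ _ (.inr ⟨v, hv, rfl, rfl⟩)⟩
  · rintro ⟨h1, h2⟩ x y (rfl | ⟨v, hv, rfl, rfl⟩)
    exacts [(h1 x).symm, h2 v hv]

theorem Joined.eq {A : Finset V} {s : V → Bool} {v : V} (h : S.Joined A s v) {γ : Type}
    {f : E → γ} (hf : Respects (S.rel A s) f) : f (S.out v) = f (S.out' v) :=
  congrArg (Quot.lift f hf) h

theorem respects_rel_iff_of_agree {A : Finset V} {s t : V → Bool} (h : ∀ v ∉ A, t v = s v)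
    {γ : Type} {f : E → γ} : Respects (S.rel A t) f ↔ Respects (S.rel A s) f := by
  have key : ∀ s t : V → Bool, (∀ v ∉ A, t v = s v) → Respects (S.rel A t) f →
      Respects (S.rel A s) f := by
    intro s t h hf
    obtain ⟨h1, h2⟩ := respects_rel.1 hf
    refine respects_rel.2 ⟨fun x => ?_, h2⟩
    rw [← h1 x]
    rcases S.perm_eq_or s t x with h3 | ⟨v, hv, h3⟩
    · rw [h3]
    · have hvA : v ∈ A := by
        by_contra hvA
        exact hv (h v hvA).symm
      rcases h3 with ⟨h3, h4⟩ | ⟨h3, h4⟩ <;> rw [h3, h4, h2 v hvA]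
  exact ⟨key s t h, key t s fun v hv => (h v hv).symm⟩

theorem joined_iff_of_agree {A : Finset V} {s t : V → Bool} (h : ∀ v ∉ A, t v = s v) {v : V} :
    S.Joined A t v ↔ S.Joined A s v :=
  ⟨fun hj => hj.eq ((respects_rel_iff_of_agree h).2 (respects_mk _)),
    fun hj => hj.eq ((respects_rel_iff_of_agree h).1 (respects_mk _))⟩

theorem joined_empty_iff {s : V → Bool} {v : V} :
    S.Joined ∅ s v ↔ (S.perm s).SameCycle (S.out v) (S.out' v) := by
  rw [← mk_permRel_eq_iff]
  have h : S.rel ∅ s = permRel (S.perm s) := by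
    funext x y
    simp [rel, permRel]
  rw [Joined, h]

theorem Joined.mono {s : V → Bool} {A : Finset V} {v : V} (h : S.Joined ∅ s v) :
    S.Joined A s v :=
  h.eq (respects_rel.2 ⟨(respects_rel.1 (respects_mk _)).1, by simp⟩)

/-- If smoothing `v` one way disconnects the two edges at `v`, then the other smoothing does not. -/
theorem joined_flip [Finite E] {A : Finset V} {s : V → Bool} {v : V} (h : ¬ S.Joined A s v) :
    S.Joined A (flip s v) v := by
  have hf := (respects_rel.1 (respects_mk (S.rel A (flip s v)))).1
  rw [flip, S.perm_flip] at hf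
  exact eq_of_swap_mul_invariant (respects_rel.1 (respects_mk (S.rel A s))).1 h hf

theorem classes_insert {A : Finset V} {s : V → Bool} {v : V} :
    classes (S.rel (insert v A) s) = classes (glue (S.rel A s) [(S.out v, S.out' v)]) := by
  refine classes_congr fun γ f => ?_
  rw [respects_glue, respects_rel, respects_rel, Finset.forall_mem_insert]
  simp only [List.mem_singleton, forall_eq]
  tauto

theorem classes_insert_of_joined {A : Finset V} {s : V → Bool} {v : V}
    (h : S.Joined A s v) : classes (S.rel A s) = classes (S.rel (insert v A) s) := by
  rw [classes_insert, classes_glue_of_eq h]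

theorem classes_insert_of_not_joined [Finite E] {A : Finset V} {s : V → Bool} {v : V}
    (h : ¬ S.Joined A s v) : classes (S.rel A s) = classes (S.rel (insert v A) s) + 1 := by
  rw [classes_insert, classes_glue_of_ne h]

theorem classes_insert_flip {A : Finset V} {s : V → Bool} {v : V} :
    classes (S.rel (insert v A) (flip s v)) = classes (S.rel (insert v A) s) :=
  classes_congr fun γ f => respects_rel_iff_of_agree fun u hu =>
    flip_of_ne s (by rintro rfl; simp at hu)

theorem classes_flip [Finite E] {A : Finset V} {s : V → Bool} {v : V} (h : ¬ S.Joined A s v) :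
    classes (S.rel A s) = classes (S.rel A (flip s v)) + 1 := by
  rw [classes_insert_of_not_joined h, classes_insert_of_joined (joined_flip h),
    classes_insert_flip]

variable (S) in
/-- The smoothing `s` connects the edges of each component of the graph with vertex set `A` to one
circuit. -/
def IsEuler (A : Finset V) (s : V → Bool) : Prop := ∀ v ∈ A, S.Joined ∅ s v

variable (S) in
/-- The vertex `v` is live with respect to the Euler circuits given by `s`, only the vertices in `A`
being taken into account: changing the smoothing of `v` splits a circuit into two, and no vertex
with a smaller label is visited by both of them. -/
def Live (label : V → ℕ) (A : Finset V) (s : V → Bool) (v : V) : Prop :=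
  ∀ u ∈ A, label u < label v → S.Joined ∅ (flip s v) u

theorem isEuler_insert_iff {A : Finset V} {s : V → Bool} {v : V} :
    S.IsEuler (insert v A) s ↔ S.IsEuler A s ∧ S.Joined A s v := by
  rw [IsEuler, Finset.forall_mem_insert, and_comm]
  refine and_congr_right fun h => ⟨Joined.mono, fun hj => hj.eq (respects_rel.2 ⟨?_, ?_⟩)⟩
  · exact (respects_rel.1 (respects_mk _)).1
  · exact h

/-- If all vertices in `A` have smaller labels than `v`, then `v` is live precisely if changing the
smoothing of `v` disconnects the graph in which only the vertices in `A` are not smoothed. -/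
theorem live_iff_not_joined [Finite E] {label : V → ℕ} {A : Finset V} {s : V → Bool} {v : V}
    (hv : ∀ u ∈ A, label u < label v) (hs : S.IsEuler (insert v A) s) :
    S.Live label (insert v A) s v ↔ ¬ S.Joined A (flip s v) v := by
  have hsv : ¬ S.Joined ∅ (flip s v) v := by
    rw [joined_empty_iff, flip, S.perm_flip]
    exact not_sameCycle_swap_mul (S.out_ne v)
      (joined_empty_iff.1 (hs v (Finset.mem_insert_self v A)))
  constructor
  · intro h hj
    refine hsv (hj.eq (respects_rel.2 ⟨(respects_rel.1 (respects_mk _)).1, fun u hu => ?_⟩))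
    exact h u (Finset.mem_insert_of_mem hu) (hv u hu)
  · intro h u hu huv
    have huA : u ∈ A := by
      rcases Finset.mem_insert.1 hu with rfl | h
      exacts [absurd huv (lt_irrefl _), h]
    by_contra hju
    classical
    -- Merging the two circuits through `v` gives a function which is constant on the circuits of
    -- `s`.  So the two edges at `u` belong to one of the two circuits each.
    let κ : E → Quot (S.rel ∅ (flip s v)) := Quot.mk _
    let φ : E → Quot (S.rel ∅ (flip s v)) := fun x =>
      if κ x = κ (S.out' v) then κ (S.out v) else κ x
    have hκ : ∀ x, κ (Equiv.swap (S.out v) (S.out' v) (S.perm s x)) = κ x := by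
      have := (respects_rel.1 (respects_mk (S.rel ∅ (flip s v)))).1
      rw [flip, S.perm_flip] at this
      exact this
    have hφ : ∀ x, φ (S.perm s x) = φ x := by
      intro x
      have h1 := hκ x
      by_cases h2 : S.perm s x = S.out v
      · rw [h2, Equiv.swap_apply_left] at h1
        simp only [φ, h2, ← h1]
        split_ifs <;> rfl
      · by_cases h3 : S.perm s x = S.out' v
        · rw [h3, Equiv.swap_apply_right] at h1
          simp only [φ, h3, ← h1]
          split_ifs <;> rfl
        · rw [Equiv.swap_apply_of_ne_of_ne h2 h3] at h1
          simp only [φ, h1]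
    have hφu : φ (S.out u) = φ (S.out' u) :=
      (hs u hu).eq (respects_rel.2 ⟨hφ, by simp⟩)
    have hR := respects_rel.1 (respects_mk (S.rel A (flip s v)))
    have hlift : Respects (S.rel ∅ (flip s v)) (Quot.mk (S.rel A (flip s v))) :=
      respects_rel.2 ⟨hR.1, by simp⟩
    have hl : ∀ x y, κ x = κ y →
        Quot.mk (S.rel A (flip s v)) x = Quot.mk (S.rel A (flip s v)) y :=
      fun x y hxy => congrArg (Quot.lift _ hlift) hxy
    have hu2 := hR.2 u huA
    change ¬ κ (S.out u) = κ (S.out' u) at hju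
    refine h ?_
    change Quot.mk (S.rel A (flip s v)) _ = Quot.mk _ _
    simp only [φ] at hφu
    split_ifs at hφu with h1 h2 h2
    · exact absurd (h1.trans h2.symm) hju
    · rw [hl _ _ hφu, ← hl _ _ h1, hu2]
    · rw [← hl _ _ h2, ← hu2, hl _ _ hφu]
    · exact absurd hφu hju

/-! ### Summation over all smoothings -/

/-- The smoothings which agree with `s` outside `A`. -/
def agreeing [Fintype V] (A : Finset V) (s : V → Bool) : Finset (V → Bool) :=
  Finset.univ.filter fun t => ∀ v ∉ A, t v = s v

theorem mem_agreeing [Fintype V] {A : Finset V} {s t : V → Bool} :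
    t ∈ agreeing A s ↔ ∀ v ∉ A, t v = s v := by
  simp [agreeing]

theorem flip_mem_agreeing [Fintype V] {A : Finset V} {s t : V → Bool} (v : V)
    (h : t ∈ agreeing A s) : flip t v ∈ agreeing A (flip s v) := by
  rw [mem_agreeing] at h ⊢
  intro u hu
  by_cases huv : u = v
  · subst huv
    rw [flip_self, flip_self, h u hu]
  · rw [flip_of_ne _ huv, flip_of_ne _ huv, h u hu]

/-- A sum over the smoothings of `insert v A` is the sum of the contributions of both smoothings of
`v`. -/
theorem sum_agreeing_insert [Fintype V] {A : Finset V} {v : V} (hv : v ∉ A) (s : V → Bool)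
    {R : Type} [AddCommMonoid R] (F : (V → Bool) → R) :
    ∑ t ∈ agreeing (insert v A) s, F t =
      ∑ t ∈ agreeing A s, F t + ∑ t ∈ agreeing A (flip s v), F t := by
  rw [← Finset.sum_union]
  · refine Finset.sum_congr ?_ fun _ _ => rfl
    ext t
    simp only [Finset.mem_union, mem_agreeing, Finset.mem_insert, not_or]
    constructor
    · intro h
      by_cases htv : t v = s v
      · left
        intro u hu
        by_cases huv : u = v
        · rw [huv, htv]
        · exact h u ⟨huv, hu⟩
      · right
        intro u hu
        by_cases huv : u = v
        · subst huv
          rw [flip_self]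
          exact Bool.eq_not_of_ne htv
        · rw [flip_of_ne _ huv]
          exact h u ⟨huv, hu⟩
    · rintro (h | h) u ⟨huv, hu⟩
      · exact h u hu
      · rw [h u hu, flip_of_ne _ huv]
  · rw [Finset.disjoint_left]
    intro t h h'
    have h1 := mem_agreeing.1 h v hv
    have h2 := mem_agreeing.1 h' v hv
    rw [h1, flip_self] at h2
    simp at h2

section expansion

variable [Fintype V] {R : Type} [CommRing R] {δ : R} {w : V → Bool → R} {label : V → ℕ}

variable (S) in
/-- The sum over all smoothings of the vertices in `A`. -/
def smoothingSum (δ : R) (w : V → Bool → R) (A : Finset V) (s : V → Bool) : R :=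
  ∑ t ∈ agreeing A s, (∏ v ∈ A, w v (t v)) * δ ^ classes (S.rel ∅ t)

open scoped Classical in
variable (S) in
/-- The weight of a vertex of an Euler circuit. -/
def activity (w : V → Bool → R) (label : V → ℕ) (A : Finset V) (s : V → Bool) (v : V) : R :=
  if S.Live label A s v then -w v (!s v) ^ 3 else w v (s v)

open scoped Classical in
variable (S) in
/-- The sum over the smoothings of the vertices in `A` which give Euler circuits. -/
def eulerSum (w : V → Bool → R) (label : V → ℕ) (A : Finset V) (s : V → Bool) : R :=
  ∑ t ∈ (agreeing A s).filter fun t => S.IsEuler A t, ∏ v ∈ A, S.activity w label A t v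

theorem smoothingSum_insert {A : Finset V} {v : V} (hv : v ∉ A) (s : V → Bool) :
    S.smoothingSum δ w (insert v A) s = w v (s v) * S.smoothingSum δ w A s +
      w v (!s v) * S.smoothingSum δ w A (flip s v) := by
  rw [smoothingSum, sum_agreeing_insert hv, smoothingSum, smoothingSum, Finset.mul_sum,
    Finset.mul_sum]
  congr 1 <;> refine Finset.sum_congr rfl fun t ht => ?_
  · rw [Finset.prod_insert hv, mem_agreeing.1 ht v hv, mul_assoc]
  · rw [Finset.prod_insert hv, mem_agreeing.1 ht v hv, flip_self, mul_assoc]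

/-- If smoothing `v` according to `s` disconnects the graph, then each circuit on both sides of `v`
is one circuit for the other smoothing of `v`. -/
theorem smoothingSum_of_not_joined [Finite E] {A : Finset V} {v : V} (hv : v ∉ A) {s : V → Bool}
    (h : ¬ S.Joined A s v) :
    S.smoothingSum δ w A s = δ * S.smoothingSum δ w A (flip s v) := by
  rw [smoothingSum, smoothingSum, Finset.mul_sum]
  refine Finset.sum_nbij' (fun t => flip t v) (fun t => flip t v)
    (fun t ht => flip_mem_agreeing v ht) (fun t ht => ?_) (fun t _ => flip_flip t v)
    (fun t _ => flip_flip t v) fun t ht => ?_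
  · have := flip_mem_agreeing v ht
    rwa [flip_flip] at this
  · have hj : ¬ S.Joined ∅ t v := fun hj =>
      h ((joined_iff_of_agree (mem_agreeing.1 ht)).1 hj.mono)
    rw [classes_flip hj, pow_succ, Finset.prod_congr rfl fun u hu => by
      rw [← flip_of_ne t (show u ≠ v by rintro rfl; exact hv hu)]]
    ring

open scoped Classical in
/-- The contributions of the two smoothings of the vertex `v` with the largest label to the sum over
Euler circuits: only a smoothing which does not disconnect the graph extends to Euler circuits, and
`v` is live in these iff the other smoothing disconnects the graph. -/
theorem eulerSum_insert [Finite E] {A : Finset V} {v : V} (hv : v ∉ A)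
    (hl : ∀ u ∈ A, label u < label v) (s : V → Bool) :
    S.eulerSum w label (insert v A) s =
      (if S.Joined A s v then
        (if S.Joined A (flip s v) v then w v (s v) else -w v (!s v) ^ 3) * S.eulerSum w label A s
        else 0) +
      (if S.Joined A (flip s v) v then
        (if S.Joined A s v then w v (!s v) else -w v (s v) ^ 3) * S.eulerSum w label A (flip s v)
        else 0) := by
  have key : ∀ s, ∑ t ∈ agreeing A s, (if S.IsEuler (insert v A) t then
      ∏ u ∈ insert v A, S.activity w label (insert v A) t u else 0) =
      if S.Joined A s v then
        (if S.Joined A (flip s v) v then w v (s v) else -w v (!s v) ^ 3) * S.eulerSum w label A s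
        else 0 := by
    intro s
    split_ifs with h1 h2
    all_goals
      try rw [eulerSum, Finset.sum_filter, Finset.mul_sum]
      try refine Finset.sum_congr rfl fun t ht => ?_
    rotate_right
    · refine Finset.sum_eq_zero fun t ht => if_neg fun ht' => h1 ?_
      exact (joined_iff_of_agree (mem_agreeing.1 ht)).1 (isEuler_insert_iff.1 ht').2
    all_goals
      have hE : S.IsEuler (insert v A) t ↔ S.IsEuler A t := by
        rw [isEuler_insert_iff, and_iff_left]
        exact (joined_iff_of_agree (mem_agreeing.1 ht)).2 h1
      by_cases ht' : S.IsEuler A t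
      · rw [if_pos ht', if_pos (hE.2 ht'), Finset.prod_insert hv]
        congr 1
        · have h3 := live_iff_not_joined hl (hE.2 ht')
          rw [joined_iff_of_agree (mem_agreeing.1 (flip_mem_agreeing v ht))] at h3
          have h4 := mem_agreeing.1 ht v hv
          simp [activity, h3, h2, h4]
        · refine Finset.prod_congr rfl fun u hu => ?_
          have h3 : S.Live label (insert v A) t u ↔ S.Live label A t u := by
            rw [Live, Finset.forall_mem_insert, Live, and_iff_right_iff_imp]
            exact fun _ h => absurd h (hl u hu).not_gt
          simp only [activity, h3]
      · rw [if_neg ht', if_neg (hE.not.2 ht'), mul_zero]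
  rw [eulerSum, Finset.sum_filter, sum_agreeing_insert hv, key, key, flip_flip, flip_self,
    Bool.not_not]

/-- The expansion over Euler circuits: the sum over all smoothings is a sum over those smoothings
which connect each component of the graph to one circuit. -/
theorem smoothingSum_eq [Finite E] (hw : ∀ v b, w v b * w v (!b) = 1)
    (hδ : ∀ v b, δ = -w v b ^ 2 - w v (!b) ^ 2) (hlabel : Function.Injective label)
    (A : Finset V) (s : V → Bool) :
    S.smoothingSum δ w A s = δ ^ classes (S.rel A s) * S.eulerSum w label A s := by
  classical
  induction A using Finset.induction_on_max_value label generalizing s with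
  | empty =>
    have h : agreeing ∅ s = {s} := by
      ext t
      simp [mem_agreeing, funext_iff]
    simp [smoothingSum, eulerSum, h, IsEuler, Finset.filter_singleton]
  | insert v A hv hl ih =>
    have hl' : ∀ u ∈ A, label u < label v := fun u hu =>
      lt_of_le_of_ne (hl u hu) fun h => hv (hlabel h ▸ hu)
    rw [smoothingSum_insert hv, eulerSum_insert hv hl']
    by_cases h1 : S.Joined A s v
    · rw [ih s, classes_insert_of_joined h1, if_pos h1, if_pos h1]
      by_cases h2 : S.Joined A (flip s v) v
      · rw [if_pos h2, if_pos h2, ih (flip s v), classes_insert_of_joined h2, classes_insert_flip]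
        ring
      -- Only `flip s v` disconnects the graph, so `w (s v) + δ w (!s v) = -w (!s v)³` is the
      -- coefficient of a live vertex.
      · rw [if_neg h2, if_neg h2, smoothingSum_of_not_joined hv h2, flip_flip, ih s,
          classes_insert_of_joined h1]
        have h3 := hw v (s v)
        rw [hδ v (s v)]
        linear_combination (-(w v (s v)) * (-w v (s v) ^ 2 - w v (!s v) ^ 2) ^
          classes (S.rel (insert v A) s) * S.eulerSum w label A s) * h3
    · have h2 := joined_flip h1
      rw [if_neg h1, if_neg h1, if_pos h2, smoothingSum_of_not_joined hv h1,
        ih (flip s v), classes_insert_of_joined h2, classes_insert_flip]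
      have h3 := hw v (s v)
      rw [hδ v (s v)]
      linear_combination (-(w v (!s v)) * (-w v (s v) ^ 2 - w v (!s v) ^ 2) ^
        classes (S.rel (insert v A) s) * S.eulerSum w label A (flip s v)) * h3

end expansion

end SmoothingSystem

/-! ### Smoothings of a checkerboard-colored graph -/

namespace VirtualGraph

variable {G : VirtualGraph} (c : G.Coloring)

/-- The directed segments of the source-target structure. -/
abbrev Arc : Type := {h : G.Half // c.left h = true}

/-- The end along which one leaves after arriving along `h`, if the colored regions get joined at
the vertices `v` with `t v = true`, and the uncolored ones at the other vertices. -/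
def turn (t : G.Vertex → Bool) : G.Half → G.Half :=
  Function.extend (fun x : G.Vertex × Fin 4 => G.port x.1 x.2)
    (fun x => G.port x.1 (if c.left (G.port x.1 x.2) = t x.1 then x.2 + 3 else x.2 + 1)) G.opp

variable {c}

theorem port_vertex_injective :
    Function.Injective fun x : G.Vertex × Fin 4 => G.port x.1 x.2 := by
  rintro ⟨v, k⟩ ⟨v', k'⟩ h
  have h1 := G.port_injective (a₁ := (v.1, k)) (a₂ := (v'.1, k')) h
  rw [Prod.mk.injEq] at h1
  exact Prod.ext (Subtype.ext h1.1) h1.2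

theorem port_eq_iff {v v' : G.Vertex} {k k' : Fin 4} :
    G.port v k = G.port v' k' ↔ v = v' ∧ k = k' := by
  constructor
  · intro h
    have := port_vertex_injective (a₁ := (v, k)) (a₂ := (v', k')) h
    rwa [Prod.mk.injEq] at this
  · rintro ⟨rfl, rfl⟩
    rfl

theorem turn_port (t : G.Vertex → Bool) (v : G.Vertex) (k : Fin 4) :
    turn c t (G.port v k) =
      G.port v (if c.left (G.port v k) = t v then k + 3 else k + 1) :=
  port_vertex_injective.extend_apply _ _ (v, k)

theorem turn_of_forall_ne (t : G.Vertex → Bool) {h : G.Half}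
    (hh : ∀ (v : G.Vertex) (k : Fin 4), h ≠ G.port v k) : turn c t h = G.opp h :=
  Function.extend_apply' _ _ _ fun ⟨x, hx⟩ => hh x.1 x.2 hx.symm

theorem opp_ne_port {h : G.Half} (hh : ∀ (v : G.Vertex) (k : Fin 4), h ≠ G.port v k)
    (v : G.Vertex) (k : Fin 4) : G.opp h ≠ G.port v k := fun h1 =>
  hh v (k + 2) (by rw [← G.opp_port, ← h1, G.opp_opp])

theorem exists_port_or (h : G.Half) :
    (∃ (v : G.Vertex) (k : Fin 4), h = G.port v k) ∨
      ∀ (v : G.Vertex) (k : Fin 4), h ≠ G.port v k := by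
  by_cases hh : ∃ (v : G.Vertex) (k : Fin 4), h = G.port v k
  · exact .inl hh
  · push Not at hh
    exact .inr hh

theorem left_port_add_two (v : G.Vertex) (k : Fin 4) :
    c.left (G.port v (k + 2)) = c.left (G.port v k) := by
  rw [show k + 2 = k + 1 + 1 by rw [add_assoc]; rfl, c.left_vertex, c.left_vertex, Bool.not_not]

theorem left_port_add_three (v : G.Vertex) (k : Fin 4) :
    c.left (G.port v (k + 3)) = !c.left (G.port v k) := by
  rw [show k + 3 = k + 2 + 1 by rw [add_assoc]; rfl, c.left_vertex, left_port_add_two]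

theorem left_turn (t : G.Vertex → Bool) (h : G.Half) : c.left (turn c t h) = !c.left h := by
  rcases exists_port_or h with ⟨v, k, rfl⟩ | hh
  · rw [turn_port]
    split_ifs
    exacts [left_port_add_three v k, c.left_vertex v k]
  · rw [turn_of_forall_ne t hh, c.left_through h hh]

theorem turn_turn (t : G.Vertex → Bool) (h : G.Half) : turn c t (turn c t h) = h := by
  rcases exists_port_or h with ⟨v, k, rfl⟩ | hh
  · have h1 := left_turn (c := c) t (G.port v k)
    rw [turn_port] at h1 ⊢
    rw [turn_port, h1]
    congr 1
    cases c.left (G.port v k) <;> cases t v <;> simp [add_assoc]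
  · rw [turn_of_forall_ne t hh, turn_of_forall_ne t (opp_ne_port hh), G.opp_opp]

/-- Different smoothings of a vertex connect each end to different ends. -/
theorem turn_port_ne {s t : G.Vertex → Bool} {v : G.Vertex} (h : s v ≠ t v) (k : Fin 4) :
    turn c s (G.port v k) = G.opp (turn c t (G.port v k)) := by
  rw [turn_port, turn_port, G.opp_port]
  congr 1
  revert h
  cases c.left (G.port v k) <;> cases s v <;> cases t v <;> simp [add_assoc]

variable (c) in
/-- The permutation of the directed segments given by a smoothing. -/
def arcPerm (t : G.Vertex → Bool) : Equiv.Perm (Arc c) where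
  toFun e := ⟨turn c t (G.seg e.1), by rw [left_turn, c.left_seg, e.2]; rfl⟩
  invFun e := ⟨G.seg (turn c t e.1), by rw [c.left_seg, left_turn, e.2]; rfl⟩
  left_inv e := by
    apply Subtype.ext
    simp only [turn_turn, G.seg_seg]
  right_inv e := by
    apply Subtype.ext
    simp only [turn_turn, G.seg_seg]

theorem arcPerm_apply (t : G.Vertex → Bool) (e : Arc c) :
    (arcPerm c t e).1 = turn c t (G.seg e.1) := rfl

variable (c) in
/-- An end at `v` along which the source-target structure leaves `v`; the other one is opposite. -/
def outPort (v : G.Vertex) : Fin 4 := if c.left (G.port v 0) = true then 0 else 1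

theorem left_outPort (v : G.Vertex) : c.left (G.port v (outPort c v)) = true := by
  rw [outPort]
  split_ifs with h
  · exact h
  · have := c.left_vertex v 0
    rw [zero_add] at this
    rw [this]
    simpa using h

theorem eq_outPort_or {v : G.Vertex} {k : Fin 4} (h : c.left (G.port v k) = true) :
    k = outPort c v ∨ k = outPort c v + 2 := by
  have h1 := c.left_vertex v 0
  have h2 := c.left_vertex v 1
  have h3 := c.left_vertex v 2
  rw [outPort]
  simp only [zero_add, show (1 : Fin 4) + 1 = 2 from rfl, show (2 : Fin 4) + 1 = 3 from rfl]
    at h1 h2 h3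
  fin_cases k <;> simp_all

variable (c) in
/-- The smoothings of a checkerboard-colored graph which respect the source-target structure. -/
def smoothingSystem : SmoothingSystem (Arc c) G.Vertex where
  perm := arcPerm c
  out v := ⟨G.port v (outPort c v), left_outPort v⟩
  out' v := ⟨G.port v (outPort c v + 2), by rw [left_port_add_two, left_outPort]⟩
  out_ne v h := by
    have h1 := (port_eq_iff.1 (congrArg Subtype.val h)).2
    revert h1
    generalize outPort c v = k
    decide +revert
  perm_eq_or s t e := by
    rcases exists_port_or (G.seg e.1) with ⟨v, k, hk⟩ | hh
    · by_cases hst : s v = t v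
      · left
        apply Subtype.ext
        rw [arcPerm_apply, arcPerm_apply, hk, turn_port, turn_port, hst]
      · refine .inr ⟨v, hst, ?_⟩
        have h1 : (arcPerm c s e).1 = G.opp (arcPerm c t e).1 := by
          rw [arcPerm_apply, arcPerm_apply, hk]
          exact turn_port_ne hst k
        have h2 : ∃ k, (arcPerm c t e).1 = G.port v k := by
          rw [arcPerm_apply, hk, turn_port]
          exact ⟨_, rfl⟩
        obtain ⟨k', hk'⟩ := h2
        have h3 := (arcPerm c t e).2
        rw [hk', G.opp_port] at h1
        rw [hk'] at h3
        rcases eq_outPort_or h3 with rfl | rfl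
        · exact .inr ⟨Subtype.ext h1, Subtype.ext hk'⟩
        · refine .inl ⟨Subtype.ext (h1.trans ?_), Subtype.ext hk'⟩
          rw [add_assoc]
          simp
    · left
      apply Subtype.ext
      rw [arcPerm_apply, arcPerm_apply, turn_of_forall_ne _ hh, turn_of_forall_ne _ hh]
  perm_flip s v := by
    ext e
    set t := Function.update s v (!s v) with ht
    have htv : t v ≠ s v := by simp [ht]
    rw [Equiv.Perm.mul_apply]
    have key : ∀ k, (arcPerm c s e).1 = G.port v k → (arcPerm c t e).1 = G.port v (k + 2) := by
      intro k hk
      have h1 : G.seg e.1 = turn c s (G.port v k) := by rw [← hk, arcPerm_apply, turn_turn]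
      rw [turn_port] at h1
      rw [arcPerm_apply, h1, turn_port_ne htv, ← h1, ← arcPerm_apply, hk, G.opp_port]
    by_cases h1 : arcPerm c s e = ⟨G.port v (outPort c v), left_outPort v⟩
    · rw [h1, Equiv.swap_apply_left]
      exact key _ (congrArg Subtype.val h1)
    · by_cases h2 : arcPerm c s e = ⟨G.port v (outPort c v + 2), by
          rw [left_port_add_two, left_outPort]⟩
      · rw [h2, Equiv.swap_apply_right]
        rw [key _ (congrArg Subtype.val h2), add_assoc]
        simp
      · rw [Equiv.swap_apply_of_ne_of_ne h1 h2, arcPerm_apply, arcPerm_apply]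
        rcases exists_port_or (G.seg e.1) with ⟨u, k, hk⟩ | hh
        · have huv : u ≠ v := by
            rintro rfl
            have h3 := (arcPerm c s e).2
            have h4 : ∃ k', (arcPerm c s e).1 = G.port u k' := by
              rw [arcPerm_apply, hk, turn_port]
              exact ⟨_, rfl⟩
            obtain ⟨k', hk'⟩ := h4
            rw [hk'] at h3
            rcases eq_outPort_or h3 with rfl | rfl
            exacts [h1 (Subtype.ext hk'), h2 (Subtype.ext hk')]
          rw [hk, turn_port, turn_port, ht, Function.update_of_ne huv]
        · rw [turn_of_forall_ne _ hh, turn_of_forall_ne _ hh]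

variable (c) in
/-- The directed segment to which an end belongs. -/
def toArc (h : G.Half) : Arc c :=
  if hh : c.left h = true then ⟨h, hh⟩ else ⟨G.seg h, by rw [c.left_seg]; simpa using hh⟩

theorem toArc_coe (e : Arc c) : toArc c e.1 = e := dif_pos e.2

theorem toArc_seg (h : G.Half) : toArc c (G.seg h) = toArc c h := by
  cases hh : c.left h
  · have h1 : c.left (G.seg h) = true := by rw [c.left_seg, hh]; rfl
    simp [toArc, hh, h1]
  · have h1 : c.left (G.seg h) = false := by rw [c.left_seg, hh]; rfl
    simp [toArc, hh, h1, G.seg_seg]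

/-- Passing from relations between the ends to relations between the directed segments. -/
theorem classes_eq_classes_arc {r : G.Half → G.Half → Prop} {r' : Arc c → Arc c → Prop}
    (hseg : ∀ {γ : Type} {f : G.Half → γ}, Respects r f → ∀ h, f (G.seg h) = f h)
    (hr : ∀ {γ : Type} {f : G.Half → γ}, (∀ h, f (G.seg h) = f h) →
      (Respects r f ↔ Respects r' fun e => f e.1)) :
    classes r = classes r' := by
  refine classes_eq_of_maps (toArc c) Subtype.val ?_ ?_ ?_ ?_
  · refine (hr fun h => by simp [toArc_seg]).2 ?_
    simpa [toArc_coe] using respects_mk r'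
  · exact (hr (hseg (respects_mk r))).1 (respects_mk r)
  · intro h
    simp only [toArc]
    split_ifs
    exacts [rfl, hseg (respects_mk r) h]
  · exact fun e => congrArg _ (toArc_coe e)

theorem forall_arc_iff {γ : Type} {f : G.Half → γ} (hf : ∀ h, f (G.seg h) = f h)
    (t : G.Vertex → Bool) :
    (∀ e : Arc c, f (arcPerm c t e).1 = f e.1) ↔ ∀ h, f (turn c t h) = f h := by
  constructor
  · intro h1
    have key : ∀ h, c.left h = false → f (turn c t h) = f h := by
      intro h hh
      have := h1 ⟨G.seg h, by rw [c.left_seg, hh]; rfl⟩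
      rw [arcPerm_apply, G.seg_seg] at this
      rw [this, hf]
    intro h
    cases hh : c.left h
    · exact key h hh
    · have := key (turn c t h) (by rw [left_turn, hh]; rfl)
      rw [turn_turn] at this
      exact this.symm
  · intro h1 e
    rw [arcPerm_apply, h1, hf]

variable (G) in
/-- The relation which defines the components of the graph. -/
def compRel (h k : G.Half) : Prop :=
  k = G.seg h ∨ k = G.opp h ∨ ∃ (v : G.Vertex) (i j : Fin 4), h = G.port v i ∧ k = G.port v j

/-- A function on the ends which is constant on segments is constant on the components of the graph
iff it is invariant under the permutation given by some smoothing `t` and has the same value on the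
two segments starting at each vertex. -/
theorem respects_compRel {γ : Type} {f : G.Half → γ} (hf : ∀ h, f (G.seg h) = f h)
    (t : G.Vertex → Bool) :
    Respects G.compRel f ↔
      Respects ((smoothingSystem c).rel Finset.univ t) fun e => f e.1 := by
  rw [SmoothingSystem.respects_rel]
  refine Iff.trans ?_ (and_congr (forall_arc_iff (c := c) hf t).symm Iff.rfl)
  constructor
  · intro h
    have hport : ∀ (v : G.Vertex) i j, f (G.port v i) = f (G.port v j) := fun v i j =>
      h _ _ (.inr (.inr ⟨v, i, j, rfl, rfl⟩))
    refine ⟨fun x => ?_, fun v _ => hport v _ _⟩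
    rcases exists_port_or x with ⟨v, k, rfl⟩ | hh
    · rw [turn_port]
      exact hport v _ _
    · rw [turn_of_forall_ne t hh]
      exact (h _ _ (.inr (.inl rfl))).symm
  · rintro ⟨h1, h2⟩
    have hport : ∀ (v : G.Vertex) i, f (G.port v i) = f (G.port v (outPort c v)) := by
      intro v i
      have h3 : ∀ k, c.left (G.port v k) = true → f (G.port v k) = f (G.port v (outPort c v)) := by
        intro k hk
        rcases eq_outPort_or hk with rfl | rfl
        exacts [rfl, (h2 v (Finset.mem_univ v)).symm]
      cases hi : c.left (G.port v i)
      · rw [← h1, turn_port]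
        refine h3 _ ?_
        split_ifs
        · rw [left_port_add_three, hi]; rfl
        · rw [c.left_vertex, hi]; rfl
      · exact h3 i hi
    rintro h k (rfl | rfl | ⟨v, i, j, rfl, rfl⟩)
    · exact (hf h).symm
    · rcases exists_port_or h with ⟨v, k, rfl⟩ | hh
      · rw [G.opp_port, hport, hport v (k + 2)]
      · rw [← turn_of_forall_ne (c := c) t hh, h1]
    · rw [hport, hport v j]

variable (c) in
/-- The components of the graph in terms of directed segments.  The smoothing `t` is irrelevant, as
all vertices connect the segments meeting there. -/
theorem card_component (t : G.Vertex → Bool) :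
    Nat.card G.Component = classes ((smoothingSystem c).rel Finset.univ t) :=
  classes_eq_classes_arc (r := G.compRel) (fun hf h => (hf h _ (.inl rfl)).symm)
    fun hf => respects_compRel hf t

theorem comp_seg (h : G.Half) : G.comp (G.seg h) = G.comp h := (Quot.sound (.inl rfl)).symm

theorem comp_port (v : G.Vertex) (i j : Fin 4) : G.comp (G.port v i) = G.comp (G.port v j) :=
  Quot.sound (.inr (.inr ⟨v, i, j, rfl, rfl⟩))

theorem comp_turn (t : G.Vertex → Bool) (h : G.Half) : G.comp (turn c t h) = G.comp h := by
  rcases exists_port_or h with ⟨v, k, rfl⟩ | hh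
  · rw [turn_port]
    exact comp_port v _ _
  · rw [turn_of_forall_ne t hh]
    exact (Quot.sound (.inr (.inl rfl))).symm

/-- A smoothing is Eulerian if its circuits are the components of the graph. -/
theorem isEuler_iff (t : G.Vertex → Bool) :
    (smoothingSystem c).IsEuler Finset.univ t ↔
      ∀ e e' : Arc c, G.comp e.1 = G.comp e'.1 → (arcPerm c t).SameCycle e e' := by
  constructor
  · intro h e e' hee
    have hκ : Respects G.compRel (Quot.mk (permRel (arcPerm c t)) ∘ toArc c) := by
      refine (respects_compRel (c := c) (fun h => by simp [toArc_seg]) t).2 ?_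
      simp only [Function.comp_apply, toArc_coe]
      refine SmoothingSystem.respects_rel.2 ⟨respects_permRel.1 (respects_mk _), fun v hv => ?_⟩
      exact mk_permRel_eq_iff.2 (SmoothingSystem.joined_empty_iff.1 (h v hv))
    have := congrArg (Quot.lift _ hκ) hee
    simp only [comp, Function.comp_apply, toArc_coe] at this
    exact mk_permRel_eq_iff.1 this
  · intro h v _
    rw [SmoothingSystem.joined_empty_iff]
    exact h _ _ (comp_port v _ _)

end VirtualGraph

namespace UnorientedDiagram

open VirtualGraph

variable (U : UnorientedDiagram) (c : U.toVirtualGraph.Coloring)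

/-- The sign of a crossing of a checkerboard-colored diagram. -/
def signOf (v : U.Vertex) : Bool := c.left (U.port v (U.overPort v))

/-- The smoothing which joins the regions swept by the over strand, in terms of the regions around a
vertex. -/
theorem smoothing_iff_turn {γ : Type} (P : Fin 4 → γ) (L : Fin 4 → Bool)
    (hL : ∀ k, L (k + 1) = !L k) (o : Fin 4) (b : Bool) :
    (∀ i, (i = o ∨ i = o + 2) → ((b == L o) = true → P (i + 1) = P (i + 2)) ∧
      ((b == L o) = false → P i = P (i + 1))) ↔
      ∀ k, P (if L k = b then k + 3 else k + 1) = P k := by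
  have h0 := hL 0
  have h1 := hL 1
  have h2 := hL 2
  simp only [zero_add, show (1 : Fin 4) + 1 = 2 from rfl, show (2 : Fin 4) + 1 = 3 from rfl]
    at h0 h1 h2
  rw [h0] at h1
  rw [h1] at h2
  have a1 : (1 : Fin 4) + 1 = 2 := rfl
  have a2 : (1 : Fin 4) + 2 = 3 := rfl
  have a3 : (1 : Fin 4) + 3 = 0 := rfl
  have a4 : (2 : Fin 4) + 1 = 3 := rfl
  have a5 : (2 : Fin 4) + 2 = 0 := rfl
  have a6 : (2 : Fin 4) + 3 = 1 := rfl
  have a7 : (3 : Fin 4) + 1 = 0 := rfl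
  have a8 : (3 : Fin 4) + 2 = 1 := rfl
  have a9 : (3 : Fin 4) + 3 = 2 := rfl
  have ho : o = 0 ∨ o = 1 ∨ o = 2 ∨ o = 3 := by decide +revert
  have hall : ∀ p : Fin 4 → Prop, (∀ k, p k) ↔ p 0 ∧ p 1 ∧ p 2 ∧ p 3 := fun p => by
    simp [Fin.forall_fin_succ]
  rw [hall fun k => P (if L k = b then k + 3 else k + 1) = P k]
  simp only [forall_eq_or_imp, forall_eq]
  cases h3 : L 0 <;> cases b <;> rcases ho with rfl | rfl | rfl | rfl <;>
    simp [h0, h1, h2, h3, a1, a2, a3, a4, a5, a6, a7, a8, a9] <;> grind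

/-- The circles of a state are the circuits of the corresponding smoothing.  States are given in
terms of the regions swept by the over strand, smoothings in terms of the colored regions, and the
sign of a vertex compares the two. -/
theorem loops_eq (t : U.Vertex → Bool) :
    U.loops (fun v => t v == U.signOf c v) = classes ((smoothingSystem c).rel ∅ t) := by
  refine classes_eq_classes_arc (c := c) (fun hf h => (hf h _ (.inl rfl)).symm) fun {γ f} hf => ?_
  have key : Respects (U.StateRel fun v => t v == U.signOf c v) f ↔
      ∀ h, f (turn c t h) = f h := by
    have hv : ∀ v : U.Vertex, _ := fun v => smoothing_iff_turn (fun k => f (U.port v k))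
      (fun k => c.left (U.port v k)) (c.left_vertex v) (U.overPort v) (t v)
    constructor
    · intro h x
      rcases exists_port_or x with ⟨v, k, rfl⟩ | hh
      · rw [turn_port]
        refine (hv v).1 (fun i hi => ⟨fun hs => ?_, fun hs => ?_⟩) k
        · exact h _ _ (.inr (.inr ⟨v, i, hi, .inl ⟨hs, rfl, rfl⟩⟩))
        · exact h _ _ (.inr (.inr ⟨v, i, hi, .inr ⟨hs, rfl, rfl⟩⟩))
      · rw [turn_of_forall_ne t hh]
        exact (h _ _ (.inr (.inl ⟨hh, rfl⟩))).symm
    · rintro h x y (rfl | ⟨hh, rfl⟩ | ⟨v, i, hi, hxy⟩)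
      · exact (hf x).symm
      · rw [← turn_of_forall_ne (c := c) t hh, h]
      · have h1 := (hv v).2 (fun k => by
          have := h (U.port v k)
          rwa [turn_port] at this) i hi
        rcases hxy with ⟨hs, rfl, rfl⟩ | ⟨hs, rfl, rfl⟩
        exacts [h1.1 hs, h1.2 hs]
  rw [key, ← forall_arc_iff (c := c) hf, SmoothingSystem.respects_rel]
  exact ⟨fun h => ⟨h, by simp⟩, And.left⟩

end UnorientedDiagram

/-! ### Interlacement -/

/-- Two elements of the cycle of `a` stay in the same cycle after composing with the transposition
of `a` and another element of this cycle iff these two elements do not separate them. -/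
theorem sameCycle_swap_mul_iff {E : Type} [Finite E] [DecidableEq E] {σ : Equiv.Perm E} {a : E}
    {m N : ℕ} (hm : 0 < m) (hmN : m < N)
    (hinj : ∀ i < N, ∀ j < N, (σ ^ i) a = (σ ^ j) a → i = j) {i k : ℕ} (hi : i < N) (hk : k < N) :
    (Equiv.swap a ((σ ^ m) a) * σ).SameCycle ((σ ^ i) a) ((σ ^ k) a) ↔ (i < m ↔ k < m) := by
  set b := (σ ^ m) a with hb
  have hab : a ≠ b := fun h => hm.ne (hinj 0 (by omega) m hmN h)
  have hstep : ∀ i, i + 1 < N → i + 1 ≠ m →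
      (Equiv.swap a b * σ).SameCycle ((σ ^ i) a) ((σ ^ (i + 1)) a) := by
    intro i hi him
    have h1 : (σ ^ (i + 1)) a = (Equiv.swap a b * σ) ((σ ^ i) a) := by
      have hs : σ ((σ ^ i) a) = (σ ^ (i + 1)) a := by rw [pow_succ', Equiv.Perm.mul_apply]
      rw [Equiv.Perm.mul_apply, hs, Equiv.swap_apply_of_ne_of_ne]
      · intro h
        have := hinj (i + 1) hi 0 (by omega) h
        omega
      · intro h
        exact him (hinj (i + 1) hi m hmN h)
    rw [h1]
    exact Equiv.Perm.sameCycle_apply_right.2 (.refl _ _)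
  have hlow : ∀ i, i < m → (Equiv.swap a b * σ).SameCycle a ((σ ^ i) a) := by
    intro i
    induction i with
    | zero => exact fun _ => .refl _ _
    | succ i ih => exact fun h => (ih (by omega)).trans (hstep i (by omega) (by omega))
  have hhigh : ∀ i, m + i < N → (Equiv.swap a b * σ).SameCycle b ((σ ^ (m + i)) a) := by
    intro i
    induction i with
    | zero => exact fun _ => .refl _ _
    | succ i ih => exact fun h => (ih (by omega)).trans (hstep (m + i) h (by omega))
  have hhigh' : ∀ i, m ≤ i → i < N → (Equiv.swap a b * σ).SameCycle b ((σ ^ i) a) := by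
    intro i h1 h2
    obtain ⟨d, rfl⟩ := Nat.exists_eq_add_of_le h1
    exact hhigh d h2
  have hn : ¬ (Equiv.swap a b * σ).SameCycle a b :=
    not_sameCycle_swap_mul hab ⟨m, by rw [zpow_natCast]⟩
  rcases Nat.lt_or_ge i m with h1 | h1 <;> rcases Nat.lt_or_ge k m with h2 | h2
  · exact iff_of_true ((hlow i h1).symm.trans (hlow k h2)) (by omega)
  · exact iff_of_false (fun h => hn ((hlow i h1).trans (h.trans (hhigh' k h2 hk).symm))) (by omega)
  · exact iff_of_false (fun h => hn ((hlow k h2).trans (h.symm.trans (hhigh' i h1 hi).symm)))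
      (by omega)
  · exact iff_of_true ((hhigh' i h1 hi).symm.trans (hhigh' k h2 hk)) (by omega)

namespace VirtualGraph

variable {G : VirtualGraph} {c : G.Coloring} {K : G.Component}

/-- A directed segment of a component as a directed segment of the graph. -/
def Edge.arc (e : Edge c K) : Arc c := ⟨e.1, e.2.1⟩

theorem Edge.arc_injective : Function.Injective (Edge.arc : Edge c K → Arc c) := fun _ _ h =>
  Subtype.ext (congrArg (fun a : Arc c => a.1) h)

instance : Finite (Edge c K) :=
  inferInstanceAs (Finite {h : G.Half // c.left h = true ∧ G.comp h = K})

instance : Fintype (Edge c K) := Fintype.ofFinite _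

theorem startsAt_iff {e : Edge c K} {v : G.Vertex} :
    StartsAt e v ↔ e.arc = (smoothingSystem c).out v ∨ e.arc = (smoothingSystem c).out' v := by
  constructor
  · rintro ⟨i, hi⟩
    have h1 := e.2.1
    rw [hi] at h1
    rcases eq_outPort_or h1 with rfl | rfl
    exacts [.inl (Subtype.ext hi), .inr (Subtype.ext hi)]
  · rintro (h | h)
    exacts [⟨_, congrArg Subtype.val h⟩, ⟨_, congrArg Subtype.val h⟩]

/-- The circuit connects the ends at the vertices as described by `t`. -/
def EulerCircuit.IsGivenBy (γ : EulerCircuit c K) (t : G.Vertex → Bool) : Prop :=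
  ∀ e, (γ.next e).1 = turn c t (G.seg e.1)

namespace EulerCircuit

variable {γ : EulerCircuit c K} {t : G.Vertex → Bool}

theorem IsGivenBy.arc_pow (h : γ.IsGivenBy t) (n : ℕ) (e : Edge c K) :
    ((γ.next ^ n) e).arc = (arcPerm c t ^ n) e.arc := by
  induction n with
  | zero => rfl
  | succ n ih =>
    rw [pow_succ', pow_succ', Equiv.Perm.mul_apply, Equiv.Perm.mul_apply, ← ih]
    exact Subtype.ext (h _)

variable (γ) in
theorem isCycleOn : γ.next.IsCycleOn ((Finset.univ : Finset (Edge c K)) : Set (Edge c K)) :=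
  ⟨by simp, fun e _ e' _ => γ.single e e'⟩

variable (γ) in
theorem pow_injective (e : Edge c K) (i : ℕ) (hi : i < Nat.card (Edge c K)) (j : ℕ)
    (hj : j < Nat.card (Edge c K)) (h : (γ.next ^ i) e = (γ.next ^ j) e) : i = j := by
  rw [Nat.card_eq_fintype_card, ← Finset.card_univ] at hi hj
  exact Nat.ModEq.eq_of_lt_of_lt
    ((γ.isCycleOn.pow_apply_eq_pow_apply (Finset.mem_univ e)).1 h) hi hj

variable (γ) in
theorem exists_pow_eq (e e' : Edge c K) : ∃ n < Nat.card (Edge c K), (γ.next ^ n) e = e' := by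
  rw [Nat.card_eq_fintype_card, ← Finset.card_univ]
  exact γ.isCycleOn.exists_pow_eq (Finset.mem_univ e) (Finset.mem_univ e')

theorem comp_arcPerm_pow (n : ℕ) (e : Arc c) : G.comp ((arcPerm c t ^ n) e).1 = G.comp e.1 := by
  induction n with
  | zero => rfl
  | succ n ih => rw [pow_succ', Equiv.Perm.mul_apply, arcPerm_apply, comp_turn, comp_seg, ih]

instance : Finite (Arc c) := inferInstanceAs (Finite {h : G.Half // c.left h = true})

/-- The vertex `u` interlaces with `v` iff changing the smoothing of `v` splits the circuit into two
circuits which both visit `u`. -/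
theorem IsGivenBy.interlaced_iff (h : γ.IsGivenBy t)
    (ht : (smoothingSystem c).IsEuler Finset.univ t) {u v : G.Vertex} (hv : G.comp (G.port v 0) = K)
    (huv : v ≠ u) :
    γ.Interlaced v u ↔ ¬ (smoothingSystem c).Joined ∅ (SmoothingSystem.flip t v) u := by
  have hperm : (smoothingSystem c).perm (SmoothingSystem.flip t v) =
      Equiv.swap ((smoothingSystem c).out v) ((smoothingSystem c).out' v) * arcPerm c t :=
    (smoothingSystem c).perm_flip t v
  rw [SmoothingSystem.joined_empty_iff, hperm]
  have hpair : ∀ {a b x y : Arc c}, (x = a ∨ x = b) → (y = a ∨ y = b) → x ≠ y →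
      a = x ∧ b = y ∨ a = y ∧ b = x := by
    rintro a b x y (rfl | rfl) (rfl | rfl) hxy
    exacts [absurd rfl hxy, .inl ⟨rfl, rfl⟩, .inr ⟨rfl, rfl⟩, absurd rfl hxy]
  have hinj : ∀ e : Edge c K, ∀ i < Nat.card (Edge c K), ∀ j < Nat.card (Edge c K),
      (arcPerm c t ^ i) e.arc = (arcPerm c t ^ j) e.arc → i = j := by
    intro e i hi j hj hij
    rw [← h.arc_pow, ← h.arc_pow] at hij
    exact γ.pow_injective e i hi j hj (Edge.arc_injective hij)
  constructor
  · rintro ⟨_, e, i, j, k, hi, hij, hjk, hk, h1, h2, h3, h4⟩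
    rw [startsAt_iff] at h1 h2 h3 h4
    rw [h.arc_pow] at h2 h3 h4
    have hswap : Equiv.swap ((smoothingSystem c).out v) ((smoothingSystem c).out' v) =
        Equiv.swap e.arc ((arcPerm c t ^ j) e.arc) := by
      rcases hpair h1 h3 (fun h0 => (hi.trans hij).ne (hinj e 0 (by omega) j (by omega) h0)) with
        ⟨h5, h6⟩ | ⟨h5, h6⟩
      · rw [h5, h6]
      · rw [h5, h6, Equiv.swap_comm]
    have hiff := sameCycle_swap_mul_iff (hi.trans hij) (hjk.trans hk) (hinj e)
      ((hij.trans hjk).trans hk) hk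
    have hnot : ¬ (i < j ↔ k < j) := by omega
    rw [hswap]
    rcases hpair h2 h4 (fun h0 => (hij.trans hjk).ne (hinj e i (by omega) k hk h0)) with
      ⟨h5, h6⟩ | ⟨h5, h6⟩
    · rw [h5, h6]
      exact hiff.not.2 hnot
    · rw [h5, h6]
      exact fun h0 => hnot (hiff.1 h0.symm)
  · intro hn
    refine ⟨huv, ?_⟩
    have hu := SmoothingSystem.joined_empty_iff.1 (ht u (Finset.mem_univ u))
    change (arcPerm c t).SameCycle _ _ at hu
    have hcv : ∀ p, G.comp (G.port v p) = K := fun p => (comp_port v p 0).trans hv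
    by_cases hcu : G.comp (G.port u 0) = K
    · have hcu' : ∀ p, G.comp (G.port u p) = K := fun p => (comp_port u p 0).trans hcu
      let ev : Edge c K := ⟨((smoothingSystem c).out v).1, ((smoothingSystem c).out v).2, hcv _⟩
      let ev' : Edge c K := ⟨((smoothingSystem c).out' v).1, ((smoothingSystem c).out' v).2, hcv _⟩
      let eu : Edge c K := ⟨((smoothingSystem c).out u).1, ((smoothingSystem c).out u).2, hcu' _⟩
      let eu' : Edge c K := ⟨((smoothingSystem c).out' u).1, ((smoothingSystem c).out' u).2, hcu' _⟩
      obtain ⟨m, hm, hm'⟩ := γ.exists_pow_eq ev ev'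
      obtain ⟨i, hi, hi'⟩ := γ.exists_pow_eq ev eu
      obtain ⟨k, hk, hk'⟩ := γ.exists_pow_eq ev eu'
      have am : (smoothingSystem c).out' v = (arcPerm c t ^ m) ev.arc := by
        rw [← h.arc_pow, hm']; rfl
      have ai : (smoothingSystem c).out u = (arcPerm c t ^ i) ev.arc := by
        rw [← h.arc_pow, hi']; rfl
      have ak : (smoothingSystem c).out' u = (arcPerm c t ^ k) ev.arc := by
        rw [← h.arc_pow, hk']; rfl
      have hne : ∀ p p', (G.port v p : G.Half) ≠ G.port u p' := fun p p' h0 =>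
        huv (port_eq_iff.1 h0).1
      have hm0 : 0 < m := Nat.pos_of_ne_zero fun h0 =>
        (smoothingSystem c).out_ne v (by rw [am, h0]; rfl)
      have hi0 : 0 < i := Nat.pos_of_ne_zero fun h0 => by
        rw [h0] at ai
        exact hne _ _ (congrArg Subtype.val ai).symm
      have hk0 : 0 < k := Nat.pos_of_ne_zero fun h0 => by
        rw [h0] at ak
        exact hne _ _ (congrArg Subtype.val ak).symm
      have him : i ≠ m := fun h0 => by
        rw [h0, ← am] at ai
        exact hne _ _ (congrArg Subtype.val ai).symm
      have hkm : k ≠ m := fun h0 => by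
        rw [h0, ← am] at ak
        exact hne _ _ (congrArg Subtype.val ak).symm
      have hsv : (smoothingSystem c).out v = ev.arc := rfl
      rw [hsv, am, ai, ak, sameCycle_swap_mul_iff hm0 hm (hinj ev) hi hk] at hn
      have sv : StartsAt ev v := ⟨_, rfl⟩
      have sv' : StartsAt ((γ.next ^ m) ev) v := by rw [hm']; exact ⟨_, rfl⟩
      have su : StartsAt ((γ.next ^ i) ev) u := by rw [hi']; exact ⟨_, rfl⟩
      have su' : StartsAt ((γ.next ^ k) ev) u := by rw [hk']; exact ⟨_, rfl⟩
      rcases Nat.lt_or_ge i m with h1 | h1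
      · exact ⟨ev, i, m, k, hi0, h1, by omega, hk, sv, su, sv', su'⟩
      · exact ⟨ev, k, m, i, hk0, by omega, by omega, hi, sv, su', sv', su⟩
    · exfalso
      obtain ⟨n, hn'⟩ := hu.exists_nat_pow_eq
      refine hn ⟨n, ?_⟩
      rw [← hn', zpow_natCast]
      clear hn hn' hu
      induction n with
      | zero => rfl
      | succ n ih =>
        have hs : arcPerm c t ((arcPerm c t ^ n) ((smoothingSystem c).out u)) =
            (arcPerm c t ^ (n + 1)) ((smoothingSystem c).out u) := by
          rw [pow_succ', Equiv.Perm.mul_apply]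
        rw [pow_succ', Equiv.Perm.mul_apply, ih, Equiv.Perm.mul_apply, hs]
        have hcn := comp_arcPerm_pow (t := t) (n + 1) ((smoothingSystem c).out u)
        have hcn' : G.comp ((arcPerm c t ^ (n + 1)) ((smoothingSystem c).out u)).1 ≠ K := by
          rw [hcn]
          exact fun h0 => hcu ((comp_port u _ _).trans h0)
        refine Equiv.swap_apply_of_ne_of_ne (fun h0 => hcn' ?_) (fun h0 => hcn' ?_)
        · rw [h0]; exact hcv _
        · rw [h0]; exact hcv _

theorem IsGivenBy.live_iff (h : γ.IsGivenBy t) (ht : (smoothingSystem c).IsEuler Finset.univ t)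
    {n : ℕ} (label : G.Vertex ≃ Fin n) {v : G.Vertex} (hv : G.comp (G.port v 0) = K) :
    γ.Live label v ↔
      (smoothingSystem c).Live (fun u => (label u : ℕ)) Finset.univ t v := by
  refine forall_congr' fun u => ?_
  rw [forall_prop_of_true (Finset.mem_univ u)]
  by_cases huv : v = u
  · subst huv
    exact iff_of_true (fun h0 => absurd rfl h0.1) (fun h0 => absurd h0 (lt_irrefl _))
  · rw [h.interlaced_iff ht hv huv, Fin.lt_def]
    have h1 : (label u : ℕ) ≠ label v := fun h0 => huv (label.injective (Fin.ext h0)).symm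
    constructor
    · exact fun h2 (h3 : (label u : ℕ) < label v) => by_contra fun h4 => absurd (h2 h4) (by omega)
    · exact fun h2 h3 => by_contra fun h4 => h3 (h2 (show (label u : ℕ) < label v by omega))

/-- The marker at a vertex lies on the colored side iff the circuit turns left there. -/
theorem markerColored_iff {e : Edge c K} {v : G.Vertex} {i j : Fin 4} (hi : G.seg e.1 = G.port v i)
    (hj : (γ.next e).1 = G.port v j) : γ.MarkerColored v ↔ j = i + 1 := by
  constructor
  · rintro ⟨e', k, h1, h2⟩
    have li : c.left (G.port v i) = false := by rw [← hi, c.left_seg, e.2.1]; rfl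
    have lk : c.left (G.port v k) = false := by rw [← h1, c.left_seg, e'.2.1]; rfl
    have lj : c.left (G.port v j) = true := by rw [← hj, (γ.next e).2.1]
    have hd : ∀ d : Fin 4, d = 0 ∨ d = 1 ∨ d = 2 ∨ d = 3 := by decide
    have hji : j = i + 1 ∨ j = i + 3 := by
      obtain ⟨d, rfl⟩ : ∃ d, j = i + d := ⟨j - i, by simp⟩
      rcases hd d with rfl | rfl | rfl | rfl
      · simp [li] at lj
      · exact .inl rfl
      · simp [left_port_add_two, li] at lj
      · exact .inr rfl
    rcases hji with rfl | rfl
    · rfl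
    · exfalso
      have hki : k = i ∨ k = i + 2 := by
        obtain ⟨d, rfl⟩ : ∃ d, k = i + d := ⟨k - i, by simp⟩
        rcases hd d with rfl | rfl | rfl | rfl
        · exact .inl (by simp)
        · simp [c.left_vertex, li] at lk
        · exact .inr rfl
        · simp [left_port_add_three, li] at lk
      rcases hki with rfl | rfl
      · have he : e' = e := by
          apply Subtype.ext
          rw [← G.seg_seg e'.1, h1, ← hi, G.seg_seg]
        rw [he, hj] at h2
        simpa using (port_eq_iff.1 h2).2
      · have he : e' = e := by
          apply γ.next.injective
          apply Subtype.ext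
          rw [h2, hj, add_assoc]
          rfl
        rw [he, hi] at h1
        simpa using (port_eq_iff.1 h1).2
  · rintro rfl
    exact ⟨e, i, hi, hj⟩

end EulerCircuit

open scoped Classical in
/-- The smoothing given by Euler circuits of all components. -/
def markers (γ : ∀ K, EulerCircuit c K) (v : G.Vertex) : Bool :=
  decide ((γ (G.comp (G.port v 0))).MarkerColored v)

theorem isGivenBy_markers (γ : ∀ K, EulerCircuit c K) (K : G.Component) :
    (γ K).IsGivenBy (markers γ) := by
  intro e
  rcases (γ K).follows e with ⟨v, i, j, hi, hj⟩ | ⟨hh, ho⟩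
  · obtain rfl : G.comp (G.port v 0) = K := by
      rw [← e.2.2, ← comp_seg e.1, hi]
      exact comp_port v _ _
    have li : c.left (G.port v i) = false := by rw [← hi, c.left_seg, e.2.1]; rfl
    have lj : c.left (G.port v j) = true := by rw [← hj, ((γ _).next e).2.1]
    have hm := EulerCircuit.markerColored_iff hi hj
    have hji : j = i + 1 ∨ j = i + 3 := by
      have hd : ∀ d : Fin 4, d = 0 ∨ d = 1 ∨ d = 2 ∨ d = 3 := by decide
      obtain ⟨d, rfl⟩ : ∃ d, j = i + d := ⟨j - i, by simp⟩
      rcases hd d with rfl | rfl | rfl | rfl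
      · simp [li] at lj
      · exact .inl rfl
      · simp [left_port_add_two, li] at lj
      · exact .inr rfl
    rw [hj, hi, turn_port, li, markers]
    congr 1
    rcases hji with rfl | rfl
    · simp [hm]
    · simp [hm]
  · rw [turn_of_forall_ne _ hh, ho]

theorem isEuler_markers (γ : ∀ K, EulerCircuit c K) :
    (smoothingSystem c).IsEuler Finset.univ (markers γ) := by
  rw [isEuler_iff]
  intro e e' hee
  obtain ⟨n, -, hn⟩ := (γ (G.comp e'.1)).exists_pow_eq ⟨e.1, e.2, hee⟩ ⟨e'.1, e'.2, rfl⟩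
  refine ⟨n, ?_⟩
  rw [zpow_natCast]
  exact ((isGivenBy_markers γ _).arc_pow n _).symm.trans (congrArg Edge.arc hn)

/-- The circuits of an Eulerian smoothing. -/
def circuitOf {t : G.Vertex → Bool} (ht : (smoothingSystem c).IsEuler Finset.univ t)
    (K : G.Component) : EulerCircuit c K where
  next :=
    { toFun := fun e => ⟨turn c t (G.seg e.1), (arcPerm c t e.arc).2, by
        rw [comp_turn, comp_seg, e.2.2]⟩
      invFun := fun e => ⟨G.seg (turn c t e.1), ((arcPerm c t).symm e.arc).2, by
        rw [comp_seg, comp_turn, e.2.2]⟩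
      left_inv := fun e => Subtype.ext (by simp only [turn_turn, G.seg_seg])
      right_inv := fun e => Subtype.ext (by simp only [turn_turn, G.seg_seg]) }
  follows e := by
    change G.CanFollow (G.seg e.1) (turn c t (G.seg e.1))
    rcases exists_port_or (G.seg e.1) with ⟨v, k, hk⟩ | hh
    · rw [hk, turn_port]
      exact .inl ⟨v, _, _, rfl, rfl⟩
    · exact .inr ⟨hh, turn_of_forall_ne t hh⟩
  single e e' := by
    obtain ⟨n, hn⟩ := ((isEuler_iff t).1 ht e.arc e'.arc
      (e.2.2.trans e'.2.2.symm)).exists_nat_pow_eq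
    refine ⟨n, Edge.arc_injective ?_⟩
    rw [← hn, zpow_natCast]
    clear hn
    induction n with
    | zero => rfl
    | succ n ih =>
      rw [pow_succ', pow_succ', Equiv.Perm.mul_apply, Equiv.Perm.mul_apply, ← ih]
      rfl

theorem markers_circuitOf {t : G.Vertex → Bool}
    (ht : (smoothingSystem c).IsEuler Finset.univ t) : markers (circuitOf ht) = t := by
  funext v
  set i := outPort c v + 1 with hi
  have li : c.left (G.port v i) = false := by rw [hi, c.left_vertex, left_outPort]; rfl
  let e : Edge c (G.comp (G.port v 0)) := ⟨G.seg (G.port v i), by rw [c.left_seg, li]; rfl, by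
    rw [comp_seg]
    exact comp_port v _ _⟩
  have h1 : G.seg e.1 = G.port v i := G.seg_seg _
  have h2 : ((circuitOf ht _).next e).1 = G.port v (if false = t v then i + 3 else i + 1) := by
    change turn c t (G.seg e.1) = _
    rw [h1, turn_port, li]
  rw [markers, EulerCircuit.markerColored_iff h1 h2]
  cases t v <;> simp

theorem markers_injective :
    Function.Injective (markers : (∀ K, EulerCircuit c K) → G.Vertex → Bool) := by
  intro γ γ' h
  funext K
  apply EulerCircuit.next_injective
  ext e
  rw [isGivenBy_markers γ K e, isGivenBy_markers γ' K e, h]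

/-- The coefficient of a smoothing of a vertex, in terms of whether it joins the colored regions. -/
def smoothingWeight (sign : G.Vertex → Bool) (v : G.Vertex) (b : Bool) : ℤ[T;T⁻¹] :=
  if (b == sign v) = true then q 1 else q (-1)

/-- The weight of a vertex of an Euler circuit in terms of the corresponding smoothing: the dead
letters have the coefficient of the smoothing as weight, the live ones minus the third power of the
coefficient of the other smoothing. -/
theorem weight_letter (γ : ∀ K, EulerCircuit c K) (sign : G.Vertex → Bool) {n : ℕ}
    (label : G.Vertex ≃ Fin n) {K : G.Component} {v : G.Vertex} (hv : G.comp (G.port v 0) = K) :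
    ((γ K).letter sign label v).weight =
      (smoothingSystem c).activity (smoothingWeight sign) (fun u => (label u : ℕ)) Finset.univ
        (markers γ) v := by
  classical
  subst hv
  have h1 := (isGivenBy_markers γ _).live_iff (isEuler_markers γ) label (v := v) rfl
  have hm : (γ (G.comp (G.port v 0))).MarkerColored v ↔ markers γ v = true := by simp [markers]
  rw [EulerCircuit.letter, SmoothingSystem.activity, ← h1]
  by_cases hl : (γ (G.comp (G.port v 0))).Live label v <;> cases hk : markers γ v <;>
    cases hs : sign v <;> rw [hk] at hm <;>
    simp [hm, hl, hs, Marker.of, Letter.of, Letter.weight, smoothingWeight]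

open scoped Classical in
/-- Choosing an Euler circuit of each component amounts to choosing an Eulerian smoothing. -/
theorem prod_componentX (sign : G.Vertex → Bool) {n : ℕ} (label : G.Vertex ≃ Fin n)
    (s : G.Vertex → Bool) :
    ∏ K, componentX c sign label K =
      (smoothingSystem c).eulerSum (smoothingWeight sign) (fun u => (label u : ℕ)) Finset.univ
        s := by
  simp only [componentX]
  rw [Finset.prod_univ_sum, Fintype.piFinset_univ]
  refine Finset.sum_nbij markers (fun γ _ => ?_) (fun γ _ γ' _ h => markers_injective h)
    (fun t ht => ?_) fun γ _ => ?_
  · simpa [SmoothingSystem.mem_agreeing] using isEuler_markers γ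
  · simp only [Finset.coe_filter, Set.mem_ofPred_eq] at ht
    exact ⟨circuitOf ht.2, by simp, markers_circuitOf ht.2⟩
  · rw [← Fintype.prod_fiberwise fun v : G.Vertex => G.comp (G.port v 0)]
    refine Finset.prod_congr rfl fun K _ => ?_
    exact Finset.prod_congr rfl fun v _ => weight_letter γ sign label v.2

end VirtualGraph

namespace UnorientedDiagram

open VirtualGraph

variable (U : UnorientedDiagram) (c : U.toVirtualGraph.Coloring)

/-- The Kauffman bracket of a checkerboard-colored diagram is the polynomial of its graph. -/
theorem bracket_eq_X [Nonempty U.Half] {n : ℕ} (label : U.Vertex ≃ Fin n) :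
    U.bracket = X c (U.signOf c) label := by
  classical
  -- Multiplying by the value of a circle turns the exponents `loops - 1` and `components - 1` into
  -- the numbers of circles and of components.
  refine mul_left_cancel₀ circleValue_ne_zero ?_
  have hcomp : 1 ≤ Nat.card U.Component := one_le_classes U.compRel
  have hδ : -(q 2 + q (-2)) = circleValue := by
    rw [circleValue]
    ring
  have hq : q 1 * q (-1) = 1 := (q_mul_q _ _).trans q_zero
  have hδ' : circleValue = -q 1 ^ 2 - q (-1) ^ 2 := by
    rw [pow_two, pow_two, q_mul_q, q_mul_q, circleValue]
    change -q (-2) - q 2 = -q 2 - q (-2)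
    ring
  have key := SmoothingSystem.smoothingSum_eq (S := smoothingSystem c) (δ := circleValue)
    (w := smoothingWeight (U.signOf c)) (label := fun u => (label u : ℕ))
    (fun v b => by
      cases b <;> cases hs : U.signOf c v <;> simp [smoothingWeight, hs, hq, mul_comm (q (-1))])
    (fun v b => by
      rw [hδ']
      cases b <;> cases hs : U.signOf c v <;> simp [smoothingWeight, hs] <;> ring)
    (fun u v h => label.injective (Fin.ext h)) Finset.univ (U.signOf c)
  rw [X, hδ, ← mul_assoc, ← pow_succ', Nat.sub_add_cancel hcomp, card_component c (U.signOf c),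
    prod_componentX _ _ (U.signOf c), ← key, SmoothingSystem.smoothingSum, bracket, Finset.mul_sum]
  have hagree : SmoothingSystem.agreeing Finset.univ (U.signOf c) = Finset.univ := by
    ext t
    simp [SmoothingSystem.mem_agreeing]
  rw [hagree]
  symm
  -- A state corresponds to the smoothing which joins the colored regions where the state and the
  -- sign agree.
  have hinv : Function.Involutive fun (t : U.Vertex → Bool) v => t v == U.signOf c v := by
    intro t
    funext v
    cases h1 : t v <;> cases h2 : U.signOf c v <;> simp [h1, h2]
  refine Fintype.sum_equiv hinv.toPerm _ _ fun t => ?_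
  rw [← U.loops_eq c t, mul_left_comm]
  have h1 : 1 ≤ U.loops fun v => t v == U.signOf c v := one_le_classes (U.StateRel _)
  change _ = (∏ v, if (t v == U.signOf c v) = true then q 1 else q (-1)) *
    (circleValue * circleValue ^ _)
  rw [← pow_succ']
  congr 2
  exact (Nat.sub_add_cancel h1).symm

end UnorientedDiagram

end VirtualKnot

end

theorem corollary3p4 (L : VirtualKnot.Link) (D : VirtualKnot.Diagram) (hD : D.IsDiagramOf L)
    (c : D.shadow.Coloring) {n : ℕ} (label : D.shadow.Vertex ≃ Fin n) :
    L.IsJonesKauffman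
      (((VirtualKnot.Diagram.negQ ^ (-3 * D.writhe) : (LaurentPolynomial ℤ)ˣ) :
          LaurentPolynomial ℤ) *
        VirtualKnot.VirtualGraph.X c (D.shadowSign c) label) := by
  intro D' hD'
  have := D.nonempty
  have : Nonempty D.unoriented.Half := inferInstanceAs (Nonempty (D.P × Bool))
  rw [VirtualKnot.Diagram.jonesKauffman_eq hD' hD, VirtualKnot.Diagram.jonesKauffman,
    VirtualKnot.UnorientedDiagram.bracket_eq_X D.unoriented c label]
  rfl
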